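/- **Setting.** Let $X$ be a compact metrizable space. *Charts.* A topological Kuranishi chart $\mathbf K=(U,\mathbb E,\mathrm{pr},0,\mathfrak s,\psi)$ for $X$ consists of separable, locally compact, metrizable spaces $U$ (the domain) and $\mathbb E$, continuous maps $\mathrm{pr}:\mathbb E\to U$ and $0,\mathfrak s:U\to\mathbb E$ with $\mathrm{pr}\circ 0=\mathrm{pr}\circ\mathfrak s=\mathrm{id}_U$, and a homeomorphism $\psi$ from $\mathfrak s^{-1}(0):=\{x\in U\mid \mathfrak s(x)=0(x)\}$ onto an open subset $F\subset X$, the footprint. Restricting to an open $U'\subset U$ means replacing $\mathbb E$ by $\mathrm{pr}^{-1}(U')$ and restricting all maps. A coordinate change $\widehat\Phi_{IJ}:\mathbf K_I\to\mathbf K_J$ consists of an open $U_{IJ}\subset U_I$ with $U_{IJ}\cap\mathfrak s_I^{-1}(0)=\psi_I^{-1}(F_I\cap F_J)$ and topological embeddings $\phi_{IJ}:U_{IJ}\to U_J$, $\widehat\Phi_{IJ}:\mathrm{pr}_I^{-1}(U_{IJ})\to\mathbb E_J$ that commute with $\mathrm{pr}$, $0$, $\mathfrak s$ and $\psi$. *Atlases.*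 A weak topological Kuranishi atlas $\mathcal K$ on $X$ consists of an open cover $X=F_1\cup\dots\cup F_N$ by the footprints of basic charts, a chart $\mathbf K_I$ with footprint $F_I:=\bigcap_{i\in I}F_i$ for each $I\in\mathcal I_{\mathcal K}:=\{\emptyset\ne I\subset\{1,\dots,N\}\mid F_I\neq\emptyset\}$ (the basic charts being the $\mathbf K_{\{i\}}$), and coordinate changes $\widehat\Phi_{IJ}:\mathbf K_I\to\mathbf K_J$ for $I\subsetneq J$ in $\mathcal I_{\mathcal K}$, such that $\widehat\Phi_{JK}\circ\widehat\Phi_{IJ}=\widehat\Phi_{IK}$ for $I\subsetneq J\subsetneq K$ wherever both sides are defined (by convention $U_{II}=U_I$, $\widehat\Phi_{II}=\mathrm{id}$). It is an atlas if moreover $\phi_{IJ}^{-1}(U_{JK})\subset U_{IK}$. The realization $|\mathcal K|$ is the quotient of $\bigsqcup_I U_I$ by the equivalence relation generated by $(I,x)\sim(J,\phi_{IJ}(x))$ for $x\in U_{IJ}$, with the quotient topology; $|\mathbf E_{\mathcal K}|$ is the analogous quotient of $\bigsqcup_I\mathbb E_I$ using $\widehat\Phi_{IJ}$; $\pi_{\mathcal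 K}$ denotes the projections $U_I\to|\mathcal K|$ and $\mathbb E_I\to|\mathbf E_{\mathcal K}|$, and $|\mathrm{pr}_{\mathcal K}|:|\mathbf E_{\mathcal K}|\to|\mathcal K|$ is induced by the $\mathrm{pr}_I$. An admissible metric is a bounded metric $d$ on the set $|\mathcal K|$ whose pullback to each $U_I$ induces the topology of $U_I$; an atlas is metrizable if it has one. *Filtrations and tameness.* A filtration of $\mathcal K$ is a family of closed subsets $\mathbb E_{IJ}\subset\mathbb E_J$, for $J\in\mathcal I_{\mathcal K}$ and $I\subset J$ (including $I=\emptyset$), with (i) $\mathbb E_{JJ}=\mathbb E_J$ and $\mathbb E_{\emptyset J}=\mathrm{im}\,0_J$; (ii) $\widehat\Phi_{JK}(\mathrm{pr}_J^{-1}(U_{JK})\cap\mathbb E_{IJ})=\mathbb E_{IK}\cap\mathrm{pr}_K^{-1}(\mathrm{im}\,\phi_{JK})$ for $I\subset J\subsetneq K$; (iii) $\mathbb E_{IJ}\cap\mathbb E_{HJ}=\mathbb E_{(I\cap H)J}$; (iv) $\mathrm{im}\,\phi_{IJ}$ is open in $\mathfrak s_J^{-1}(\mathbb E_{IJ})$ for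 $I\subsetneq J$ in $\mathcal I_{\mathcal K}$. The filtered $\mathcal K$ is tame if $U_{IJ}\cap U_{IK}=U_{I(J\cup K)}$ for all $I\subset J,K$ (with $U_{I(J\cup K)}=\emptyset$ if $J\cup K\notin\mathcal I_{\mathcal K}$) and $\phi_{IJ}(U_{IK})=U_{JK}\cap\mathfrak s_J^{-1}(\mathbb E_{IJ})$ for all $I\subset J\subset K$ in $\mathcal I_{\mathcal K}$. *Shrinkings.* A shrinking $\mathcal K'$ of $\mathcal K$ is given by open sets $F_i'$ covering $X$, with compact closure contained in $F_i$ and with $F'_I\ne\emptyset$ whenever $F_I\neq\emptyset$, and open sets $U_I'\subset U_I$ with compact closure in $U_I$ and $U_I'\cap\mathfrak s_I^{-1}(0)=\psi_I^{-1}(F_I')$; it has the charts $\mathbf K_I|_{U_I'}$ and the coordinate changes restricted to $U'_{IJ}=U_I'\cap\phi_{IJ}^{-1}(U_J')$, and is a weak atlas with $\mathcal I_{\mathcal K'}=\mathcal I_{\mathcal K}$. If $\mathcal K$ is filtered, $\mathcal K'$ carries the canonical filtration $\mathbb E_{IJ}\cap\mathrm{pr}_J^{-1}(U'_J)$. A tame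 shrinking is a shrinking that is an atlas and is tame with its canonical filtration. It is preshrunk if it is also a shrinking of an intermediate tame shrinking of $\mathcal K$. *Concordances.* For $\alpha\in\{0,1\}$ and $\varepsilon\in(0,\frac12)$ let $A^0_\varepsilon=[0,\varepsilon)$ and $A^1_\varepsilon=(1-\varepsilon,1]$. A concordance from an atlas $\mathcal K^0$ to an atlas $\mathcal K^1$ on $X$ is an atlas $\mathcal C$ on $[0,1]\times X$ such that for some $\varepsilon$ and $\alpha=0,1$: * every footprint satisfies $(t,p)\in F_I\Leftrightarrow(\alpha,p)\in F_I$ for all $t\in A^\alpha_\varepsilon$, $p\in X$; * an injection of basic indices identifies $\mathcal I_{\mathcal K^\alpha}$ with $\{I\in\mathcal I_{\mathcal C}\mid F_I\cap(\{\alpha\}\times X)\ne\emptyset\}$, and under it $F_I\cap(\{\alpha\}\times X)=\{\alpha\}\times F^\alpha_I$; * for $I\in\mathcal I_{\mathcal K^\alpha}$ there are open embeddings $\iota^\alpha_{U_I}:A^\alpha_\varepsilon\times U_I^\alpha\to U_I$ and $\iota^\alpha_{\mathbb E_I}:A^\alpha_\varepsilon\times\mathbb E_I^\alpha\to\mathbb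 E_I$ (whose restrictions to $t=\alpha$ have closed images), with disjoint images for the two ends of a chart, which intertwine the projections, zero sections, sections and footprint maps with those of the product chart $A^\alpha_\varepsilon\times\mathbf K_I^\alpha$; * for $I\subset J$ in $\mathcal I_{\mathcal K^\alpha}$, $\widehat\Phi_{IJ}$ pulls back under the collar embeddings to $\mathrm{id}_{A^\alpha_\varepsilon}\times\widehat\Phi^\alpha_{IJ}$, with $(\iota^\alpha_{U_I})^{-1}(U_{IJ})=A^\alpha_\varepsilon\times U^\alpha_{IJ}$ and $(\iota^\alpha_{U_J})^{-1}(\mathrm{im}\,\phi_{IJ})=A^\alpha_\varepsilon\times\mathrm{im}\,\phi^\alpha_{IJ}$; if $I\in\mathcal I_{\mathcal K^\alpha}$ and $I\subset J\notin\mathcal I_{\mathcal K^\alpha}$, then $U_{IJ}\cap\mathrm{im}\,\iota^\alpha_{U_I}=\emptyset$. If $\mathcal K^0,\mathcal K^1$ are filtered, a filtration of $\mathcal C$ restricts to the given ones if for $I\subset J\in\mathcal I_{\mathcal K^\alpha}$ one has $(\iota^\alpha_{\mathbb E_J}(\alpha,\cdot))^{-1}(\mathbb E_{IJ})=\mathbb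 E^\alpha_{IJ}$ and, for some $\delta\in(0,\varepsilon]$, $\iota^\alpha_{\mathbb E_J}(A^\alpha_\delta\times\mathbb E_{IJ}^\alpha)=\mathbb E_{IJ}\cap\mathrm{pr}_J^{-1}(\iota^\alpha_{U_J}(A_\delta^\alpha\times U_J^\alpha))$. For metrics $d^\alpha$ on $|\mathcal K^\alpha|$, a metric $D$ on $|\mathcal C|$ is collared with restrictions $d^\alpha$ if for some $\delta\in(0,\varepsilon]$ and $\alpha=0,1$, writing $[t,x]:=[I,\iota^\alpha_{U_I}(t,x')]\in|\mathcal C|$ for $t\in A^\alpha_\delta$ and $x=[I,x']\in|\mathcal K^\alpha|$, one has $D([t,x],[t',y])=|t-t'|+d^\alpha(x,y)$, and $D(p,[t,x])\ge\delta-|t-\alpha|$ for all $p\in|\mathcal C|$ that are not of the form $[s,y]$ with $s\in A_\delta^\alpha$, $y\in|\mathcal K^\alpha|$. **Theorem.** Let $\mathcal K$ be a filtered weak topological Kuranishi atlas on a compact metrizable space $X$. 1. There exists a preshrunk tame shrinking of $\mathcal K$. 2. Every preshrunk tame shrinking $\mathcal K'$ of $\mathcal K$, with domains $U'_I\subset U_I$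 and $\mathbb E'_I=\mathrm{pr}_I^{-1}(U_I')$, is a metrizable tame topological Kuranishi atlas. The realizations $|\mathcal K'|$ and $|\mathbf E_{\mathcal K'}|$ are Hausdorff in the quotient topology; for each $I\in\mathcal I_{\mathcal K'}=\mathcal I_{\mathcal K}$ the projections $\pi_{\mathcal K'}:U_I'\to|\mathcal K'|$ and $\pi_{\mathcal K'}:\mathbb E_I'\to|\mathbf E_{\mathcal K'}|$ are homeomorphisms onto their images; and $|\mathrm{pr}_{\mathcal K'}|$ is continuous with $|\mathrm{pr}_{\mathcal K'}|\circ\pi_{\mathcal K'}=\pi_{\mathcal K'}\circ\mathrm{pr}_I$ on $\mathbb E'_I$. 3. For any two preshrunk tame shrinkings $\mathcal K^0,\mathcal K^1$ of $\mathcal K$ with admissible metrics $d^0,d^1$ on $|\mathcal K^0|,|\mathcal K^1|$ there are a concordance $\mathcal C$ from $\mathcal K^0$ to $\mathcal K^1$ that is an atlas on $[0,1]\times X$, a filtration of $\mathcal C$ that restricts to the canonical filtrations of $\mathcal K^0,\mathcal K^1$ and with respect to which $\mathcal C$ is tame, and an admissible metric on $|\mathcal C|$ that is collared with restrictions $d^0,d^1$;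 and $\mathcal C$ has the Hausdorff, homeomorphism and compatibility properties stated in 2. -/

import Mathlib

open Set Topology TopologicalSpace

universe u v

namespace Kuranishi

/-- A topological Kuranishi chart for `X`: domain `U`, obstruction "bundle" `pr : E → U` with zero
section, a section `sec`, and a footprint map `ψ` from the zero set of `sec` which is a homeomorphism
onto an open subset of `X`, the footprint. -/
structure KChart (X : Type u) [TopologicalSpace X] : Type (max u (v + 1)) where
  U : Type v
  E : Type v
  [topU : TopologicalSpace U]
  [metU : MetrizableSpace U]
  [sepU : SeparableSpace U]
  [lcU : LocallyCompactSpace U]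
  [topE : TopologicalSpace E]
  [metE : MetrizableSpace E]
  [sepE : SeparableSpace E]
  [lcE : LocallyCompactSpace E]
  pr : E → U
  zero : U → E
  sec : U → E
  continuous_pr : Continuous pr
  continuous_zero : Continuous zero
  continuous_sec : Continuous sec
  pr_zero : ∀ x, pr (zero x) = x
  pr_sec : ∀ x, pr (sec x) = x
  ψ : {x : U // sec x = zero x} → X
  isOpenEmbedding_ψ : IsOpenEmbedding ψ

attribute [instance] KChart.topU KChart.metU KChart.sepU KChart.lcU
  KChart.topE KChart.metE KChart.sepE KChart.lcE

namespace KChart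

variable {X : Type u} [TopologicalSpace X]

/-- The footprint of a chart. -/
def foot (K : KChart.{u, v} X) : Set X := range K.ψ

theorem zero_mem (K : KChart.{u, v} X) {V : Set K.U} {x : K.U} (hx : x ∈ V) :
    K.zero x ∈ K.pr ⁻¹' V := by
  rw [mem_preimage, K.pr_zero]; exact hx

theorem sec_mem (K : KChart.{u, v} X) {V : Set K.U} {x : K.U} (hx : x ∈ V) :
    K.sec x ∈ K.pr ⁻¹' V := by
  rw [mem_preimage, K.pr_sec]; exact hx

/-- The restriction of a chart to an open subset `V` of its domain. -/
abbrev restrict (K : KChart.{u, v} X) (V : Set K.U) (hV : IsOpen V) : KChart.{u, v} X where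
  U := V
  E := ↥(K.pr ⁻¹' V)
  sepU := hV.isOpenEmbedding_subtypeVal.separableSpace
  lcU := hV.isOpenEmbedding_subtypeVal.locallyCompactSpace
  sepE := (hV.preimage K.continuous_pr).isOpenEmbedding_subtypeVal.separableSpace
  lcE := (hV.preimage K.continuous_pr).isOpenEmbedding_subtypeVal.locallyCompactSpace
  pr e := ⟨K.pr e.1, e.2⟩
  zero x := ⟨K.zero x.1, K.zero_mem x.2⟩
  sec x := ⟨K.sec x.1, K.sec_mem x.2⟩
  continuous_pr := (K.continuous_pr.comp continuous_subtype_val).subtype_mk _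
  continuous_zero := (K.continuous_zero.comp continuous_subtype_val).subtype_mk _
  continuous_sec := (K.continuous_sec.comp continuous_subtype_val).subtype_mk _
  pr_zero x := Subtype.ext (K.pr_zero x.1)
  pr_sec x := Subtype.ext (K.pr_sec x.1)
  ψ x := K.ψ ⟨x.1.1, congrArg Subtype.val x.2⟩
  isOpenEmbedding_ψ := by
    refine K.isOpenEmbedding_ψ.comp ⟨?_, ?_⟩
    · refine IsEmbedding.of_comp (g := Subtype.val) (by fun_prop) continuous_subtype_val ?_
      exact (IsEmbedding.subtypeVal (p := (· ∈ V))).comp IsEmbedding.subtypeVal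
    · convert hV.preimage (continuous_subtype_val (p := fun x : K.U => K.sec x = K.zero x))
      ext x
      constructor
      · rintro ⟨y, rfl⟩; exact y.1.2
      · intro hx; exact ⟨⟨⟨x.1, hx⟩, Subtype.ext x.2⟩, rfl⟩

end KChart

/-- A topological coordinate change between charts: an open domain `dom` (the restriction of the
first chart to the intersection of the footprints), and a topological embedding `Φ` of bundles over
a topological embedding `φ`, compatible with projections, zero sections, sections and footprints. -/
structure CoordChange {X : Type u} [TopologicalSpace X] (K L : KChart.{u, v} X) where
  dom : Set K.U
  isOpen_dom : IsOpen dom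
  mem_dom_iff : ∀ x : {x : K.U // K.sec x = K.zero x}, x.1 ∈ dom ↔ K.ψ x ∈ K.foot ∩ L.foot
  φ : dom → L.U
  isEmbedding_φ : IsEmbedding φ
  Φ : ↥(K.pr ⁻¹' dom) → L.E
  isEmbedding_Φ : IsEmbedding Φ
  pr_Φ : ∀ e, L.pr (Φ e) = φ ⟨K.pr e.1, e.2⟩
  zero_φ : ∀ x : dom, L.zero (φ x) = Φ ⟨K.zero x.1, K.zero_mem x.2⟩
  sec_φ : ∀ x : dom, L.sec (φ x) = Φ ⟨K.sec x.1, K.sec_mem x.2⟩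
  ψ_φ : ∀ (x : dom) (hx : K.sec x.1 = K.zero x.1) (hy : L.sec (φ x) = L.zero (φ x)),
    L.ψ ⟨φ x, hy⟩ = K.ψ ⟨x.1, hx⟩

namespace CoordChange

variable {X : Type u} [TopologicalSpace X] {K L : KChart.{u, v} X}

/-- The restriction of a coordinate change to restrictions of the two charts to open subsets `V`,
`W` of their domains; its domain is `V ∩ φ⁻¹(W)`. -/
def restrict (c : CoordChange K L) (V : Set K.U) (hV : IsOpen V) (W : Set L.U) (hW : IsOpen W) :
    CoordChange (K.restrict V hV) (L.restrict W hW) where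
  dom := {x : V | ∃ h : x.1 ∈ c.dom, c.φ ⟨x.1, h⟩ ∈ W}
  isOpen_dom := by
    obtain ⟨O, hO, hOW⟩ := isOpen_induced_iff.1 (hW.preimage c.isEmbedding_φ.continuous)
    convert (hO.inter c.isOpen_dom).preimage (continuous_subtype_val (p := (· ∈ V))) using 1
    ext x
    constructor
    · rintro ⟨h, hx⟩
      exact ⟨(Set.ext_iff.1 hOW ⟨x.1, h⟩).2 hx, h⟩
    · rintro ⟨h1, h⟩
      exact ⟨h, (Set.ext_iff.1 hOW ⟨x.1, h⟩).1 h1⟩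
  mem_dom_iff := by
    intro x
    have hx0 : K.sec x.1.1 = K.zero x.1.1 := congrArg Subtype.val x.2
    constructor
    · rintro ⟨h, hW'⟩
      have hy : L.sec (c.φ ⟨x.1.1, h⟩) = L.zero (c.φ ⟨x.1.1, h⟩) := by
        rw [c.sec_φ, c.zero_φ]; congr 2
      exact ⟨⟨x, rfl⟩, ⟨⟨⟨_, hW'⟩, Subtype.ext hy⟩, c.ψ_φ ⟨x.1.1, h⟩ hx0 hy⟩⟩
    · rintro ⟨-, ⟨z, hz⟩⟩
      have hz' : L.ψ ⟨z.1.1, congrArg Subtype.val z.2⟩ = K.ψ ⟨x.1.1, hx0⟩ := hz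
      have h : x.1.1 ∈ c.dom := (c.mem_dom_iff ⟨x.1.1, hx0⟩).2 ⟨⟨_, rfl⟩, ⟨_, hz'⟩⟩
      have hy : L.sec (c.φ ⟨x.1.1, h⟩) = L.zero (c.φ ⟨x.1.1, h⟩) := by
        rw [c.sec_φ, c.zero_φ]; congr 2
      have := L.isOpenEmbedding_ψ.injective ((c.ψ_φ ⟨x.1.1, h⟩ hx0 hy).trans hz'.symm)
      refine ⟨h, ?_⟩
      have h2 : c.φ ⟨x.1.1, h⟩ = z.1.1 := congrArg Subtype.val this
      rw [h2]
      exact z.1.2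
  φ x := ⟨c.φ ⟨x.1.1, x.2.fst⟩, x.2.snd⟩
  isEmbedding_φ := by
    have h1 : IsEmbedding (fun x : {x : V | ∃ h : x.1 ∈ c.dom, c.φ ⟨x.1, h⟩ ∈ W} =>
        (⟨x.1.1, x.2.fst⟩ : c.dom)) := by
      refine IsEmbedding.of_comp (g := Subtype.val) (by fun_prop) continuous_subtype_val ?_
      exact (IsEmbedding.subtypeVal (p := (· ∈ V))).comp IsEmbedding.subtypeVal
    have h2 := c.isEmbedding_φ.comp h1
    exact IsEmbedding.of_comp (h2.continuous.subtype_mk _) continuous_subtype_val h2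
  Φ e := ⟨c.Φ ⟨e.1.1, e.2.fst⟩, by
    rw [mem_preimage, c.pr_Φ]; exact e.2.snd⟩
  isEmbedding_Φ := by
    have h1 : IsEmbedding (fun e : ↥((K.restrict V hV).pr ⁻¹'
        {x : V | ∃ h : x.1 ∈ c.dom, c.φ ⟨x.1, h⟩ ∈ W}) =>
        (⟨e.1.1, e.2.fst⟩ : ↥(K.pr ⁻¹' c.dom))) := by
      refine IsEmbedding.of_comp (g := Subtype.val)
        ((continuous_subtype_val.comp continuous_subtype_val).subtype_mk _)
        continuous_subtype_val ?_
      exact (IsEmbedding.subtypeVal (p := (· ∈ K.pr ⁻¹' V))).comp IsEmbedding.subtypeVal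
    have h2 := c.isEmbedding_Φ.comp h1
    exact IsEmbedding.of_comp (h2.continuous.subtype_mk _) continuous_subtype_val h2
  pr_Φ e := Subtype.ext (c.pr_Φ _)
  zero_φ x := Subtype.ext (c.zero_φ _)
  sec_φ x := Subtype.ext (c.sec_φ _)
  ψ_φ x hx hy := c.ψ_φ ⟨x.1.1, x.2.fst⟩ (congrArg Subtype.val hx) (congrArg Subtype.val hy)

end CoordChange

/-- A weak topological Kuranishi atlas on `X`. `F i` are the footprints of the basic charts, `idx` is
the index set of all nonempty `I` with `⋂ i ∈ I, F i ≠ ∅`; the basic chart with nonempty footprint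
`F i` is the chart with index `{i}`. The coordinate change for `I = J` is the identity, which is the
usual notational convention. -/
structure WeakAtlas (X : Type u) [TopologicalSpace X] : Type (max u (v + 1)) where
  N : ℕ
  F : Fin N → Set X
  isOpen_F : ∀ i, IsOpen (F i)
  cover_F : ⋃ i, F i = univ
  idx : Set (Finset (Fin N))
  mem_idx : ∀ I, I ∈ idx ↔ I.Nonempty ∧ (⋂ i ∈ I, F i).Nonempty
  chart : idx → KChart.{u, v} X
  foot_chart : ∀ I : idx, (chart I).foot = ⋂ i ∈ I.1, F i
  coord : ∀ {I J : idx}, I ≤ J → CoordChange (chart I) (chart J)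
  dom_refl : ∀ I : idx, (coord (le_refl I)).dom = univ
  φ_refl : ∀ (I : idx) x, (coord (le_refl I)).φ x = x.1
  Φ_refl : ∀ (I : idx) e, (coord (le_refl I)).Φ e = e.1
  /-- `Φ_JK ∘ Φ_IJ = Φ_IK` on the overlap of the domains. -/
  weak_cocycle : ∀ {I J K : idx} (hIJ : I ≤ J) (hJK : J ≤ K) (e : (chart I).E)
    (h₁ : e ∈ (chart I).pr ⁻¹' (coord hIJ).dom)
    (h₂ : (coord hIJ).Φ ⟨e, h₁⟩ ∈ (chart J).pr ⁻¹' (coord hJK).dom)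
    (h₃ : e ∈ (chart I).pr ⁻¹' (coord (hIJ.trans hJK)).dom),
    (coord hJK).Φ ⟨(coord hIJ).Φ ⟨e, h₁⟩, h₂⟩ = (coord (hIJ.trans hJK)).Φ ⟨e, h₃⟩

namespace WeakAtlas

variable {X : Type u} [TopologicalSpace X]

/-- A weak atlas is a topological Kuranishi atlas if it satisfies the cocycle condition, i.e. in
addition to the equality on overlaps one has `φ_IJ⁻¹(U_JK) ⊆ U_IK`. -/
def IsAtlas (K : WeakAtlas.{u, v} X) : Prop :=
  ∀ (I J L : K.idx) (hIJ : I ≤ J) (hJL : J ≤ L) (x : (K.coord hIJ).dom),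
    (K.coord hIJ).φ x ∈ (K.coord hJL).dom → x.1 ∈ (K.coord (hIJ.trans hJL)).dom

/-- Objects of the domain category. -/
abbrev ObjB (K : WeakAtlas.{u, v} X) : Type v := Σ I : K.idx, (K.chart I).U

/-- Objects of the obstruction category. -/
abbrev ObjE (K : WeakAtlas.{u, v} X) : Type v := Σ I : K.idx, (K.chart I).E

/-- `MorB p q` means that there is a morphism from `p` to `q` in the domain category. -/
def MorB (K : WeakAtlas.{u, v} X) (p q : K.ObjB) : Prop :=
  ∃ (h : p.1 ≤ q.1) (hx : p.2 ∈ (K.coord h).dom), (K.coord h).φ ⟨p.2, hx⟩ = q.2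

/-- `MorE p q` means that there is a morphism from `p` to `q` in the obstruction category. -/
def MorE (K : WeakAtlas.{u, v} X) (p q : K.ObjE) : Prop :=
  ∃ (h : p.1 ≤ q.1) (he : p.2 ∈ (K.chart p.1).pr ⁻¹' (K.coord h).dom),
    (K.coord h).Φ ⟨p.2, he⟩ = q.2

/-- The realization `|K|`: quotient by the equivalence relation generated by the morphisms, with
the quotient topology. -/
abbrev RealB (K : WeakAtlas.{u, v} X) : Type v := Quot K.MorB

/-- The realization `|E_K|`, with the quotient topology. -/
abbrev RealE (K : WeakAtlas.{u, v} X) : Type v := Quot K.MorE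

/-- The projection `U_I → |K|`. -/
def πB (K : WeakAtlas.{u, v} X) (I : K.idx) (x : (K.chart I).U) : K.RealB := Quot.mk _ ⟨I, x⟩

/-- The projection `E_I → |E_K|`. -/
def πE (K : WeakAtlas.{u, v} X) (I : K.idx) (e : (K.chart I).E) : K.RealE := Quot.mk _ ⟨I, e⟩

/-- The map `|pr_K| : |E_K| → |K|` induced by the projections `pr_I`. -/
def prReal (K : WeakAtlas.{u, v} X) : K.RealE → K.RealB :=
  Quot.map (fun p => ⟨p.1, (K.chart p.1).pr p.2⟩) (by
    rintro ⟨I, e⟩ ⟨J, f⟩ ⟨h, he, hf⟩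
    exact ⟨h, he, by rw [← (K.coord h).pr_Φ ⟨e, he⟩, hf]⟩)

/-- The Hausdorff and homeomorphism properties of an atlas: both realizations are Hausdorff in the
quotient topology, the projections from the charts are homeomorphisms onto their images, and they
are compatible with the (continuous) bundle projections. -/
def HausdorffHomeo (K : WeakAtlas.{u, v} X) : Prop :=
  T2Space K.RealB ∧ T2Space K.RealE ∧
  (∀ I : K.idx, IsEmbedding (K.πB I)) ∧ (∀ I : K.idx, IsEmbedding (K.πE I)) ∧
  Continuous K.prReal ∧
  ∀ (I : K.idx) (e : (K.chart I).E), K.prReal (K.πE I e) = K.πB I ((K.chart I).pr e)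

/-- `d` is an admissible metric on `|K|`: a bounded metric whose pullback to each `U_I` induces the
given topology of `U_I`. -/
structure IsAdmissibleMetric (K : WeakAtlas.{u, v} X) (d : K.RealB → K.RealB → ℝ) : Prop where
  eq_zero_iff : ∀ p q, d p q = 0 ↔ p = q
  symm : ∀ p q, d p q = d q p
  triangle : ∀ p q r, d p r ≤ d p q + d q r
  bounded : ∃ C, ∀ p q, d p q ≤ C
  isOpen_iff : ∀ (I : K.idx) (V : Set (K.chart I).U),
    IsOpen V ↔ ∀ x ∈ V, ∃ δ > 0, ∀ y, d (K.πB I x) (K.πB I y) < δ → y ∈ V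

/-- A filtration: closed subsets `sub I J` (written `E_IJ` in the literature) of `E_J` for all
`I ⊆ J`, including `I = ∅`. Only the values with `I ⊆ J` are meaningful. -/
structure Filtration (K : WeakAtlas.{u, v} X) where
  sub : Finset (Fin K.N) → ∀ J : K.idx, Set (K.chart J).E
  isClosed_sub : ∀ (I : Finset (Fin K.N)) (J : K.idx), I ⊆ J.1 → IsClosed (sub I J)
  sub_self : ∀ J : K.idx, sub J.1 J = univ
  sub_empty : ∀ J : K.idx, sub ∅ J = range (K.chart J).zero
  image_sub : ∀ (I : Finset (Fin K.N)) (J L : K.idx) (hJL : J < L), I ⊆ J.1 →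
    (K.coord hJL.le).Φ '' {e | e.1 ∈ sub I J} =
      sub I L ∩ (K.chart L).pr ⁻¹' range (K.coord hJL.le).φ
  inter_sub : ∀ (I H : Finset (Fin K.N)) (J : K.idx), I ⊆ J.1 → H ⊆ J.1 →
    sub I J ∩ sub H J = sub (I ∩ H) J
  /-- `im φ_IJ` is an open subset of `s_J⁻¹(E_IJ)`. -/
  isOpen_range : ∀ (I J : K.idx) (hIJ : I < J), ∃ O : Set (K.chart J).U, IsOpen O ∧
    range (K.coord hIJ.le).φ = O ∩ (K.chart J).sec ⁻¹' sub I.1 J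

/-- Tameness of a weak atlas with respect to a filtration:
`U_IJ ∩ U_IL = U_I(J∪L)` (which is empty if `J ∪ L` is not in the index set) for `I ⊆ J, L`, and
`φ_IJ(U_IL) = U_JL ∩ s_J⁻¹(E_IJ)` for `I ⊆ J ⊆ L`. -/
structure IsTame (K : WeakAtlas.{u, v} X) (𝓔 : K.Filtration) : Prop where
  inter_dom : ∀ (I J L : K.idx) (hIJ : I ≤ J) (hIL : I ≤ L) (x : (K.chart I).U),
    x ∈ (K.coord hIJ).dom ∩ (K.coord hIL).dom ↔
      ∃ h : J.1 ∪ L.1 ∈ K.idx,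
        x ∈ (K.coord (J := ⟨J.1 ∪ L.1, h⟩) (hIJ.trans Finset.subset_union_left)).dom
  image_dom : ∀ (I J L : K.idx) (hIJ : I ≤ J) (hJL : J ≤ L),
    (K.coord hIJ).φ '' {x | x.1 ∈ (K.coord (hIJ.trans hJL)).dom} =
      (K.coord hJL).dom ∩ (K.chart J).sec ⁻¹' 𝓔.sub I.1 J

/-- A shrinking of a weak atlas, given by a shrinking of the footprint cover and precompact open
subsets `U I` of the domains whose footprints are the intersections of the shrunk basic footprints.
The induced atlas is `Shrinking.atlas`. -/
structure Shrinking (K : WeakAtlas.{u, v} X) where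
  F : Fin K.N → Set X
  isOpen_F : ∀ i, IsOpen (F i)
  closure_F : ∀ i, IsCompact (closure (F i)) ∧ closure (F i) ⊆ K.F i
  cover_F : ⋃ i, F i = univ
  nonempty_F : ∀ I : Finset (Fin K.N), (⋂ i ∈ I, K.F i).Nonempty → (⋂ i ∈ I, F i).Nonempty
  U : ∀ I : K.idx, Set (K.chart I).U
  isOpen_U : ∀ I, IsOpen (U I)
  isCompact_closure_U : ∀ I, IsCompact (closure (U I))
  mem_U_iff : ∀ (I : K.idx) (x : {x // (K.chart I).sec x = (K.chart I).zero x}),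
    x.1 ∈ U I ↔ (K.chart I).ψ x ∈ ⋂ i ∈ I.1, F i

namespace Shrinking

variable {K : WeakAtlas.{u, v} X}

theorem inter_F_subset (S : K.Shrinking) (I : Finset (Fin K.N)) :
    (⋂ i ∈ I, S.F i) ⊆ ⋂ i ∈ I, K.F i :=
  iInter₂_mono fun i _ => subset_closure.trans (S.closure_F i).2

/-- The weak atlas obtained by restricting all charts to `U I`, with coordinate changes restricted
to `U_I' ∩ φ_IJ⁻¹(U_J')`. Its index set is that of the original atlas. -/
def atlas (S : K.Shrinking) : WeakAtlas.{u, v} X where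
  N := K.N
  F := S.F
  isOpen_F := S.isOpen_F
  cover_F := S.cover_F
  idx := K.idx
  mem_idx I := by
    rw [K.mem_idx]
    exact and_congr_right fun _ => ⟨S.nonempty_F I, fun h => h.mono (S.inter_F_subset I)⟩
  chart I := (K.chart I).restrict (S.U I) (S.isOpen_U I)
  foot_chart I := by
    ext p
    constructor
    · rintro ⟨x, rfl⟩
      exact (S.mem_U_iff I ⟨x.1.1, congrArg Subtype.val x.2⟩).1 x.1.2
    · intro hp
      have hp' : p ∈ (K.chart I).foot := by rw [K.foot_chart]; exact S.inter_F_subset _ hp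
      obtain ⟨x, rfl⟩ := hp'
      exact ⟨⟨⟨x.1, (S.mem_U_iff I x).2 hp⟩, Subtype.ext x.2⟩, rfl⟩
  coord {I J} h := (K.coord h).restrict (S.U I) (S.isOpen_U I) (S.U J) (S.isOpen_U J)
  dom_refl I := by
    ext x
    simp only [mem_univ, iff_true]
    have hx : x.1 ∈ (K.coord (le_refl I)).dom := by rw [K.dom_refl]; trivial
    refine ⟨hx, ?_⟩
    rw [K.φ_refl]
    exact x.2
  φ_refl I x := Subtype.ext (K.φ_refl I _)
  Φ_refl I e := Subtype.ext (K.Φ_refl I _)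
  weak_cocycle hIJ hJL e h₁ h₂ h₃ :=
    Subtype.ext (K.weak_cocycle hIJ hJL e.1 h₁.fst h₂.fst h₃.fst)

/-- The canonical filtration `E_IJ ∩ pr_J⁻¹(U_J')` of a shrinking of a filtered weak atlas. -/
def filtration (S : K.Shrinking) (𝓔 : K.Filtration) : S.atlas.Filtration where
  sub I J := {e | e.1 ∈ 𝓔.sub I J}
  isClosed_sub I J h := (𝓔.isClosed_sub I J h).preimage continuous_subtype_val
  sub_self J := by
    ext e
    simp only [mem_ofPred_eq, mem_univ, iff_true]
    exact (Set.ext_iff.1 (𝓔.sub_self J) e.1).2 trivial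
  sub_empty J := by
    ext e
    have := Set.ext_iff.1 (𝓔.sub_empty J) e.1
    refine this.trans ⟨?_, ?_⟩
    · rintro ⟨x, hx⟩
      have hxU : x ∈ S.U J := by
        have := e.2
        rw [← hx, mem_preimage, KChart.pr_zero] at this
        exact this
      exact ⟨⟨x, hxU⟩, Subtype.ext hx⟩
    · rintro ⟨x, rfl⟩
      exact ⟨x.1, rfl⟩
  image_sub I J L hJL hI := by
    have key := Set.ext_iff.1 (𝓔.image_sub I J L hJL hI)
    ext f
    constructor
    · rintro ⟨e, he, rfl⟩
      refine ⟨((key _).1 ⟨⟨e.1.1, e.2.fst⟩, he, rfl⟩).1, ?_⟩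
      exact ⟨⟨⟨_, e.1.2⟩, e.2⟩,
        Subtype.ext ((K.coord hJL.le).pr_Φ ⟨e.1.1, e.2.fst⟩).symm⟩
    · rintro ⟨hf, ⟨x, hx⟩⟩
      have hx' : (K.coord hJL.le).φ ⟨x.1.1, x.2.fst⟩ = (K.chart L).pr f.1 :=
        congrArg Subtype.val hx
      obtain ⟨e, he, hef⟩ := (key f.1).2 ⟨hf, ⟨_, hx'⟩⟩
      have hpe : (⟨(K.chart J).pr e.1, e.2⟩ : (K.coord hJL.le).dom) = ⟨x.1.1, x.2.fst⟩ := by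
        apply (K.coord hJL.le).isEmbedding_φ.injective
        rw [← (K.coord hJL.le).pr_Φ, hef, hx']
      have hpe' : (K.chart J).pr e.1 = x.1.1 := congrArg Subtype.val hpe
      have heU : e.1 ∈ (K.chart J).pr ⁻¹' S.U J := by
        rw [mem_preimage, hpe']; exact x.1.2
      refine ⟨⟨⟨e.1, heU⟩, ⟨e.2, ?_⟩⟩, he, Subtype.ext hef⟩
      change (K.coord hJL.le).φ ⟨(K.chart J).pr e.1, e.2⟩ ∈ S.U L
      rw [hpe]
      exact x.2.snd
  inter_sub I H J hI hH := by
    ext e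
    exact Set.ext_iff.1 (𝓔.inter_sub I H J hI hH) e.1
  isOpen_range I J hIJ := by
    obtain ⟨O, hO, hr⟩ := 𝓔.isOpen_range I J hIJ
    have hemb := (K.coord hIJ.le).isEmbedding_φ
    obtain ⟨W, hW, hWr⟩ := hemb.isInducing.isOpen_iff.1
      ((S.isOpen_U I).preimage (continuous_subtype_val (p := (· ∈ (K.coord hIJ.le).dom))))
    refine ⟨Subtype.val ⁻¹' (O ∩ W), (hO.inter hW).preimage continuous_subtype_val, ?_⟩
    ext y
    have key := Set.ext_iff.1 hr y.1
    constructor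
    · rintro ⟨x, rfl⟩
      obtain ⟨h1, h2⟩ := key.1 ⟨⟨x.1.1, x.2.fst⟩, rfl⟩
      exact ⟨⟨h1, (Set.ext_iff.1 hWr ⟨x.1.1, x.2.fst⟩).2 x.1.2⟩, h2⟩
    · rintro ⟨⟨h1, h2⟩, h3⟩
      obtain ⟨x, hx⟩ := key.2 ⟨h1, h3⟩
      have hxU : x.1 ∈ S.U I := by
        refine (Set.ext_iff.1 hWr x).1 ?_
        rw [mem_preimage, hx]; exact h2
      refine ⟨⟨⟨x.1, hxU⟩, ⟨x.2, ?_⟩⟩, Subtype.ext hx⟩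
      change (K.coord hIJ.le).φ x ∈ S.U J
      rw [hx]; exact y.2

/-- A tame shrinking of a filtered weak atlas: the shrunk atlas is a topological Kuranishi atlas
which is tame with respect to its canonical filtration. -/
def IsTame (S : K.Shrinking) (𝓔 : K.Filtration) : Prop :=
  S.atlas.IsAtlas ∧ S.atlas.IsTame (S.filtration 𝓔)

/-- `S` is a shrinking of the intermediate shrinking `S'`, i.e. its domains are those of a shrinking
of the atlas of `S'`. -/
def IsShrinkingOf (S S' : K.Shrinking) : Prop :=
  ∃ T : S'.atlas.Shrinking, T.F = S.F ∧
    ∀ I : K.idx, S.U I = Subtype.val '' (show Set (S'.U I) from T.U I)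

/-- A preshrunk tame shrinking: a tame shrinking that is also a shrinking of an intermediate tame
shrinking. -/
def IsPreshrunkTame (S : K.Shrinking) (𝓔 : K.Filtration) : Prop :=
  S.IsTame 𝓔 ∧ ∃ S' : K.Shrinking, S'.IsTame 𝓔 ∧ S.IsShrinkingOf S'

end Shrinking

end WeakAtlas

/-- The endpoints `0` and `1` of the unit interval. -/
def endpt (α : Fin 2) : unitInterval := if α = 0 then 0 else 1

/-- The collar `[0, ε)` resp. `(1 - ε, 1]` of an endpoint of the unit interval. -/
def collar (α : Fin 2) (ε : ℝ) : Set unitInterval := {t | |(t : ℝ) - endpt α| < ε}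

/-- A (weak) topological Kuranishi concordance on `[0,1] × X` from the (weak) atlas `A 0` to the
(weak) atlas `A 1`, with uniform collar width `ε`. The boundary restriction of the atlas at the end
`α` is identified with `A α` by means of the injection `emb α` of basic indices and the collar
embeddings `ιU`, `ιE` at the endpoint. -/
structure Concordance {X : Type u} [TopologicalSpace X] (A : Fin 2 → WeakAtlas.{u, v} X) where
  atlas : WeakAtlas.{u, v} (unitInterval × X)
  ε : ℝ
  ε_pos : 0 < ε
  ε_lt : ε < 1 / 2
  /-- All footprints are collared; a chart whose footprint does not meet a boundary component has
  footprint disjoint from the collar of that component. -/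
  foot_collar : ∀ (I : atlas.idx) (α : Fin 2), ∀ t ∈ collar α ε, ∀ p : X,
    (t, p) ∈ (atlas.chart I).foot ↔ (endpt α, p) ∈ (atlas.chart I).foot
  emb : ∀ α, Fin (A α).N ↪ Fin atlas.N
  bd : ∀ α, (A α).idx → atlas.idx
  bd_val : ∀ α (I : (A α).idx), (bd α I).1 = I.1.map (emb α)
  /-- The indices of the boundary restriction at `α` are those whose footprint meets
  `{α} × X`. -/
  mem_range_bd : ∀ α (I : atlas.idx),
    I ∈ range (bd α) ↔ ∃ p : X, (endpt α, p) ∈ (atlas.chart I).foot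
  /-- The boundary restriction of the chart with index `bd α I` has the footprint of the chart of
  `A α` with index `I`. -/
  foot_bd : ∀ α (I : (A α).idx) (p : X),
    (endpt α, p) ∈ (atlas.chart (bd α I)).foot ↔ p ∈ ((A α).chart I).foot
  /-- Collars of the domains and of the obstruction bundles. -/
  ιU : ∀ α (I : (A α).idx), ↥(collar α ε) × ((A α).chart I).U → (atlas.chart (bd α I)).U
  ιE : ∀ α (I : (A α).idx), ↥(collar α ε) × ((A α).chart I).E → (atlas.chart (bd α I)).E
  isOpenEmbedding_ιU : ∀ α I, IsOpenEmbedding (ιU α I)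
  isOpenEmbedding_ιE : ∀ α I, IsOpenEmbedding (ιE α I)
  isClosed_bdU : ∀ α I, IsClosed (ιU α I '' {q | (q.1 : unitInterval) = endpt α})
  isClosed_bdE : ∀ α I, IsClosed (ιE α I '' {q | (q.1 : unitInterval) = endpt α})
  /-- The collars at the two ends of one chart are disjoint. -/
  disjoint_ιU : ∀ (I : (A 0).idx) (J : (A 1).idx) q r,
    (⟨bd 0 I, ιU 0 I q⟩ : atlas.ObjB) ≠ ⟨bd 1 J, ιU 1 J r⟩
  disjoint_ιE : ∀ (I : (A 0).idx) (J : (A 1).idx) q r,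
    (⟨bd 0 I, ιE 0 I q⟩ : atlas.ObjE) ≠ ⟨bd 1 J, ιE 1 J r⟩
  /-- The collars embed the product charts: they intertwine projections, zero sections, sections
  and footprint maps. -/
  pr_ιE : ∀ α I t e, (atlas.chart (bd α I)).pr (ιE α I (t, e)) = ιU α I (t, ((A α).chart I).pr e)
  zero_ιU : ∀ α I t x,
    (atlas.chart (bd α I)).zero (ιU α I (t, x)) = ιE α I (t, ((A α).chart I).zero x)
  sec_ιU : ∀ α I t x,
    (atlas.chart (bd α I)).sec (ιU α I (t, x)) = ιE α I (t, ((A α).chart I).sec x)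
  ψ_ιU : ∀ α I t x (hx : ((A α).chart I).sec x = ((A α).chart I).zero x)
    (hy : (atlas.chart (bd α I)).sec (ιU α I (t, x)) = (atlas.chart (bd α I)).zero (ιU α I (t, x))),
    (atlas.chart (bd α I)).ψ ⟨ιU α I (t, x), hy⟩ = (t.1, ((A α).chart I).ψ ⟨x, hx⟩)
  /-- Between charts that both meet the boundary component `α`, the coordinate changes are on the
  collar the product of the identity with the coordinate change of `A α`. -/
  mem_dom_ιU : ∀ α (I J : (A α).idx) (h : I ≤ J) (h' : bd α I ≤ bd α J) t x,
    ιU α I (t, x) ∈ (atlas.coord h').dom ↔ x ∈ ((A α).coord h).dom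
  φ_ιU : ∀ α (I J : (A α).idx) (h : I ≤ J) (h' : bd α I ≤ bd α J) t
    (x : ((A α).coord h).dom) (hx : ιU α I (t, x.1) ∈ (atlas.coord h').dom),
    (atlas.coord h').φ ⟨ιU α I (t, x.1), hx⟩ = ιU α J (t, ((A α).coord h).φ x)
  Φ_ιE : ∀ α (I J : (A α).idx) (h : I ≤ J) (h' : bd α I ≤ bd α J) t
    (e : ↥(((A α).chart I).pr ⁻¹' ((A α).coord h).dom))
    (he : ιE α I (t, e.1) ∈ (atlas.chart (bd α I)).pr ⁻¹' (atlas.coord h').dom),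
    (atlas.coord h').Φ ⟨ιE α I (t, e.1), he⟩ = ιE α J (t, ((A α).coord h).Φ e)
  range_φ_ιU : ∀ α (I J : (A α).idx) (h : I ≤ J) (h' : bd α I ≤ bd α J) t y,
    ιU α J (t, y) ∈ range (atlas.coord h').φ ↔ y ∈ range ((A α).coord h).φ
  /-- If only the first chart meets the boundary component `α`, then the domain of the coordinate
  change is disjoint from the collar. -/
  notMem_dom_ιU : ∀ α (I : (A α).idx) (J : atlas.idx) (h' : bd α I ≤ J), J ∉ range (bd α) →
    ∀ q, ιU α I q ∉ (atlas.coord h').dom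

namespace Concordance

variable {X : Type u} [TopologicalSpace X] {A : Fin 2 → WeakAtlas.{u, v} X}

/-- A filtration of the concordance is compatible with given filtrations of the two ends: for some
collar width, it is a product on the collars, and its boundary restrictions are the given ones. -/
def IsFilteredBy (C : Concordance A) (𝓔 : C.atlas.Filtration)
    (𝓔A : ∀ α, (A α).Filtration) : Prop :=
  ∃ δ : ℝ, 0 < δ ∧ δ ≤ C.ε ∧ ∀ α (I : Finset (Fin (A α).N)) (J : (A α).idx), I ⊆ J.1 →
    (∀ (t : collar α C.ε) e, (t : unitInterval) = endpt α →
      (C.ιE α J (t, e) ∈ 𝓔.sub (I.map (C.emb α)) (C.bd α J) ↔ e ∈ (𝓔A α).sub I J)) ∧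
    C.ιE α J '' {q | (q.1 : unitInterval) ∈ collar α δ ∧ q.2 ∈ (𝓔A α).sub I J} =
      𝓔.sub (I.map (C.emb α)) (C.bd α J) ∩ (C.atlas.chart (C.bd α J)).pr ⁻¹'
        (C.ιU α J '' {q | (q.1 : unitInterval) ∈ collar α δ})

/-- A metric on the realization of the concordance is collared with given boundary restrictions
`dA α`: for some `δ > 0`, it pulls back to the product metric `|t' - t| + dA α x x'` on the
`δ`-collars, and points outside the `δ`-collar have distance at least `δ - |t - α|` from the
points of the collar at parameter `t`. -/
def IsCollaredMetric (C : Concordance A) (d : C.atlas.RealB → C.atlas.RealB → ℝ)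
    (dA : ∀ α, (A α).RealB → (A α).RealB → ℝ) : Prop :=
  ∃ δ : ℝ, 0 < δ ∧ δ ≤ C.ε ∧ ∀ α,
    (∀ (I J : (A α).idx) (t t' : collar α C.ε) x y,
      (t : unitInterval) ∈ collar α δ → (t' : unitInterval) ∈ collar α δ →
      d (C.atlas.πB (C.bd α I) (C.ιU α I (t, x))) (C.atlas.πB (C.bd α J) (C.ιU α J (t', y))) =
        |(t' : unitInterval).1 - (t : unitInterval).1| +
          dA α ((A α).πB I x) ((A α).πB J y)) ∧
    ∀ p : C.atlas.RealB,
      (∀ (I : (A α).idx) (t : collar α C.ε) x, (t : unitInterval) ∈ collar α δ →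
        p ≠ C.atlas.πB (C.bd α I) (C.ιU α I (t, x))) →
      ∀ (I : (A α).idx) (t : collar α C.ε) x, (t : unitInterval) ∈ collar α δ →
        δ - |(t : unitInterval).1 - (endpt α).1| ≤
          d p (C.atlas.πB (C.bd α I) (C.ιU α I (t, x)))

end Concordance

end Kuranishi

/-! The atlas and tameness conditions of a shrinking involve only the relation "`x` is mapped to `y`
by a coordinate change of `K`", so they become three conditions `TameFamily` on the family of open
subsets `U_I'` (`isTame_iff`). Each condition asserts the existence of a point that the given data
determine uniquely; hence tame families are stable under intersection, which is what makes
interpolation between shrinkings possible.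

Existence. One constructs sets `U_IL`, the future domains of the shrunk coordinate changes, for all
`L ⊇ I` at once, by induction on the size of `I`. The points that must lie in `U_IL` are the zeros
over `F_L` and the images of the `U_GL` with `G ⊊ I`. Since `E_GI ∩ E_HI = E_(G∩H)I`, with `E_∅I`
the zero section, the demands of different `G` and `H` agree where they meet
(`exists_of_mem_forcedSet`), and the forced points are relatively open in the closed set where `s_I`
vanishes or lies in some `E_HI`. They are thickened to open subsets of `U_I` by balls so small that
no new intersections arise (`exists_isOpen_inter_subset`). Staying in `goodSet`, where all
compositions are defined, turns the weak cocycle condition into the strong one. Shrinking twice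
gives a preshrunk tame shrinking.

Hausdorff property and metric. Let `S` be a shrinking of the tame shrinking `S'`. On the disjoint
union of the bundles over the compact closures of the `S.U I`, relate two vectors if they have a
common image over `S'`. By tameness this is an equivalence relation, and related vectors over `I`
and `J` come from a common vector over `I ∩ J`, or are zero vectors over zeros with the same
footprint if `I ∩ J = ∅`. This description from below shows that saturations of closed sets are
closed (`isClosed_saturation`), so the quotient is Hausdorff, and that the relation restricts to the
one defining `|E_S|` (`relE_of_relE`). So `|E_S|` injects continuously into a Hausdorff space in
which every chart is embedded; `|S|` follows along the zero section, whose image lies in a compact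
metrizable set, and this provides an admissible metric.

Concordance. Over `[0,1]` use the domains of `S α` near the end `α`, those of an auxiliary preshrunk
tame shrinking `B` near `1/2`, and `S α ∩ B` in between. The footprints of `B` contain those of both
ends, so the footprints still cover. Tameness can be checked for each parameter separately, and the
interpolation is a preshrunk tame shrinking of `[0,1] × K`, so the previous results apply to it. The
collared metric adds to the parameter distance cone metrics built from `d α` and from some
admissible metric, with heights chosen so that only `d α` survives near `α` (`coneDist_triangle`,
`isAdmissibleMetric_glue`). -/

namespace Kuranishi

/-! ### Point-set topology: closed quotients and thickenings of relatively open sets. -/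

section Topology

/-- The image of a normal `T1` space under a closed continuous surjection with closed fibres is
Hausdorff. -/
theorem t2Space_of_isClosedMap {Y Q : Type*} [TopologicalSpace Y] [TopologicalSpace Q]
    [NormalSpace Y] [T1Space Y] {q : Y → Q} (hc : Continuous q) (hcl : IsClosedMap q)
    (hs : Function.Surjective q) : T2Space Q := by
  have hsing : ∀ p : Q, IsClosed ({p} : Set Q) := fun p => by
    obtain ⟨y, rfl⟩ := hs p
    simpa using hcl _ (isClosed_singleton (x := y))
  refine ⟨fun p p' hp => ?_⟩
  obtain ⟨U, V, hU, hV, hpU, hpV, hd⟩ := normal_separation ((hsing p).preimage hc)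
    ((hsing p').preimage hc) (Disjoint.preimage q (by simpa using hp))
  -- The complement of `q '' Uᶜ` consists of the points whose whole fibre lies in `U`; it is open
  -- because `q` is closed.
  refine ⟨(q '' Uᶜ)ᶜ, (q '' Vᶜ)ᶜ, (hcl _ hU.isClosed_compl).isOpen_compl,
    (hcl _ hV.isClosed_compl).isOpen_compl, ?_, ?_, ?_⟩
  · rintro ⟨y, hy, rfl⟩; exact hy (hpU rfl)
  · rintro ⟨y, hy, rfl⟩; exact hy (hpV rfl)
  · rw [Set.disjoint_left]
    intro r h1 h2
    obtain ⟨y, rfl⟩ := hs r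
    have h1' : y ∈ U := by by_contra h; exact h1 ⟨y, h, rfl⟩
    have h2' : y ∈ V := by by_contra h; exact h2 ⟨y, h, rfl⟩
    exact Set.disjoint_left.1 hd h1' h2'

/-- A Hausdorff continuous image of a compact metrizable space is metrizable. -/
theorem metrizableSpace_of_surjective {Y Q : Type*} [TopologicalSpace Y] [TopologicalSpace Q]
    [CompactSpace Y] [MetrizableSpace Y] [T2Space Q] {q : Y → Q} (hc : Continuous q)
    (hs : Function.Surjective q) : MetrizableSpace Q := by
  have : CompactSpace Q := hs.compactSpace hc
  have hcl : IsClosedMap q := hc.isClosedMap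
  let _ := metrizableSpaceMetric Y
  let b := countableBasis Y
  have hb : IsTopologicalBasis b := isBasis_countableBasis Y
  -- A fibre is compact, so inside an open set it is covered by finitely many basic open sets. The
  -- points whose fibres lie in a given finite union therefore form a countable basis of the compact
  -- Hausdorff space `Q`, and Urysohn's theorem applies.
  let 𝒞 : Set (Set Q) := (fun s : Set (Set Y) => (q '' (⋃₀ s)ᶜ)ᶜ) '' {s | s ⊆ b ∧ s.Finite}
  have h𝒞 : IsTopologicalBasis 𝒞 := by
    refine isTopologicalBasis_of_isOpen_of_nhds ?_ ?_
    · rintro _ ⟨s, ⟨hsb, -⟩, rfl⟩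
      exact (hcl _ (isOpen_sUnion fun t ht => hb.isOpen (hsb ht)).isClosed_compl).isOpen_compl
    · intro p W hp hW
      have hcpt : IsCompact (q ⁻¹' {p}) := (isClosed_singleton.preimage hc).isCompact
      obtain ⟨s, hsb, hsfin, h1, h2⟩ : ∃ s : Set (Set Y), s ⊆ b ∧ s.Finite ∧
          q ⁻¹' {p} ⊆ ⋃₀ s ∧ ⋃₀ s ⊆ q ⁻¹' W := by
        choose! f hf using fun (y : Y) (hy : y ∈ q ⁻¹' W) =>
          hb.exists_subset_of_mem_open hy (hW.preimage hc)
        have hsub : q ⁻¹' {p} ⊆ q ⁻¹' W := fun y hy => by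
          rw [mem_preimage, show q y = p from hy]; exact hp
        obtain ⟨t, ht, ht2⟩ := hcpt.elim_nhds_subcover f
          (fun y hy => (hb.isOpen (hf y (hsub hy)).1).mem_nhds (hf y (hsub hy)).2.1)
        refine ⟨f '' t, ?_, t.finite_toSet.image f, ?_, ?_⟩
        · rintro _ ⟨y, hy, rfl⟩; exact (hf y (hsub (ht y hy))).1
        · simpa [sUnion_image] using ht2
        · rw [sUnion_image]
          exact iUnion₂_subset fun y hy => (hf y (hsub (ht y hy))).2.2
      refine ⟨_, ⟨s, ⟨hsb, hsfin⟩, rfl⟩, ?_, ?_⟩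
      · rintro ⟨y, hy, hyp⟩; exact hy (h1 hyp)
      · intro r hr
        obtain ⟨y, rfl⟩ := hs r
        by_contra h
        exact hr ⟨y, fun h' => h (h2 h'), rfl⟩
  have : SecondCountableTopology Q := by
    refine h𝒞.secondCountableTopology (Countable.image ?_ _)
    refine (Set.countable_ofPred_finite_subset (countable_countableBasis Y)).mono ?_
    rintro s ⟨hs, hs'⟩
    exact ⟨hs', hs⟩
  infer_instance

/-- Finitely many open sets can be shrunk, keeping their traces on an arbitrary set `Z`, in such a
way that every point of the shrunk sets lies in the same shrunk sets as some point of `Z`. -/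
theorem exists_isOpen_inter_subset {Y ι : Type*} [TopologicalSpace Y] [MetrizableSpace Y] [Finite ι]
    (Z : Set Y) (O : ι → Set Y) (hO : ∀ i, IsOpen (O i)) :
    ∃ V : ι → Set Y, (∀ i, IsOpen (V i)) ∧ (∀ i, V i ⊆ O i) ∧ (∀ i, Z ∩ O i ⊆ V i) ∧
      (∀ i j, Z ∩ O i ⊆ O j → V i ⊆ V j) ∧
      ∀ i j, ∀ x ∈ V i ∩ V j, ∃ z ∈ Z ∩ O i ∩ O j, ∀ k, z ∈ O k → x ∈ V k := by
  let _ := metrizableSpaceMetric Y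
  -- `V i` will be the union of the balls of radius `r z` about the points of `Z ∩ O i`; the factor
  -- 2 is needed when two balls meet.
  have hr : ∀ z, ∃ r > 0, ∀ i, z ∈ O i → Metric.ball z (2 * r) ⊆ O i := by
    intro z
    have : (⋂ i : {i // z ∈ O i}, O i.1) ∈ 𝓝 z :=
      (isOpen_iInter_of_finite fun i : {i // z ∈ O i} => hO i.1).mem_nhds
        (mem_iInter.2 fun i => i.2)
    obtain ⟨ε, hε, h⟩ := Metric.mem_nhds_iff.1 this
    refine ⟨ε / 2, half_pos hε, fun i hi => ?_⟩
    rw [mul_div_cancel₀ _ two_ne_zero]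
    exact h.trans (iInter_subset _ (⟨i, hi⟩ : {i // z ∈ O i}))
  choose r hr0 hr using hr
  refine ⟨fun i => ⋃ z ∈ Z ∩ O i, Metric.ball z (r z), fun i => ?_, fun i => ?_, fun i z hz => ?_,
    fun i j h => ?_, ?_⟩
  · exact isOpen_biUnion fun z _ => Metric.isOpen_ball
  · refine iUnion₂_subset fun z hz => (Metric.ball_subset_ball ?_).trans (hr z i hz.2)
    linarith [hr0 z]
  · exact mem_iUnion₂.2 ⟨z, hz, Metric.mem_ball_self (hr0 z)⟩
  · exact iUnion₂_subset fun z hz x hx => mem_iUnion₂.2 ⟨z, ⟨hz.1, h hz⟩, hx⟩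
  · rintro i j x ⟨hi, hj⟩
    simp only [mem_iUnion] at hi hj
    obtain ⟨z, hz, hxz⟩ := hi
    obtain ⟨w, hw, hxw⟩ := hj
    rw [Metric.mem_ball] at hxz hxw
    -- If two balls share `x`, the centre of the smaller one is within twice the radius of the
    -- larger one's centre, hence lies in both `O i` and `O j` and serves as the witness.
    rcases le_total (r w) (r z) with h | h
    · refine ⟨w, ⟨⟨hw.1, hr z i hz.2 ?_⟩, hw.2⟩, fun k hk => mem_iUnion₂.2 ⟨w, ⟨hw.1, hk⟩, hxw⟩⟩
      rw [Metric.mem_ball]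
      linarith [dist_triangle_left w z x]
    · refine ⟨z, ⟨hz, hr w j hw.2 ?_⟩, fun k hk => mem_iUnion₂.2 ⟨z, ⟨hz.1, hk⟩, hxz⟩⟩
      rw [Metric.mem_ball]
      linarith [dist_triangle_left z w x]

end Topology

end Kuranishi

/-! ### Calculus of morphisms between points and vectors. -/

namespace Kuranishi

namespace WeakAtlas

variable {X : Type u} [TopologicalSpace X] {K : WeakAtlas.{u, v} X}

instance (K : WeakAtlas.{u, v} X) : Finite K.idx := inferInstance

theorem mem_idx_of_subset {H : Finset (Fin K.N)} {I : K.idx} (hH : H.Nonempty) (h : H ⊆ I.1) :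
    H ∈ K.idx :=
  (K.mem_idx H).2 ⟨hH, ((K.mem_idx I.1).1 I.2).2.mono (biInter_subset_biInter_left h)⟩

theorem foot_anti {I J : K.idx} (h : I ≤ J) : (K.chart J).foot ⊆ (K.chart I).foot := by
  rw [foot_chart, foot_chart]
  exact biInter_subset_biInter_left h

section Mor

variable {I J L : K.idx}

theorem morE_iff {e : (K.chart I).E} {f : (K.chart J).E} : K.MorE ⟨I, e⟩ ⟨J, f⟩ ↔
    ∃ (h : I ≤ J) (he : e ∈ (K.chart I).pr ⁻¹' (K.coord h).dom), (K.coord h).Φ ⟨e, he⟩ = f :=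
  Iff.rfl

theorem morB_iff {x : (K.chart I).U} {y : (K.chart J).U} : K.MorB ⟨I, x⟩ ⟨J, y⟩ ↔
    ∃ (h : I ≤ J) (hx : x ∈ (K.coord h).dom), (K.coord h).φ ⟨x, hx⟩ = y :=
  Iff.rfl

theorem morB_φ (h : I ≤ J) {x : (K.chart I).U} (hx : x ∈ (K.coord h).dom) :
    K.MorB ⟨I, x⟩ ⟨J, (K.coord h).φ ⟨x, hx⟩⟩ :=
  ⟨h, hx, rfl⟩

theorem MorE.le {e : (K.chart I).E} {f : (K.chart J).E} (h : K.MorE ⟨I, e⟩ ⟨J, f⟩) : I ≤ J := h.1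

theorem MorB.le {x : (K.chart I).U} {y : (K.chart J).U} (h : K.MorB ⟨I, x⟩ ⟨J, y⟩) : I ≤ J := h.1

theorem MorE.right_unique {e : (K.chart I).E} {f f' : (K.chart J).E} (h : K.MorE ⟨I, e⟩ ⟨J, f⟩)
    (h' : K.MorE ⟨I, e⟩ ⟨J, f'⟩) : f = f' := by
  obtain ⟨h1, h2, h3⟩ := h
  obtain ⟨h1', h2', h3'⟩ := h'
  exact h3.symm.trans h3'

theorem MorB.right_unique {x : (K.chart I).U} {y y' : (K.chart J).U} (h : K.MorB ⟨I, x⟩ ⟨J, y⟩)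
    (h' : K.MorB ⟨I, x⟩ ⟨J, y'⟩) : y = y' := by
  obtain ⟨h1, h2, h3⟩ := h
  obtain ⟨h1', h2', h3'⟩ := h'
  exact h3.symm.trans h3'

theorem MorE.left_unique {e e' : (K.chart I).E} {f : (K.chart J).E} (h : K.MorE ⟨I, e⟩ ⟨J, f⟩)
    (h' : K.MorE ⟨I, e'⟩ ⟨J, f⟩) : e = e' := by
  obtain ⟨h1, h2, h3⟩ := h
  obtain ⟨h1', h2', h3'⟩ := h'
  exact congrArg Subtype.val ((K.coord h1).isEmbedding_Φ.injective (h3.trans h3'.symm))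

theorem MorB.left_unique {x x' : (K.chart I).U} {y : (K.chart J).U} (h : K.MorB ⟨I, x⟩ ⟨J, y⟩)
    (h' : K.MorB ⟨I, x'⟩ ⟨J, y⟩) : x = x' := by
  obtain ⟨h1, h2, h3⟩ := h
  obtain ⟨h1', h2', h3'⟩ := h'
  exact congrArg Subtype.val ((K.coord h1).isEmbedding_φ.injective (h3.trans h3'.symm))

theorem MorE.refl (e : (K.chart I).E) : K.MorE ⟨I, e⟩ ⟨I, e⟩ :=
  ⟨le_refl I, by simp [K.dom_refl], K.Φ_refl I _⟩

theorem MorB.refl (x : (K.chart I).U) : K.MorB ⟨I, x⟩ ⟨I, x⟩ :=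
  ⟨le_refl I, by simp [K.dom_refl], K.φ_refl I _⟩

theorem MorE.eq {e f : (K.chart I).E} (h : K.MorE ⟨I, e⟩ ⟨I, f⟩) : e = f :=
  (MorE.refl e).right_unique h

theorem MorB.eq {x y : (K.chart I).U} (h : K.MorB ⟨I, x⟩ ⟨I, y⟩) : x = y :=
  (MorB.refl x).right_unique h

/-- A morphism of obstruction bundles lies over a morphism of domains. -/
theorem MorE.pr {e : (K.chart I).E} {f : (K.chart J).E} (h : K.MorE ⟨I, e⟩ ⟨J, f⟩) :
    K.MorB ⟨I, (K.chart I).pr e⟩ ⟨J, (K.chart J).pr f⟩ := by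
  obtain ⟨h1, h2, h3⟩ := h
  refine ⟨h1, h2, ?_⟩
  change _ = (K.chart J).pr f
  rw [← show _ = f from h3]
  exact ((K.coord h1).pr_Φ ⟨e, h2⟩).symm

theorem MorB.exists_lift {e : (K.chart I).E} {y : (K.chart J).U}
    (h : K.MorB ⟨I, (K.chart I).pr e⟩ ⟨J, y⟩) :
    ∃ f, (K.chart J).pr f = y ∧ K.MorE ⟨I, e⟩ ⟨J, f⟩ := by
  obtain ⟨h1, h2, h3⟩ := h
  exact ⟨(K.coord h1).Φ ⟨e, h2⟩, ((K.coord h1).pr_Φ _).trans h3, h1, h2, rfl⟩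

theorem MorB.zero {x : (K.chart I).U} {y : (K.chart J).U} (h : K.MorB ⟨I, x⟩ ⟨J, y⟩) :
    K.MorE ⟨I, (K.chart I).zero x⟩ ⟨J, (K.chart J).zero y⟩ := by
  obtain ⟨h1, h2, h3⟩ := h
  refine ⟨h1, (K.chart I).zero_mem h2, ?_⟩
  rw [← show _ = y from h3]
  exact ((K.coord h1).zero_φ ⟨x, h2⟩).symm

theorem MorB.sec {x : (K.chart I).U} {y : (K.chart J).U} (h : K.MorB ⟨I, x⟩ ⟨J, y⟩) :
    K.MorE ⟨I, (K.chart I).sec x⟩ ⟨J, (K.chart J).sec y⟩ := by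
  obtain ⟨h1, h2, h3⟩ := h
  refine ⟨h1, (K.chart I).sec_mem h2, ?_⟩
  rw [← show _ = y from h3]
  exact ((K.coord h1).sec_φ ⟨x, h2⟩).symm

/-- The weak cocycle condition for obstruction bundles. -/
theorem MorE.weak_trans {e : (K.chart I).E} {f : (K.chart J).E} {g : (K.chart L).E}
    {z : (K.chart L).U} (h : K.MorE ⟨I, e⟩ ⟨J, f⟩) (h' : K.MorE ⟨J, f⟩ ⟨L, g⟩)
    (hz : K.MorB ⟨I, (K.chart I).pr e⟩ ⟨L, z⟩) : K.MorE ⟨I, e⟩ ⟨L, g⟩ := by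
  obtain ⟨h1, h2, rfl⟩ := morE_iff.1 h
  obtain ⟨h1', h2', h3'⟩ := h'
  obtain ⟨a, b, -⟩ := hz
  exact ⟨a, b, (K.weak_cocycle h1 h1' e h2 h2' b).symm.trans h3'⟩

/-- The weak cocycle condition for domains. -/
theorem MorB.weak_trans {x : (K.chart I).U} {y : (K.chart J).U} {z z' : (K.chart L).U}
    (h : K.MorB ⟨I, x⟩ ⟨J, y⟩) (h' : K.MorB ⟨J, y⟩ ⟨L, z⟩) (hz : K.MorB ⟨I, x⟩ ⟨L, z'⟩) :
    z' = z := by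
  -- The cocycle condition is given for the bundles only; it is applied to the zero vectors and
  -- projected back.
  have hz' : K.MorB ⟨I, (K.chart I).pr ((K.chart I).zero x)⟩ ⟨L, z'⟩ := by
    rwa [KChart.pr_zero]
  have h1 := (h.zero.weak_trans h'.zero hz').pr
  rw [KChart.pr_zero, KChart.pr_zero] at h1
  exact hz.right_unique h1

/-- If `x ↦ z` factors as `x ↦ y ↦ z'`, then `z' = z`. -/
theorem MorB.weak_trans_mor {x : (K.chart I).U} {y : (K.chart J).U} {z z' : (K.chart L).U}
    (h : K.MorB ⟨I, x⟩ ⟨J, y⟩) (h' : K.MorB ⟨J, y⟩ ⟨L, z⟩) (hz : K.MorB ⟨I, x⟩ ⟨L, z'⟩) :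
    K.MorB ⟨I, x⟩ ⟨L, z⟩ := h.weak_trans h' hz ▸ hz

/-- The zero set of a chart, where the section agrees with the zero section. -/
def zeroSet (K : WeakAtlas.{u, v} X) (I : K.idx) : Set (K.chart I).U :=
  {x | (K.chart I).sec x = (K.chart I).zero x}

theorem isClosed_zeroSet (I : K.idx) : IsClosed (K.zeroSet I) :=
  isClosed_eq (K.chart I).continuous_sec (K.chart I).continuous_zero

/-- The injective map `Φ` takes section to section and zero to zero, so it preserves and reflects
their equality. -/
theorem MorB.mem_zeroSet_iff {x : (K.chart I).U} {y : (K.chart J).U}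
    (h : K.MorB ⟨I, x⟩ ⟨J, y⟩) : x ∈ K.zeroSet I ↔ y ∈ K.zeroSet J := by
  constructor
  · intro hx
    have h1 := h.sec
    rw [show (K.chart I).sec x = _ from hx] at h1
    exact h1.right_unique h.zero
  · intro hy
    have h1 := h.sec
    rw [show (K.chart J).sec y = _ from hy] at h1
    exact h1.left_unique h.zero

theorem MorB.ψ_eq {x : (K.chart I).U} {y : (K.chart J).U} (h : K.MorB ⟨I, x⟩ ⟨J, y⟩)
    (hx : x ∈ K.zeroSet I) (hy : y ∈ K.zeroSet J) :
    (K.chart J).ψ ⟨y, hy⟩ = (K.chart I).ψ ⟨x, hx⟩ := by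
  obtain ⟨h1, h2, rfl⟩ := morB_iff.1 h
  exact (K.coord h1).ψ_φ ⟨x, h2⟩ hx hy

/-- Points of the zero sets with the same footprint are related by a morphism. -/
theorem morB_of_ψ_eq (hIJ : I ≤ J) {x : (K.chart I).U} {y : (K.chart J).U}
    (hx : x ∈ K.zeroSet I) (hy : y ∈ K.zeroSet J)
    (h : (K.chart I).ψ ⟨x, hx⟩ = (K.chart J).ψ ⟨y, hy⟩) : K.MorB ⟨I, x⟩ ⟨J, y⟩ := by
  have hd : x ∈ (K.coord hIJ).dom :=
    ((K.coord hIJ).mem_dom_iff ⟨x, hx⟩).2 ⟨⟨_, rfl⟩, h ▸ ⟨_, rfl⟩⟩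
  have hm : K.MorB ⟨I, x⟩ ⟨J, (K.coord hIJ).φ ⟨x, hd⟩⟩ := ⟨hIJ, hd, rfl⟩
  have hz := hm.mem_zeroSet_iff.1 hx
  have := (K.chart J).isOpenEmbedding_ψ.injective ((hm.ψ_eq hx hz).trans h)
  rwa [show (K.coord hIJ).φ ⟨x, hd⟩ = y from congrArg Subtype.val this] at hm

theorem exists_zero_of_mem_foot {p : X} (hp : p ∈ (K.chart I).foot) :
    ∃ x, ∃ hx : x ∈ K.zeroSet I, (K.chart I).ψ ⟨x, hx⟩ = p := by
  obtain ⟨⟨x, hx⟩, rfl⟩ := hp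
  exact ⟨x, hx, rfl⟩

theorem exists_morB_of_zero (hIJ : I ≤ J) {x : (K.chart I).U} (hx : x ∈ K.zeroSet I)
    (hp : (K.chart I).ψ ⟨x, hx⟩ ∈ (K.chart J).foot) :
    ∃ y, ∃ hy : y ∈ K.zeroSet J, (K.chart J).ψ ⟨y, hy⟩ = (K.chart I).ψ ⟨x, hx⟩ ∧
      K.MorB ⟨I, x⟩ ⟨J, y⟩ := by
  obtain ⟨y, hy, h⟩ := exists_zero_of_mem_foot hp
  exact ⟨y, hy, h, morB_of_ψ_eq hIJ hx hy h.symm⟩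

theorem exists_morB_to_zero (hIJ : I ≤ J) {y : (K.chart J).U} (hy : y ∈ K.zeroSet J) :
    ∃ x, ∃ hx : x ∈ K.zeroSet I, (K.chart I).ψ ⟨x, hx⟩ = (K.chart J).ψ ⟨y, hy⟩ ∧
      K.MorB ⟨I, x⟩ ⟨J, y⟩ := by
  obtain ⟨x, hx, h⟩ := exists_zero_of_mem_foot (foot_anti hIJ ⟨⟨y, hy⟩, rfl⟩)
  exact ⟨x, hx, h, morB_of_ψ_eq hIJ hx hy h⟩

end Mor

/-! ### Filtrations and morphisms. -/

section Filtration

variable {𝓔 : K.Filtration} {I J L : K.idx}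

/-- Condition (ii) of a filtration gives the forward direction directly; backwards it yields some
preimage in `E_HJ`, which is `e` because `Φ` is injective. -/
theorem Filtration.mem_iff_of_morE (𝓔 : K.Filtration) {H : Finset (Fin K.N)} (hH : H ⊆ J.1)
    {e : (K.chart J).E} {f : (K.chart L).E} (h : K.MorE ⟨J, e⟩ ⟨L, f⟩) :
    e ∈ 𝓔.sub H J ↔ f ∈ 𝓔.sub H L := by
  rcases h.le.eq_or_lt with rfl | hlt
  · rw [h.eq]
  obtain ⟨h1, h2, h3⟩ := h
  have key := Set.ext_iff.1 (𝓔.image_sub H J L hlt hH) f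
  constructor
  · intro he
    exact (key.1 ⟨⟨e, h2⟩, he, h3⟩).1
  · intro hf
    have hpr : (K.chart L).pr f ∈ range (K.coord hlt.le).φ := by
      rw [← show _ = f from h3]
      exact ⟨_, ((K.coord h1).pr_Φ ⟨e, h2⟩).symm⟩
    obtain ⟨e', he', h'⟩ := key.2 ⟨hf, hpr⟩
    have := (K.coord hlt.le).isEmbedding_Φ.injective (h'.trans h3.symm)
    rw [this] at he'
    exact he'

/-- This is condition (ii) with `E_II = E_I`: over the image of `φ_IJ`, all of `E_IJ` comes from the
bundle over `U_I`. -/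
theorem Filtration.exists_morE (𝓔 : K.Filtration) {f : (K.chart J).E} (hf : f ∈ 𝓔.sub I.1 J)
    {x : (K.chart I).U} (h : K.MorB ⟨I, x⟩ ⟨J, (K.chart J).pr f⟩) :
    ∃ e, (K.chart I).pr e = x ∧ K.MorE ⟨I, e⟩ ⟨J, f⟩ := by
  rcases h.le.eq_or_lt with rfl | hlt
  · exact ⟨f, h.eq.symm, MorE.refl f⟩
  obtain ⟨h1, h2, h3⟩ := h
  obtain ⟨e, he, h'⟩ := (Set.ext_iff.1 (𝓔.image_sub I.1 I J hlt subset_rfl) f).2 ⟨hf, ⟨_, h3⟩⟩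
  have hm : K.MorE ⟨I, e.1⟩ ⟨J, f⟩ := ⟨hlt.le, e.2, h'⟩
  exact ⟨e.1, hm.pr.left_unique ⟨h1, h2, h3⟩, hm⟩

theorem Filtration.mem_of_morE (𝓔 : K.Filtration) {e : (K.chart I).E} {f : (K.chart J).E}
    (h : K.MorE ⟨I, e⟩ ⟨J, f⟩) : f ∈ 𝓔.sub I.1 J :=
  (𝓔.mem_iff_of_morE subset_rfl h).1 (by rw [𝓔.sub_self]; trivial)

theorem Filtration.sec_mem_of_morB (𝓔 : K.Filtration) {x : (K.chart I).U} {y : (K.chart J).U}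
    (h : K.MorB ⟨I, x⟩ ⟨J, y⟩) : (K.chart J).sec y ∈ 𝓔.sub I.1 J :=
  𝓔.mem_of_morE h.sec

theorem Filtration.sec_mem_empty_iff (𝓔 : K.Filtration) {x : (K.chart I).U} :
    (K.chart I).sec x ∈ 𝓔.sub ∅ I ↔ x ∈ K.zeroSet I := by
  rw [𝓔.sub_empty]
  constructor
  · rintro ⟨y, hy⟩
    have : y = x := by rw [← (K.chart I).pr_zero y, hy, KChart.pr_sec]
    subst this
    exact hy.symm
  · intro h
    exact ⟨x, Eq.symm h⟩

end Filtration

/-! ### Tameness as a condition on families of subsets. -/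

/-- Tameness of a family of subsets of the domains, in terms of morphisms. -/
structure TameFamily (K : WeakAtlas.{u, v} X) (𝓔 : K.Filtration)
    (V : ∀ I : K.idx, Set (K.chart I).U) : Prop where
  up : ∀ {I J L : K.idx} {x : (K.chart I).U} {z : (K.chart L).U}, I ≤ J → J ≤ L → x ∈ V I →
    z ∈ V L → K.MorB ⟨I, x⟩ ⟨L, z⟩ → ∃ y ∈ V J, K.MorB ⟨I, x⟩ ⟨J, y⟩ ∧ K.MorB ⟨J, y⟩ ⟨L, z⟩
  down : ∀ {I J L : K.idx} {y : (K.chart J).U} {z : (K.chart L).U}, I ≤ J → y ∈ V J → z ∈ V L →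
    K.MorB ⟨J, y⟩ ⟨L, z⟩ → (K.chart J).sec y ∈ 𝓔.sub I.1 J →
    ∃ x ∈ V I, K.MorB ⟨I, x⟩ ⟨J, y⟩ ∧ K.MorB ⟨I, x⟩ ⟨L, z⟩
  join : ∀ {I J L : K.idx} {x : (K.chart I).U} {y : (K.chart J).U} {z : (K.chart L).U}, x ∈ V I →
    y ∈ V J → z ∈ V L → K.MorB ⟨I, x⟩ ⟨J, y⟩ → K.MorB ⟨I, x⟩ ⟨L, z⟩ →
    ∃ h : J.1 ∪ L.1 ∈ K.idx, ∃ w ∈ V ⟨J.1 ∪ L.1, h⟩, K.MorB ⟨I, x⟩ ⟨⟨J.1 ∪ L.1, h⟩, w⟩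

namespace TameFamily

variable {𝓔 : K.Filtration} {V W : ∀ I : K.idx, Set (K.chart I).U}

/-- The section at an image point of `x` lies in `E_IJ`, so `down` applies at `y`; the point it
produces over `y` is `x` by injectivity. This is the strong cocycle condition. -/
theorem trans (hV : K.TameFamily 𝓔 V) {I J L : K.idx} {x : (K.chart I).U} {y : (K.chart J).U}
    {z : (K.chart L).U} (hy : y ∈ V J) (hz : z ∈ V L) (h : K.MorB ⟨I, x⟩ ⟨J, y⟩)
    (h' : K.MorB ⟨J, y⟩ ⟨L, z⟩) : K.MorB ⟨I, x⟩ ⟨L, z⟩ := by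
  obtain ⟨x', -, h1, h2⟩ := hV.down h.le hy hz h' (𝓔.sec_mem_of_morB h)
  rwa [h.left_unique h1]

/-- Points over a tame family with section in `E_IJ` come from `U_I`. -/
theorem exists_of_sec_mem (hV : K.TameFamily 𝓔 V) {I J : K.idx} {y : (K.chart J).U} (hIJ : I ≤ J)
    (hy : y ∈ V J) (h : (K.chart J).sec y ∈ 𝓔.sub I.1 J) : ∃ x ∈ V I, K.MorB ⟨I, x⟩ ⟨J, y⟩ := by
  obtain ⟨x, hx, h1, -⟩ := hV.down hIJ hy hy (MorB.refl y) h
  exact ⟨x, hx, h1⟩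

/-- Each clause produces a point joined to a given one by a morphism between fixed charts. Such a
point is unique, so the ones found in `V` and in `W` coincide. -/
theorem inter (hV : K.TameFamily 𝓔 V) (hW : K.TameFamily 𝓔 W) :
    K.TameFamily 𝓔 (fun I => V I ∩ W I) where
  up hIJ hJL hx hz h := by
    obtain ⟨y, hy, h1, h2⟩ := hV.up hIJ hJL hx.1 hz.1 h
    obtain ⟨y', hy', h1', -⟩ := hW.up hIJ hJL hx.2 hz.2 h
    obtain rfl := h1.right_unique h1'
    exact ⟨y, ⟨hy, hy'⟩, h1, h2⟩
  down hIJ hy hz h hs := by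
    obtain ⟨x, hx, h1, h2⟩ := hV.down hIJ hy.1 hz.1 h hs
    obtain ⟨x', hx', h1', -⟩ := hW.down hIJ hy.2 hz.2 h hs
    obtain rfl := h1.left_unique h1'
    exact ⟨x, ⟨hx, hx'⟩, h1, h2⟩
  join hx hy hz h h' := by
    obtain ⟨hu, w, hw, h1⟩ := hV.join hx.1 hy.1 hz.1 h h'
    obtain ⟨hu, w', hw', h1'⟩ := hW.join hx.2 hy.2 hz.2 h h'
    obtain rfl := h1.right_unique h1'
    exact ⟨hu, w, ⟨hw, hw'⟩, h1⟩

end TameFamily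

/-- The two inclusions in `φ_IJ(U_IL) = U_JL ∩ s_J⁻¹(E_IJ)` correspond to `up` and `down`, the
inclusion `U_IJ ∩ U_IL ⊆ U_I(J∪L)` to `join`. Conversely, `down` yields the cocycle condition. -/
theorem isAtlas_and_isTame_iff {𝓔 : K.Filtration} :
    K.IsAtlas ∧ K.IsTame 𝓔 ↔ K.TameFamily 𝓔 (fun _ => univ) := by
  constructor
  · rintro ⟨hA, hT⟩
    have down : ∀ {I J L : K.idx} {y : (K.chart J).U} {z : (K.chart L).U}, I ≤ J →
        K.MorB ⟨J, y⟩ ⟨L, z⟩ → (K.chart J).sec y ∈ 𝓔.sub I.1 J →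
        ∃ x, K.MorB ⟨I, x⟩ ⟨J, y⟩ ∧ K.MorB ⟨I, x⟩ ⟨L, z⟩ := by
      intro I J L y z hIJ h hs
      obtain ⟨hJL, hy, hz⟩ := id h
      obtain ⟨x, hx, hxy⟩ := (Set.ext_iff.1 (hT.image_dom I J L hIJ hJL) y).2 ⟨hy, hs⟩
      have h1 : K.MorB ⟨I, x.1⟩ ⟨J, y⟩ := ⟨hIJ, x.2, hxy⟩
      have h2 := morB_φ (hIJ.trans hJL) hx
      exact ⟨x, h1, h1.weak_trans_mor h h2⟩
    refine ⟨?_, ?_, ?_⟩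
    · intro I J L x z hIJ hJL _ _ h
      obtain ⟨hIL, hx, hz⟩ := morB_iff.1 h
      have hxJ : x ∈ (K.coord hIJ).dom := by
        -- For `J ⊆ L` the condition on `U_I(J∪L)` is to be read at `L`; `key` transports domain
        -- membership along the equality of indices.
        have key : ∀ (M : K.idx) (hIM : I ≤ M), M = L → x ∈ (K.coord hIM).dom := by
          rintro M hIM rfl; exact hx
        have hu : J.1 ∪ L.1 = L.1 := Finset.union_eq_right.2 hJL
        have hu' : J.1 ∪ L.1 ∈ K.idx := by rw [hu]; exact L.2
        exact ((hT.inter_dom I J L hIJ hIL x).2 ⟨hu', key _ _ (Subtype.ext hu)⟩).1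
      obtain ⟨hy, -⟩ := (Set.ext_iff.1 (hT.image_dom I J L hIJ hJL) _).1 ⟨⟨x, hxJ⟩, hx, rfl⟩
      have h1 := morB_φ hIJ hxJ
      have h2 := morB_φ hJL hy
      exact ⟨_, trivial, h1, h1.weak_trans h2 h ▸ h2⟩
    · intro I J L y z hIJ _ _ h hs
      obtain ⟨x, h1, h2⟩ := down hIJ h hs
      exact ⟨x, trivial, h1, h2⟩
    · intro I J L x y z _ _ _ h h'
      obtain ⟨hu, hx⟩ := (hT.inter_dom I J L h.le h'.le x).1 ⟨h.2.1, h'.2.1⟩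
      exact ⟨hu, _, trivial, morB_φ _ hx⟩
  · intro h
    refine ⟨?_, ?_, ?_⟩
    · intro I J L hIJ hJL x hx
      exact (h.trans trivial trivial (morB_φ hIJ x.2) (morB_φ hJL hx)).2.1
    · intro I J L hIJ hIL x
      constructor
      · rintro ⟨h1, h2⟩
        obtain ⟨hu, w, -, hw⟩ := h.join (J := J) (L := L) trivial trivial trivial
          (morB_φ hIJ h1) (morB_φ hIL h2)
        exact ⟨hu, hw.2.1⟩
      · rintro ⟨hu, hx⟩
        have hm := morB_φ _ hx
        obtain ⟨y, -, hy, -⟩ := h.up (J := J) hIJ Finset.subset_union_left trivial trivial hm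
        obtain ⟨y', -, hy', -⟩ := h.up (J := L) hIL Finset.subset_union_right trivial trivial hm
        exact ⟨hy.2.1, hy'.2.1⟩
    · intro I J L hIJ hJL
      ext y
      constructor
      · rintro ⟨x, hx, rfl⟩
        obtain ⟨y, -, h1, h2⟩ := h.up hIJ hJL trivial trivial
          (morB_φ _ hx)
        have h3 : K.MorB ⟨I, x.1⟩ ⟨J, (K.coord hIJ).φ x⟩ := ⟨hIJ, x.2, rfl⟩
        rw [h3.right_unique h1]
        exact ⟨h2.2.1, 𝓔.sec_mem_of_morB h1⟩
      · rintro ⟨hy, hs⟩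
        obtain ⟨x, -, h1, h2⟩ := h.down hIJ trivial trivial
          (morB_φ hJL hy) hs
        obtain ⟨a, b, c⟩ := h1
        exact ⟨⟨x, b⟩, h2.2.1, c⟩

namespace Shrinking

theorem morB_atlas_iff (S : K.Shrinking) {I J : K.idx} (x : S.U I) (y : S.U J) :
    S.atlas.MorB ⟨I, x⟩ ⟨J, y⟩ ↔ K.MorB ⟨I, x.1⟩ ⟨J, y.1⟩ := by
  constructor
  · rintro ⟨h1, h2, h3⟩
    exact ⟨h1, h2.fst, congrArg Subtype.val h3⟩
  · rintro ⟨h1, h2, h3⟩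
    refine ⟨h1, ⟨h2, ?_⟩, Subtype.ext h3⟩
    rw [show (K.coord h1).φ ⟨x.1, h2⟩ = y.1 from h3]
    exact y.2

theorem morE_atlas_iff (S : K.Shrinking) {I J : K.idx} (e : ↥((K.chart I).pr ⁻¹' S.U I))
    (f : ↥((K.chart J).pr ⁻¹' S.U J)) :
    S.atlas.MorE ⟨I, e⟩ ⟨J, f⟩ ↔ K.MorE ⟨I, e.1⟩ ⟨J, f.1⟩ := by
  constructor
  · rintro ⟨h1, h2, h3⟩
    exact ⟨h1, h2.fst, congrArg Subtype.val h3⟩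
  · rintro ⟨h1, h2, h3⟩
    refine ⟨h1, ⟨h2, ?_⟩, Subtype.ext h3⟩
    change (K.coord h1).φ ⟨(K.chart I).pr e.1, _⟩ ∈ S.U J
    rw [← (K.coord h1).pr_Φ ⟨e.1, h2⟩, show (K.coord h1).Φ ⟨e.1, h2⟩ = f.1 from h3]
    exact f.2

/-- Morphisms of a shrinking are those of `K` with both ends in the smaller domains, so shrinkings
can be compared and intersected inside `K`. -/
theorem isTame_iff (S : K.Shrinking) (𝓔 : K.Filtration) :
    S.IsTame 𝓔 ↔ K.TameFamily 𝓔 S.U := by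
  refine isAtlas_and_isTame_iff.trans ⟨fun h => ⟨?_, ?_, ?_⟩, fun h => ⟨?_, ?_, ?_⟩⟩
  · intro I J L x z hIJ hJL hx hz hm
    obtain ⟨y, -, h1, h2⟩ := h.up (I := I) (J := J) (L := L) hIJ hJL trivial trivial
      ((S.morB_atlas_iff ⟨x, hx⟩ ⟨z, hz⟩).2 hm)
    exact ⟨y.1, y.2, (S.morB_atlas_iff _ _).1 h1, (S.morB_atlas_iff _ _).1 h2⟩
  · intro I J L y z hIJ hy hz hm hs
    obtain ⟨x, -, h1, h2⟩ := h.down (I := I) (J := J) (L := L) hIJ trivial trivial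
      ((S.morB_atlas_iff ⟨y, hy⟩ ⟨z, hz⟩).2 hm) hs
    exact ⟨x.1, x.2, (S.morB_atlas_iff _ _).1 h1, (S.morB_atlas_iff _ _).1 h2⟩
  · intro I J L x y z hx hy hz hm hm'
    obtain ⟨hu, w, -, hw⟩ := h.join (I := I) (J := J) (L := L) trivial trivial trivial
      ((S.morB_atlas_iff ⟨x, hx⟩ ⟨y, hy⟩).2 hm) ((S.morB_atlas_iff ⟨x, hx⟩ ⟨z, hz⟩).2 hm')
    exact ⟨hu, w.1, w.2, (S.morB_atlas_iff _ _).1 hw⟩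
  · intro I J L x z hIJ hJL _ _ hm
    obtain ⟨y, hy, h1, h2⟩ := h.up (I := I) (J := J) (L := L) hIJ hJL x.2 z.2
      ((S.morB_atlas_iff x z).1 hm)
    exact ⟨⟨y, hy⟩, trivial, (S.morB_atlas_iff x ⟨y, hy⟩).2 h1, (S.morB_atlas_iff ⟨y, hy⟩ z).2 h2⟩
  · intro I J L y z hIJ _ _ hm hs
    obtain ⟨x, hx, h1, h2⟩ := h.down (I := I) (J := J) (L := L) hIJ y.2 z.2
      ((S.morB_atlas_iff y z).1 hm) hs
    exact ⟨⟨x, hx⟩, trivial, (S.morB_atlas_iff ⟨x, hx⟩ y).2 h1, (S.morB_atlas_iff ⟨x, hx⟩ z).2 h2⟩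
  · intro I J L x y z _ _ _ hm hm'
    obtain ⟨hu, w, hw, h1⟩ := h.join (I := I) (J := J) (L := L) x.2 y.2 z.2
      ((S.morB_atlas_iff x y).1 hm) ((S.morB_atlas_iff x z).1 hm')
    exact ⟨hu, ⟨w, hw⟩, trivial, (S.morB_atlas_iff x ⟨w, hw⟩).2 h1⟩

end Shrinking

end WeakAtlas

end Kuranishi

/-! ### Inductive construction of tame shrinkings. -/

namespace Kuranishi

namespace WeakAtlas

variable {X : Type u} [TopologicalSpace X] {K : WeakAtlas.{u, v} X}

theorem isOpen_setOf_exists_morB {I J : K.idx} (hIJ : I ≤ J) {P : Set (K.chart J).U}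
    (hP : IsOpen P) : IsOpen {x : (K.chart I).U | ∃ y ∈ P, K.MorB ⟨I, x⟩ ⟨J, y⟩} := by
  have h := (K.coord hIJ).isOpen_dom.isOpenMap_subtype_val _
    (hP.preimage (K.coord hIJ).isEmbedding_φ.continuous)
  convert h using 1
  ext x
  constructor
  · rintro ⟨y, hy, hm⟩
    obtain ⟨_, h2, rfl⟩ := morB_iff.1 hm
    exact ⟨⟨x, h2⟩, hy, rfl⟩
  · rintro ⟨x, hx, rfl⟩
    exact ⟨_, hx, morB_φ hIJ x.2⟩

/-- The image of an open set under a coordinate change is relatively open in `s_J⁻¹(E_IJ)`. -/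
theorem exists_isOpen_image_morB (𝓔 : K.Filtration) {I J : K.idx} (hIJ : I < J)
    {P : Set (K.chart I).U} (hP : IsOpen P) : ∃ W : Set (K.chart J).U, IsOpen W ∧
      {y | ∃ x ∈ P, K.MorB ⟨I, x⟩ ⟨J, y⟩} = W ∩ (K.chart J).sec ⁻¹' 𝓔.sub I.1 J := by
  obtain ⟨O, hO, hr⟩ := 𝓔.isOpen_range I J hIJ
  obtain ⟨W, hW, hWP⟩ := (K.coord hIJ.le).isEmbedding_φ.isInducing.isOpen_iff.1
    (hP.preimage continuous_subtype_val)
  refine ⟨O ∩ W, hO.inter hW, ?_⟩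
  ext y
  have key := Set.ext_iff.1 hr y
  constructor
  · rintro ⟨x, hx, hm⟩
    obtain ⟨_, h2, rfl⟩ := morB_iff.1 hm
    have h3 := key.1 ⟨_, rfl⟩
    exact ⟨⟨h3.1, (Set.ext_iff.1 hWP ⟨x, h2⟩).2 hx⟩, h3.2⟩
  · rintro ⟨⟨h1, h2⟩, h3⟩
    obtain ⟨x, rfl⟩ := key.2 ⟨h1, h3⟩
    exact ⟨x, (Set.ext_iff.1 hWP x).1 h2, morB_φ hIJ.le x.2⟩

section Existence

variable (F : Fin K.N → Set X) (O : ∀ J : K.idx, Set (K.chart J).U)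

/-- The part of the zero set of a chart over the intersection of the `F i`, `i ∈ L`. -/
def zeroPart (I L : K.idx) : Set (K.chart I).U :=
  {x | ∃ hx : x ∈ K.zeroSet I, (K.chart I).ψ ⟨x, hx⟩ ∈ ⋂ i ∈ L.1, F i}

/-- The points of `U_I` which are mapped to `O J` for all `I ⊆ J ⊆ L`, and for which all
compositions of coordinate changes between such indices are defined. -/
def goodSet (I L : K.idx) : Set (K.chart I).U :=
  {x | ∀ J, I ≤ J → J ≤ L → ∃ y ∈ O J ∩ {y | ∀ M, J ≤ M → M ≤ L →
    ∃ w ∈ (univ : Set (K.chart M).U), K.MorB ⟨J, y⟩ ⟨M, w⟩}, K.MorB ⟨I, x⟩ ⟨J, y⟩}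

/-- The inductive properties of the domains `U_IL = V L` of the coordinate changes of a tame
shrinking, relative to the domains `U_HL = U H L` for `H ⊊ I`. -/
structure TameStep (𝓔 : K.Filtration) (U : ∀ I : K.idx, K.idx → Set (K.chart I).U) (I : K.idx)
    (V : K.idx → Set (K.chart I).U) : Prop where
  isOpen : ∀ L, IsOpen (V L)
  subset : ∀ L, I ≤ L → V L ⊆ goodSet O I L
  zero : ∀ L, I ≤ L → K.zeroSet I ∩ V L = zeroPart F I L
  join : ∀ J L, I ≤ J → I ≤ L → ∀ x ∈ V J ∩ V L, ∃ h : J.1 ∪ L.1 ∈ K.idx, x ∈ V ⟨_, h⟩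
  mono : ∀ J L, I ≤ J → J ≤ L → V L ⊆ V J
  down : ∀ H L, H < I → I ≤ L → ∀ y ∈ V L, (K.chart I).sec y ∈ 𝓔.sub H.1 I →
    ∃ x ∈ U H L, K.MorB ⟨H, x⟩ ⟨I, y⟩
  up : ∀ H L, H < I → I ≤ L → ∀ x ∈ U H L, ∃ y ∈ V L, K.MorB ⟨H, x⟩ ⟨I, y⟩

variable {F O} {𝓔 : K.Filtration} {U U' : ∀ I : K.idx, K.idx → Set (K.chart I).U} {I J L : K.idx}

/-- Only the values of `U` at proper subsets of `I` enter, so an induction on cardinality may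
redefine `U` at larger indices without disturbing earlier steps. -/
theorem TameStep.congr {V : K.idx → Set (K.chart I).U} (h : TameStep F O 𝓔 U I V)
    (hU : ∀ H < I, U H = U' H) : TameStep F O 𝓔 U' I V where
  isOpen := h.isOpen
  subset := h.subset
  zero := h.zero
  join := h.join
  mono := h.mono
  down H L hH := hU H hH ▸ h.down H L hH
  up H L hH := hU H hH ▸ h.up H L hH

theorem isOpen_goodSet (hO : ∀ J, IsOpen (O J)) (I L : K.idx) : IsOpen (goodSet O I L) := by
  simp only [goodSet, ofPred_forall]
  refine isOpen_iInter_of_finite fun J => isOpen_iInter_of_finite fun hIJ =>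
    isOpen_iInter_of_finite fun hJL => isOpen_setOf_exists_morB hIJ ((hO J).inter ?_)
  exact isOpen_iInter_of_finite fun M => isOpen_iInter_of_finite fun hJM =>
    isOpen_iInter_of_finite fun hML => isOpen_setOf_exists_morB hJM isOpen_univ

/-- Every further image of `y` exists by the definition of `goodSet`, and the weak cocycle
identifies it with the corresponding image of `x`, which lies in the prescribed set. Good points are
thus preserved by coordinate changes. -/
theorem exists_mor_of_mem_goodSet {x : (K.chart I).U} (hx : x ∈ goodSet O I L) (hIJ : I ≤ J)
    (hJL : J ≤ L) : ∃ y ∈ goodSet O J L, K.MorB ⟨I, x⟩ ⟨J, y⟩ := by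
  obtain ⟨y, ⟨-, hy⟩, hm⟩ := hx J hIJ hJL
  refine ⟨y, fun M hJM hML => ?_, hm⟩
  obtain ⟨w, hw, hm'⟩ := hx M (hIJ.trans hJM) hML
  obtain ⟨w', -, hw'⟩ := hy M hJM hML
  obtain rfl := hm.weak_trans hw' hm'
  exact ⟨w, hw, hw'⟩

theorem mem_goodSet_of_mor {x : (K.chart I).U} {y : (K.chart J).U} (hx : x ∈ goodSet O I L)
    (hm : K.MorB ⟨I, x⟩ ⟨J, y⟩) (hJL : J ≤ L) : y ∈ goodSet O J L := by
  obtain ⟨y', hy', hm'⟩ := exists_mor_of_mem_goodSet hx hm.le hJL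
  rwa [hm.right_unique hm']

theorem zeroPart_iff_of_morB {x : (K.chart I).U} {y : (K.chart J).U}
    (hm : K.MorB ⟨I, x⟩ ⟨J, y⟩) : x ∈ zeroPart F I L ↔ y ∈ zeroPart F J L := by
  constructor
  · rintro ⟨hx, h⟩
    exact ⟨hm.mem_zeroSet_iff.1 hx, by rwa [hm.ψ_eq hx]⟩
  · rintro ⟨hy, h⟩
    exact ⟨hm.mem_zeroSet_iff.2 hy, by rwa [← hm.ψ_eq]⟩

theorem exists_morB_of_mem_zeroPart (hF : ∀ i, F i ⊆ K.F i) (hIJ : I ≤ J) (hJL : J ≤ L)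
    {x : (K.chart I).U} (hx : x ∈ zeroPart F I L) :
    ∃ y ∈ zeroPart F J L, K.MorB ⟨I, x⟩ ⟨J, y⟩ := by
  obtain ⟨hx, h⟩ := hx
  obtain ⟨y, hy, hψ, hm⟩ := exists_morB_of_zero hIJ hx (by
    rw [K.foot_chart]
    exact mem_iInter₂.2 fun i hi => hF i (mem_iInter₂.1 h i (hJL hi)))
  exact ⟨y, ⟨hy, by rwa [hψ]⟩, hm⟩

theorem zeroPart_subset_goodSet (hF : ∀ i, F i ⊆ K.F i)
    (hO : ∀ J, zeroPart F J J ⊆ O J) : zeroPart F I L ⊆ goodSet O I L := by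
  intro x hx J hIJ hJL
  obtain ⟨y, hy, hm⟩ := exists_morB_of_mem_zeroPart hF hIJ hJL hx
  refine ⟨y, ⟨hO J ?_, fun M hJM hML => ?_⟩, hm⟩
  · obtain ⟨hy, h⟩ := hy
    exact ⟨hy, mem_iInter₂.2 fun i hi => mem_iInter₂.1 h i (hJL hi)⟩
  · obtain ⟨w, -, hw⟩ := exists_morB_of_mem_zeroPart hF hJM hML hy
    exact ⟨w, trivial, hw⟩

theorem exists_isOpen_zeroPart (hFo : ∀ i, IsOpen (F i)) :
    ∃ W : Set (K.chart I).U, IsOpen W ∧ zeroPart F I L = W ∩ K.zeroSet I := by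
  obtain ⟨W, hW, h⟩ := isOpen_induced_iff.1
    ((L.1.finite_toSet.isOpen_biInter fun i _ => hFo i).preimage
      (K.chart I).isOpenEmbedding_ψ.continuous)
  refine ⟨W, hW, ?_⟩
  ext x
  constructor
  · rintro ⟨hx, h'⟩
    exact ⟨(Set.ext_iff.1 h ⟨x, hx⟩).2 h', hx⟩
  · rintro ⟨h', hx⟩
    exact ⟨hx, (Set.ext_iff.1 h ⟨x, hx⟩).1 h'⟩

/-- The points of `U_I` that have to lie in `U_IL`, given the `U_HL` for `H ⊊ I`. -/
def forcedSet (F : Fin K.N → Set X) (U : ∀ I : K.idx, K.idx → Set (K.chart I).U) (I L : K.idx) :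
    Set (K.chart I).U :=
  {x | x ∈ zeroPart F I L ∨ ∃ G < I, ∃ w ∈ U G L, K.MorB ⟨G, w⟩ ⟨I, x⟩}

/-- Coordinate changes preserve zeros and footprints, and by induction the zeros in `U_GL` are
exactly those over `F_L`; so lower charts force no further zeros. -/
theorem zeroSet_inter_forcedSet (hU : ∀ H < I, TameStep F O 𝓔 U H (U H)) (hIL : I ≤ L)
    {x : (K.chart I).U} (hx : x ∈ forcedSet F U I L) (hz : x ∈ K.zeroSet I) :
    x ∈ zeroPart F I L := by
  rcases hx with hx | ⟨G, hG, w, hw, hm⟩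
  · exact hx
  · refine (zeroPart_iff_of_morB hm).1 ?_
    rw [← (hU G hG).zero L (hG.le.trans hIL)]
    exact ⟨hm.mem_zeroSet_iff.2 hz, hw⟩

/-- The compatibility that makes the induction work: demands coming from `G` are already demands of
`H` on `s_I⁻¹(E_HI)`. Zeros are handled by footprints. A nonzero forced point coming from `G` has
its section in `E_(G∩H)I`, which forces `G ∩ H ≠ ∅`; it descends from `G` to `G ∩ H` and is lifted
from there to `H`. -/
theorem exists_of_mem_forcedSet (hU : ∀ H < I, TameStep F O 𝓔 U H (U H)) (hIL : I ≤ L) {H : K.idx} (hH : H < I)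
    {x : (K.chart I).U} (hx : x ∈ forcedSet F U I L) (hs : (K.chart I).sec x ∈ 𝓔.sub H.1 I) :
    ∃ v ∈ U H L, K.MorB ⟨H, v⟩ ⟨I, x⟩ := by
  by_cases hz : x ∈ K.zeroSet I
  · have hx := zeroSet_inter_forcedSet hU hIL hx hz
    obtain ⟨v, hv, -, hm⟩ := exists_morB_to_zero hH.le hz
    have h1 := (zeroPart_iff_of_morB hm).2 hx
    rw [← (hU H hH).zero L (hH.le.trans hIL)] at h1
    exact ⟨v, h1.2, hm⟩
  · obtain hx | ⟨G, hG, w, hw, hm⟩ := hx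
    · exact absurd hx.fst hz
    have hGH : (K.chart I).sec x ∈ 𝓔.sub (G.1 ∩ H.1) I := by
      rw [← 𝓔.inter_sub _ _ I hG.le hH.le]
      exact ⟨𝓔.sec_mem_of_morB hm, hs⟩
    have hne : (G.1 ∩ H.1).Nonempty := by
      by_contra h
      rw [Finset.not_nonempty_iff_eq_empty] at h
      rw [h, 𝓔.sec_mem_empty_iff] at hGH
      exact hz hGH
    obtain ⟨M, hM⟩ : ∃ M : K.idx, M.1 = G.1 ∩ H.1 :=
      ⟨⟨_, mem_idx_of_subset hne Finset.inter_subset_left⟩, rfl⟩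
    rw [← hM] at hGH
    have hMG : M ≤ G := by change M.1 ⊆ G.1; rw [hM]; exact Finset.inter_subset_left
    have hMH : M ≤ H := by change M.1 ⊆ H.1; rw [hM]; exact Finset.inter_subset_right
    have hMI : M < I := hMH.trans_lt hH
    have hsw := (𝓔.mem_iff_of_morE hMG hm.sec).2 hGH
    obtain ⟨v, hv, hvw⟩ : ∃ v ∈ U M L, K.MorB ⟨M, v⟩ ⟨G, w⟩ := by
      rcases hMG.eq_or_lt with rfl | hlt
      · exact ⟨w, hw, MorB.refl w⟩
      · exact (hU G hG).down M L hlt (hG.le.trans hIL) w hw hsw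
    -- Goodness of `v` ensures that the direct map from `M = G ∩ H` to `I` is defined at `v`. By the
    -- weak cocycle its value, first via `G` and then via `H`, is `x`.
    have hvN := (hU M hMI).subset L (hMI.le.trans hIL) hv
    obtain ⟨x', -, hx'⟩ := exists_mor_of_mem_goodSet hvN hMI.le hIL
    have hvx := hvw.weak_trans_mor hm hx'
    obtain ⟨y, hy, hvy⟩ : ∃ y ∈ U H L, K.MorB ⟨M, v⟩ ⟨H, y⟩ := by
      rcases hMH.eq_or_lt with rfl | hlt
      · exact ⟨v, hv, MorB.refl v⟩
      · exact (hU H hH).up M L hlt (hH.le.trans hIL) v hv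
    have hyN := (hU H hH).subset L (hH.le.trans hIL) hy
    obtain ⟨x'', -, hx''⟩ := exists_mor_of_mem_goodSet hyN hH.le hIL
    obtain rfl := hvy.weak_trans hx'' hvx
    exact ⟨y, hy, hx''⟩

/-- By the preceding lemma, on each closed piece `s_I⁻¹(E_HI)` the forced set is just the image of
`U_HL`, which is relatively open; on the zero set it is the part over `F_L`. Deleting from the good
set the finitely many closed complements within these pieces leaves the required open set. -/
theorem exists_isOpen_forcedSet (hFo : ∀ i, IsOpen (F i)) (hF : ∀ i, F i ⊆ K.F i)
    (hO : ∀ J, IsOpen (O J)) (hOz : ∀ J, zeroPart F J J ⊆ O J)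
    (hU : ∀ H < I, TameStep F O 𝓔 U H (U H)) (hIL : I ≤ L) :
    ∃ W : Set (K.chart I).U, IsOpen W ∧ W ⊆ goodSet O I L ∧
      (K.zeroSet I ∪ ⋃ H ∈ Iio I, (K.chart I).sec ⁻¹' 𝓔.sub H.1 I) ∩ W = forcedSet F U I L := by
  obtain ⟨W₀, hW₀, hz⟩ := exists_isOpen_zeroPart (I := I) (L := L) hFo
  choose! W hW hWi using fun (H : K.idx) (hH : H < I) =>
    exists_isOpen_image_morB 𝓔 hH ((hU H hH).isOpen L)
  refine ⟨goodSet O I L \ ((K.zeroSet I \ W₀) ∪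
    ⋃ H ∈ Iio I, ((K.chart I).sec ⁻¹' 𝓔.sub H.1 I) \ W H), ?_, sdiff_subset, ?_⟩
  · refine (isOpen_goodSet hO I L).sdiff (((isClosed_zeroSet I).sdiff hW₀).union
      ((toFinite _).isClosed_biUnion fun H hH => ?_))
    exact ((𝓔.isClosed_sub H.1 I (show H ≤ I from le_of_lt hH)).preimage
      (K.chart I).continuous_sec).sdiff (hW H hH)
  · ext x
    constructor
    · rintro ⟨hx | hx, hN, hB⟩
      · refine Or.inl ?_
        rw [hz]
        exact ⟨by_contra fun h => hB (Or.inl ⟨hx, h⟩), hx⟩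
      · obtain ⟨H, hH, hs⟩ := mem_iUnion₂.1 hx
        have hxW : x ∈ W H := by_contra fun h => hB (Or.inr (mem_iUnion₂.2 ⟨H, hH, hs, h⟩))
        obtain ⟨w, hw, hm⟩ := (Set.ext_iff.1 (hWi H hH) x).2 ⟨hxW, hs⟩
        exact Or.inr ⟨H, hH, w, hw, hm⟩
    · intro hx
      refine ⟨?_, ?_, ?_⟩
      · rcases hx with hx | ⟨G, hG, w, -, hm⟩
        · exact Or.inl hx.fst
        · exact Or.inr (mem_iUnion₂.2 ⟨G, hG, 𝓔.sec_mem_of_morB hm⟩)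
      · rcases hx with hx | ⟨G, hG, w, hw, hm⟩
        · exact zeroPart_subset_goodSet hF hOz hx
        · exact mem_goodSet_of_mor ((hU G hG).subset L (hG.le.trans hIL) hw) hm hIL
      · rintro (⟨h1, h2⟩ | h)
        · have := zeroSet_inter_forcedSet hU hIL hx h1
          rw [hz] at this
          exact h2 this.1
        · obtain ⟨H, hH, hs, h2⟩ := mem_iUnion₂.1 h
          have := (Set.ext_iff.1 (hWi H hH) x).1 (exists_of_mem_forcedSet hU hIL hH hx hs)
          exact h2 this.1

/-- The forced sets satisfy the monotonicity and join conditions, and a thickening with control of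
intersections carries both over to open subsets of `U_I`. On the closed set where the section
vanishes or lies in some `E_HI` nothing is added. -/
theorem exists_tameStep (hFo : ∀ i, IsOpen (F i)) (hF : ∀ i, F i ⊆ K.F i)
    (hO : ∀ J, IsOpen (O J)) (hOz : ∀ J, zeroPart F J J ⊆ O J)
    (hU : ∀ H < I, TameStep F O 𝓔 U H (U H)) :
    ∃ V, TameStep F O 𝓔 U I V := by
  choose! W hW hWN hWA using fun (L : K.idx) (hIL : I ≤ L) =>
    exists_isOpen_forcedSet hFo hF hO hOz hU hIL
  obtain ⟨V', hV'o, hV'W, hZV, hmono, hjoin⟩ := exists_isOpen_inter_subset (ι := {L // I ≤ L})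
    (K.zeroSet I ∪ ⋃ H ∈ Iio I, (K.chart I).sec ⁻¹' 𝓔.sub H.1 I) (fun L => W L.1)
    (fun L => hW L.1 L.2)
  have forced : ∀ L (h : I ≤ L), forcedSet F U I L ⊆ V' ⟨L, h⟩ := fun L h =>
    (hWA L h).symm.subset.trans (hZV ⟨L, h⟩)
  have forced_mono : ∀ J L, I ≤ J → J ≤ L → forcedSet F U I L ⊆ forcedSet F U I J := by
    rintro J L hIJ hJL x (⟨hx, h⟩ | ⟨G, hG, w, hw, hm⟩)
    · exact Or.inl ⟨hx, mem_iInter₂.2 fun i hi => mem_iInter₂.1 h i (hJL hi)⟩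
    · exact Or.inr ⟨G, hG, w, (hU G hG).mono J L (hG.le.trans hIJ) hJL hw, hm⟩
  -- Zeros are handled by footprints. A nonzero point forced for `J` comes from some `w ∈ U_GJ`; its
  -- section lies in `E_GI`, so it also comes from `U_GL`, by injectivity at the same `w`, and the
  -- join condition of `G` applies.
  have forced_join : ∀ J L, I ≤ J → I ≤ L → ∀ x ∈ forcedSet F U I J ∩ forcedSet F U I L,
      ∃ h : J.1 ∪ L.1 ∈ K.idx, x ∈ forcedSet F U I ⟨_, h⟩ := by
    rintro J L hIJ hIL x ⟨hxJ, hxL⟩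
    by_cases hz : x ∈ K.zeroSet I
    · have h1 := (zeroSet_inter_forcedSet hU hIJ hxJ hz).snd
      have h2 := (zeroSet_inter_forcedSet hU hIL hxL hz).snd
      have h3 : (K.chart I).ψ ⟨x, hz⟩ ∈ ⋂ i ∈ J.1 ∪ L.1, F i := by
        refine mem_iInter₂.2 fun i hi => ?_
        rcases Finset.mem_union.1 hi with hi | hi
        · exact mem_iInter₂.1 h1 i hi
        · exact mem_iInter₂.1 h2 i hi
      have hu : J.1 ∪ L.1 ∈ K.idx := (K.mem_idx _).2
        ⟨((K.mem_idx _).1 J.2).1.mono Finset.subset_union_left,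
          _, mem_iInter₂.2 fun i hi => hF i (mem_iInter₂.1 h3 i hi)⟩
      exact ⟨hu, Or.inl ⟨hz, h3⟩⟩
    · rcases id hxJ with hxJ' | ⟨G, hG, w, hw, hm⟩
      · exact absurd hxJ'.fst hz
      obtain ⟨w', hw', hm'⟩ := exists_of_mem_forcedSet hU hIL hG hxL (𝓔.sec_mem_of_morB hm)
      obtain rfl := hm.left_unique hm'
      obtain ⟨hu, hwu⟩ := (hU G hG).join J L (hG.le.trans hIJ) (hG.le.trans hIL) w ⟨hw, hw'⟩
      exact ⟨hu, Or.inr ⟨G, hG, w, hwu, hm⟩⟩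
  have hV' : ∀ L, ∀ h : I ≤ L, ∀ x ∈ V' ⟨L, h⟩, x ∈ K.zeroSet I ∪
      ⋃ H ∈ Iio I, (K.chart I).sec ⁻¹' 𝓔.sub H.1 I → x ∈ forcedSet F U I L :=
    fun L h x hx hZ => (hWA L h).subset ⟨hZ, hV'W ⟨L, h⟩ hx⟩
  -- The union over proofs of `I ≤ L` makes the set empty for all other `L`.
  refine ⟨fun L => ⋃ h : I ≤ L, V' ⟨L, h⟩, fun L => isOpen_iUnion fun h => hV'o _, ?_, ?_, ?_, ?_,
    ?_, ?_⟩
  · intro L h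
    simpa [h] using (hV'W ⟨L, h⟩).trans (hWN L h)
  · intro L h
    simp only [h, iUnion_true]
    ext x
    constructor
    · rintro ⟨hz, hx⟩
      exact zeroSet_inter_forcedSet hU h (hV' L h x hx (Or.inl hz)) hz
    · exact fun hx => ⟨hx.fst, forced L h (Or.inl hx)⟩
  · intro J L hJ hL x hx
    simp only [hJ, hL, iUnion_true] at hx
    -- The thickening attaches to `x` a point `z` forced for both `J` and `L`, hence for `J ∪ L`;
    -- and `x` lies in every set of the thickening that belongs to `z`.
    obtain ⟨z, ⟨⟨hzZ, hzJ⟩, hzL⟩, hz⟩ := hjoin ⟨J, hJ⟩ ⟨L, hL⟩ x hx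
    obtain ⟨hu, hzu⟩ := forced_join J L hJ hL z
      ⟨(hWA J hJ).subset ⟨hzZ, hzJ⟩, (hWA L hL).subset ⟨hzZ, hzL⟩⟩
    have hIu : I ≤ ⟨J.1 ∪ L.1, hu⟩ := hJ.trans Finset.subset_union_left
    exact ⟨hu, mem_iUnion.2 ⟨hIu, hz ⟨_, hIu⟩ ((hWA _ hIu).symm.subset hzu).2⟩⟩
  · intro J L hJ hJL
    have hL := hJ.trans hJL
    simp only [hJ, hL, iUnion_true]
    refine hmono ⟨L, hL⟩ ⟨J, hJ⟩ fun z hz => ?_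
    exact ((hWA J hJ).symm.subset (forced_mono J L hJ hJL ((hWA L hL).subset hz))).2
  · intro H L hH hL y hy hs
    simp only [hL, iUnion_true] at hy
    exact exists_of_mem_forcedSet hU hL hH
      (hV' L hL y hy (Or.inr (mem_iUnion₂.2 ⟨H, hH, hs⟩))) hs
  · intro H L hH hL x hx
    simp only [hL, iUnion_true]
    obtain ⟨y, -, hm⟩ := exists_mor_of_mem_goodSet
      ((hU H hH).subset L (hH.le.trans hL) hx) hH.le hL
    exact ⟨y, forced L hL (Or.inr ⟨H, hH, x, hx, hm⟩), hm⟩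

theorem exists_tameSteps (𝓔 : K.Filtration) (hFo : ∀ i, IsOpen (F i)) (hF : ∀ i, F i ⊆ K.F i)
    (hO : ∀ J, IsOpen (O J)) (hOz : ∀ J, zeroPart F J J ⊆ O J) :
    ∃ U, ∀ I, TameStep F O 𝓔 U I (U I) := by
  have key : ∀ n : ℕ, ∃ U, ∀ I : K.idx, I.1.card < n → TameStep F O 𝓔 U I (U I) := by
    intro n
    induction n with
    | zero => exact ⟨fun _ _ => ∅, fun I h => absurd h (Nat.not_lt_zero _)⟩
    | succ n ih =>
      obtain ⟨U, hU⟩ := ih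
      have hcard : ∀ {H I : K.idx}, H < I → H.1.card < I.1.card := fun h => Finset.card_lt_card h
      choose! V hV using fun (I : K.idx) (hI : I.1.card = n) =>
        exists_tameStep (I := I) hFo hF hO hOz (fun H hH => hU H (hI ▸ hcard hH))
      classical
      refine ⟨fun I => if I.1.card = n then V I else U I, fun I hI => ?_⟩
      have hc : ∀ H < I, U H = if H.1.card = n then V H else U H := fun H hH => by
        rw [if_neg]
        have := hcard hH
        omega
      rcases (Nat.lt_succ_iff.1 hI).eq_or_lt with h | h
      · beta_reduce
        rw [if_pos h]
        exact (hV I h).congr hc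
      · beta_reduce
        rw [if_neg h.ne]
        exact (hU I h).congr hc
  -- Every index has at most `N` elements, so stage `N + 1` covers all of them.
  obtain ⟨U, hU⟩ := key (K.N + 1)
  exact ⟨U, fun I => hU I (Nat.lt_succ_of_le (by simpa using Finset.card_le_univ I.1))⟩

/-- The diagonal sets `U_II` serve as domains. Any point of `U_I` mapped into `U_JJ` already lies in
`U_IJ`, so the inductive conditions on `U_IL` translate into the three clauses. -/
theorem tameFamily_of_tameSteps (hU : ∀ I, TameStep F O 𝓔 U I (U I)) :
    K.TameFamily 𝓔 (fun I => U I I) := by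
  have down : ∀ {I J L : K.idx}, I ≤ J → J ≤ L → ∀ y ∈ U J L, (K.chart J).sec y ∈ 𝓔.sub I.1 J →
      ∃ x ∈ U I L, K.MorB ⟨I, x⟩ ⟨J, y⟩ := by
    intro I J L hIJ hJL y hy hs
    rcases hIJ.eq_or_lt with rfl | hlt
    · exact ⟨y, hy, MorB.refl y⟩
    · exact (hU J).down I L hlt hJL y hy hs
  have up : ∀ {I J L : K.idx}, I ≤ J → J ≤ L → ∀ x ∈ U I L,
      ∃ y ∈ U J L, K.MorB ⟨I, x⟩ ⟨J, y⟩ := by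
    intro I J L hIJ hJL x hx
    rcases hIJ.eq_or_lt with rfl | hlt
    · exact ⟨x, hx, MorB.refl x⟩
    · exact (hU J).up I L hlt hJL x hx
  -- `down` produces a preimage of `y` in `U_IJ`, and injectivity makes it equal to `x`.
  have dom : ∀ {I J : K.idx} {x : (K.chart I).U} {y : (K.chart J).U}, y ∈ U J J →
      K.MorB ⟨I, x⟩ ⟨J, y⟩ → x ∈ U I J := by
    intro I J x y hy hm
    obtain ⟨x', hx', hm'⟩ := down hm.le le_rfl y hy (𝓔.sec_mem_of_morB hm)
    rwa [hm.left_unique hm']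
  refine ⟨?_, ?_, ?_⟩
  · intro I J L x z hIJ hJL hx hz hm
    obtain ⟨y, hy, hxy⟩ := up hIJ hJL x (dom hz hm)
    obtain ⟨z', hz', hyz'⟩ := up hJL le_rfl y hy
    obtain rfl := hxy.weak_trans hyz' hm
    exact ⟨y, (hU J).mono J L le_rfl hJL hy, hxy, hyz'⟩
  · intro I J L y z hIJ hy hz hm hs
    obtain ⟨x, hx, hxy⟩ := down hIJ hm.le y (dom hz hm) hs
    have hIL := hIJ.trans hm.le
    obtain ⟨z', -, hxz'⟩ := exists_mor_of_mem_goodSet ((hU I).subset L hIL hx) hIL le_rfl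
    exact ⟨x, (hU I).mono I L le_rfl hIL hx, hxy, hxy.weak_trans_mor hm hxz'⟩
  · intro I J L x y z _ hy hz hm hm'
    obtain ⟨hu, hxu⟩ := (hU I).join J L hm.le hm'.le x ⟨dom hy hm, dom hz hm'⟩
    obtain ⟨w, hw, hxw⟩ := up (J := ⟨_, hu⟩) (hm.le.trans Finset.subset_union_left) le_rfl x hxu
    exact ⟨hu, w, hw, hxw⟩

end Existence

/-- Each `F i` is a neighbourhood of three closed sets with closure in `K.F i`: a closed shrinking
of the cover, the prescribed `A i`, and one chosen point of `F_I` for every `I ∋ i`. The chosen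
points keep the index set unchanged. -/
theorem exists_shrinking_cover [MetrizableSpace X] (K : WeakAtlas.{u, v} X) (A : Fin K.N → Set X)
    (hA : ∀ i, IsClosed (A i)) (hAF : ∀ i, A i ⊆ K.F i) :
    ∃ F : Fin K.N → Set X, (∀ i, IsOpen (F i)) ∧ (∀ i, closure (F i) ⊆ K.F i) ∧
      ⋃ i, F i = univ ∧ (∀ i, A i ⊆ F i) ∧
      ∀ I : Finset (Fin K.N), (⋂ i ∈ I, K.F i).Nonempty → (⋂ i ∈ I, F i).Nonempty := by
  obtain ⟨v, hv, -, hvF⟩ := exists_iUnion_eq_closure_subset K.isOpen_F (fun _ => toFinite _)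
    K.cover_F
  choose p hp using fun (I : Finset (Fin K.N)) (h : (⋂ i ∈ I, K.F i).Nonempty) =>
    (show ∃ p, p ∈ ⋂ i ∈ I, K.F i from h)
  let P : Fin K.N → Set X := fun i =>
    ⋃ (I : Finset (Fin K.N)) (h : i ∈ I ∧ (⋂ i ∈ I, K.F i).Nonempty), {p I h.2}
  have hP : ∀ i, IsClosed (P i) := fun i => isClosed_iUnion_of_finite fun I =>
    isClosed_iUnion_of_finite fun _ => isClosed_singleton
  have hPF : ∀ i, P i ⊆ K.F i := fun i => iUnion₂_subset fun I hI => by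
    rw [singleton_subset_iff]
    exact mem_iInter₂.1 (hp I hI.2) i hI.1
  choose F hFo hF hFc using fun i => normal_exists_closure_subset
    (((isClosed_closure (s := v i)).union (hA i)).union (hP i)) (K.isOpen_F i)
    (union_subset (union_subset (hvF i) (hAF i)) (hPF i))
  refine ⟨F, hFo, hFc, ?_, fun i x hx => hF i (Or.inl (Or.inr hx)), fun I hI => ?_⟩
  · rw [← univ_subset_iff, ← hv]
    exact iUnion_mono fun i x hx => hF i (Or.inl (Or.inl (subset_closure hx)))
  · exact ⟨p I hI, mem_iInter₂.2 fun i hi =>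
      hF i (Or.inr (mem_iUnion₂.2 ⟨I, ⟨hi, hI⟩, mem_singleton _⟩))⟩

/-- Every filtered weak atlas has a tame shrinking, whose footprints can be chosen to contain given
closed subsets of the footprints. -/
theorem exists_isTame [CompactSpace X] [MetrizableSpace X] (K : WeakAtlas.{u, v} X) (𝓔 : K.Filtration) (A : Fin K.N → Set X)
    (hA : ∀ i, IsClosed (A i)) (hAF : ∀ i, A i ⊆ K.F i) :
    ∃ S : K.Shrinking, S.IsTame 𝓔 ∧ ∀ i, A i ⊆ S.F i := by
  obtain ⟨F, hFo, hFc, hFu, hAF', hne⟩ := K.exists_shrinking_cover A hA hAF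
  -- The zeros over the intersection of the closures of the `F i` are compact, so they have a
  -- precompact open neighbourhood. The new domains stay inside it because `U_II ⊆ goodSet O I I ⊆ O
  -- I`.
  have hO : ∀ J : K.idx, ∃ O : Set (K.chart J).U, IsOpen O ∧ zeroPart F J J ⊆ O ∧
      IsCompact (closure O) := by
    intro J
    have hc : IsClosed (⋂ i ∈ J.1, closure (F i)) :=
      isClosed_biInter fun i _ => isClosed_closure
    have hsub : (⋂ i ∈ J.1, closure (F i)) ⊆ range (K.chart J).ψ := by
      change _ ⊆ (K.chart J).foot
      rw [K.foot_chart]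
      exact iInter₂_mono fun i _ => hFc i
    have := ((K.chart J).isOpenEmbedding_ψ.isInducing.isCompact_preimage_iff hsub).2 hc.isCompact
    obtain ⟨O, hO, hsO, hOc⟩ := exists_isOpen_superset_and_isCompact_closure
      (this.image continuous_subtype_val)
    refine ⟨O, hO, ?_, hOc⟩
    rintro x ⟨hx, h⟩
    exact hsO ⟨⟨x, hx⟩, iInter₂_mono (fun i _ => subset_closure) h, rfl⟩
  choose O hO hOz hOc using hO
  obtain ⟨U, hU⟩ := exists_tameSteps 𝓔 hFo (fun i => subset_closure.trans (hFc i)) hO hOz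
  let S : K.Shrinking :=
    { F := F
      isOpen_F := hFo
      closure_F := fun i => ⟨isClosed_closure.isCompact, hFc i⟩
      cover_F := hFu
      nonempty_F := hne
      U := fun I => U I I
      isOpen_U := fun I => (hU I).isOpen I
      isCompact_closure_U := fun I => (hOc I).of_isClosed_subset isClosed_closure
        (closure_mono fun x hx => by
          obtain ⟨y, hy, hm⟩ := (hU I).subset I le_rfl hx I le_rfl le_rfl
          rw [hm.eq]
          exact hy.1)
      mem_U_iff := fun I x => by
        have := Set.ext_iff.1 ((hU I).zero I le_rfl) x.1
        exact ⟨fun h => (this.1 ⟨x.2, h⟩).snd, fun h => (this.2 ⟨x.2, h⟩).2⟩ }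
  exact ⟨S, (S.isTame_iff 𝓔).2 (tameFamily_of_tameSteps hU), hAF'⟩

end WeakAtlas

end Kuranishi

/-! ### Shrinkings of shrinkings. -/

namespace Kuranishi

namespace WeakAtlas

variable {X : Type u} [TopologicalSpace X] {K : WeakAtlas.{u, v} X}

namespace Shrinking

/-- A compact closure in `S'.U I` remains closed in `U_I`; conversely, compactness in `U_I` is
inherited once the closure lies in `S'.U I`. So only nested closures matter. -/
theorem isShrinkingOf_iff (S S' : K.Shrinking) : S.IsShrinkingOf S' ↔
    (∀ i, closure (S.F i) ⊆ S'.F i) ∧ ∀ I, closure (S.U I) ⊆ S'.U I := by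
  constructor
  · rintro ⟨T, hF, hU⟩
    refine ⟨fun i => hF ▸ (T.closure_F i).2, fun I => ?_⟩
    have hc : IsCompact (Subtype.val '' closure (show Set (S'.U I) from T.U I)) :=
      (T.isCompact_closure_U I).image continuous_subtype_val
    rw [hU I]
    refine (closure_minimal (image_mono subset_closure) hc.isClosed).trans ?_
    rintro _ ⟨x, -, rfl⟩
    exact x.2
  · rintro ⟨hF, hU⟩
    refine ⟨{ F := S.F
              isOpen_F := S.isOpen_F
              closure_F := fun i => ⟨(S.closure_F i).1, hF i⟩
              cover_F := S.cover_F
              nonempty_F := fun I h => S.nonempty_F I (h.mono (S'.inter_F_subset I))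
              U := fun I => (Subtype.val : S'.U I → _) ⁻¹' S.U I
              isOpen_U := fun I => (S.isOpen_U I).preimage continuous_subtype_val
              isCompact_closure_U := fun I => ?_
              mem_U_iff := fun I x => S.mem_U_iff I ⟨x.1.1, congrArg Subtype.val x.2⟩ }, rfl,
      fun I => ?_⟩
    · have h1 : IsCompact ((Subtype.val : S'.U I → _) ⁻¹' closure (S.U I)) :=
        (IsInducing.subtypeVal.isCompact_preimage_iff (by
          rw [Subtype.range_coe]; exact hU I)).2 (S.isCompact_closure_U I)
      exact h1.of_isClosed_subset isClosed_closure
        (closure_minimal (preimage_mono subset_closure)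
          (isClosed_closure.preimage continuous_subtype_val))
    · change S.U I = Subtype.val '' ((Subtype.val : S'.U I → _) ⁻¹' S.U I)
      rw [Subtype.image_preimage_coe, inter_eq_right.2 (subset_closure.trans (hU I))]

end Shrinking

/-- Apply the existence result to `K` and then to the atlas so obtained; tameness of the second
family passes to `K` because the morphisms are the same. The closed sets `A i` allow footprints to
be kept large, as a concordance requires. -/
theorem exists_isPreshrunkTame [CompactSpace X] [MetrizableSpace X] (K : WeakAtlas.{u, v} X)
    (𝓔 : K.Filtration) (A : Fin K.N → Set X) (hA : ∀ i, IsClosed (A i))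
    (hAF : ∀ i, A i ⊆ K.F i) :
    ∃ S : K.Shrinking, S.IsPreshrunkTame 𝓔 ∧ ∀ i, A i ⊆ S.F i := by
  obtain ⟨S', hS', hAS'⟩ := K.exists_isTame 𝓔 A hA hAF
  obtain ⟨T, hT, hAT⟩ := S'.atlas.exists_isTame (S'.filtration 𝓔) A hA hAS'
  have hcl : ∀ I : K.idx, IsCompact (Subtype.val '' closure (show Set (S'.U I) from T.U I)) :=
    fun I => (T.isCompact_closure_U I).image continuous_subtype_val
  let S : K.Shrinking :=
    { F := T.F
      isOpen_F := T.isOpen_F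
      closure_F := fun i => ⟨(T.closure_F i).1,
        (T.closure_F i).2.trans (subset_closure.trans (S'.closure_F i).2)⟩
      cover_F := T.cover_F
      nonempty_F := fun I h => T.nonempty_F I (S'.nonempty_F I h)
      U := fun I => Subtype.val '' (show Set (S'.U I) from T.U I)
      isOpen_U := fun I => (S'.isOpen_U I).isOpenMap_subtype_val _ (T.isOpen_U I)
      isCompact_closure_U := fun I => (hcl I).of_isClosed_subset isClosed_closure
        (closure_minimal (image_mono subset_closure) (hcl I).isClosed)
      mem_U_iff := by
        intro I x
        constructor
        · rintro ⟨y, hy, hyx⟩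
          obtain ⟨x, hx⟩ := x
          dsimp only at hyx
          subst hyx
          exact (T.mem_U_iff I ⟨y, Subtype.ext hx⟩).1 hy
        · intro h
          have hx := (S'.mem_U_iff I x).2 (T.inter_F_subset I.1 h)
          exact ⟨⟨x.1, hx⟩, (T.mem_U_iff I ⟨⟨x.1, hx⟩, Subtype.ext x.2⟩).2 h, rfl⟩ }
  have hTt := (T.isTame_iff _).1 hT
  refine ⟨S, ⟨(S.isTame_iff 𝓔).2 ⟨?_, ?_, ?_⟩, S', hS', T, rfl, fun I => rfl⟩, hAT⟩
  · rintro I J L _ _ hIJ hJL ⟨x, hx, rfl⟩ ⟨z, hz, rfl⟩ hm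
    obtain ⟨y, hy, h1, h2⟩ := hTt.up (I := I) (J := J) (L := L) hIJ hJL hx hz
      ((S'.morB_atlas_iff x z).2 hm)
    exact ⟨y.1, ⟨y, hy, rfl⟩, (S'.morB_atlas_iff x y).1 h1, (S'.morB_atlas_iff y z).1 h2⟩
  · rintro I J L _ _ hIJ ⟨y, hy, rfl⟩ ⟨z, hz, rfl⟩ hm hs
    obtain ⟨x, hx, h1, h2⟩ := hTt.down (I := I) (J := J) (L := L) hIJ hy hz
      ((S'.morB_atlas_iff y z).2 hm) hs
    exact ⟨x.1, ⟨x, hx, rfl⟩, (S'.morB_atlas_iff x y).1 h1, (S'.morB_atlas_iff x z).1 h2⟩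
  · rintro I J L _ _ _ ⟨x, hx, rfl⟩ ⟨y, hy, rfl⟩ ⟨z, hz, rfl⟩ hm hm'
    obtain ⟨hu, w, hw, h1⟩ := hTt.join (I := I) (J := J) (L := L) hx hy hz
      ((S'.morB_atlas_iff x y).2 hm) ((S'.morB_atlas_iff x z).2 hm')
    exact ⟨hu, w.1, ⟨w, hw, rfl⟩, (S'.morB_atlas_iff x w).1 h1⟩

end WeakAtlas

end Kuranishi

/-! ### The identification relation on vectors and closedness of saturations. -/

namespace Kuranishi

namespace WeakAtlas

variable {X : Type u} [TopologicalSpace X] {K : WeakAtlas.{u, v} X}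

/-- Two elements of the obstruction bundles are related over a family `V` of subsets of the domains
if they are mapped to a common element over `V`. -/
def RelE (K : WeakAtlas.{u, v} X) (V : ∀ I : K.idx, Set (K.chart I).U) (p q : K.ObjE) : Prop :=
  ∃ (M : K.idx) (g : (K.chart M).E), (K.chart M).pr g ∈ V M ∧ K.MorE p ⟨M, g⟩ ∧ K.MorE q ⟨M, g⟩

section RelE

variable {𝓔 : K.Filtration} {V W : ∀ I : K.idx, Set (K.chart I).U} {I J L : K.idx}

theorem RelE.symm {p q : K.ObjE} (hpq : K.RelE V p q) : K.RelE V q p := by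
  obtain ⟨M, g, hg, h1, h2⟩ := hpq
  exact ⟨M, g, hg, h2, h1⟩

theorem relE_of_morE {e : (K.chart I).E} {f : (K.chart J).E} (hf : (K.chart J).pr f ∈ V J)
    (h : K.MorE ⟨I, e⟩ ⟨J, f⟩) : K.RelE V ⟨I, e⟩ ⟨J, f⟩ :=
  ⟨J, f, hf, h, MorE.refl f⟩

theorem RelE.eq {e f : (K.chart I).E} (h : K.RelE V ⟨I, e⟩ ⟨I, f⟩) : e = f := by
  obtain ⟨M, g, -, h1, h2⟩ := h
  exact h1.left_unique h2

theorem TameFamily.transE (hV : K.TameFamily 𝓔 V) {e : (K.chart I).E} {f : (K.chart J).E}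
    {g : (K.chart L).E} (hf : (K.chart J).pr f ∈ V J) (hg : (K.chart L).pr g ∈ V L)
    (h : K.MorE ⟨I, e⟩ ⟨J, f⟩) (h' : K.MorE ⟨J, f⟩ ⟨L, g⟩) : K.MorE ⟨I, e⟩ ⟨L, g⟩ :=
  h.weak_trans h' (hV.trans hf hg h.pr h'.pr)

/-- `up` makes the map from `I` to `L` factor through `J` on base points; the middle point is `pr f`
by uniqueness, and the weak cocycle lifts this to vectors. -/
theorem TameFamily.upE (hV : K.TameFamily 𝓔 V) (hJL : J ≤ L)
    {e : (K.chart I).E} {f : (K.chart J).E} {g : (K.chart L).E} (he : (K.chart I).pr e ∈ V I)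
    (hg : (K.chart L).pr g ∈ V L)
    (h : K.MorE ⟨I, e⟩ ⟨J, f⟩) (h' : K.MorE ⟨I, e⟩ ⟨L, g⟩) : K.MorE ⟨J, f⟩ ⟨L, g⟩ := by
  obtain ⟨y, -, h1, h2⟩ := hV.up h.le hJL he hg h'.pr
  rw [h1.right_unique h.pr] at h2
  obtain ⟨g', -, h3⟩ := h2.exists_lift
  rwa [h'.right_unique (h.weak_trans h3 h'.pr)]

/-- Two images of an element over a tame family have a common image. -/
theorem TameFamily.joinE (hV : K.TameFamily 𝓔 V) {e : (K.chart I).E} {f : (K.chart J).E}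
    {g : (K.chart L).E} (he : (K.chart I).pr e ∈ V I) (hf : (K.chart J).pr f ∈ V J)
    (hg : (K.chart L).pr g ∈ V L) (h : K.MorE ⟨I, e⟩ ⟨J, f⟩) (h' : K.MorE ⟨I, e⟩ ⟨L, g⟩) :
    K.RelE V ⟨J, f⟩ ⟨L, g⟩ := by
  obtain ⟨hu, w, hw, hm⟩ := hV.join he hf hg h.pr h'.pr
  obtain ⟨k, rfl, hk⟩ := hm.exists_lift
  exact ⟨_, k, hw, hV.upE Finset.subset_union_left he hw h hk,
    hV.upE Finset.subset_union_right he hw h' hk⟩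

/-- The two common images `m` and `n` are both images of `f`, so they have a common image
themselves. -/
theorem RelE.trans (hV : K.TameFamily 𝓔 V) {e : (K.chart I).E} {f : (K.chart J).E}
    {g : (K.chart L).E} (hf : (K.chart J).pr f ∈ V J) (h : K.RelE V ⟨I, e⟩ ⟨J, f⟩)
    (h' : K.RelE V ⟨J, f⟩ ⟨L, g⟩) : K.RelE V ⟨I, e⟩ ⟨L, g⟩ := by
  obtain ⟨M, m, hm, h1, h2⟩ := h
  obtain ⟨N, n, hn, h3, h4⟩ := h'
  obtain ⟨P, p, hp, h5, h6⟩ := hV.joinE hf hm hn h2 h3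
  exact ⟨P, p, hp, hV.transE hm hp h1 h5, hV.transE hn hp h4 h6⟩

/-- Related elements of bundles with disjoint indices are zero vectors over zeros of the sections
with the same footprint. -/
theorem RelE.of_inter_eq_empty (𝓔 : K.Filtration) {e : (K.chart I).E} {f : (K.chart J).E}
    (hIJ : I.1 ∩ J.1 = ∅) (h : K.RelE V ⟨I, e⟩ ⟨J, f⟩) :
    ∃ x, ∃ hx : x ∈ K.zeroSet I, ∃ y, ∃ hy : y ∈ K.zeroSet J, (K.chart I).zero x = e ∧
      (K.chart J).zero y = f ∧ (K.chart I).ψ ⟨x, hx⟩ = (K.chart J).ψ ⟨y, hy⟩ := by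
  obtain ⟨M, g, -, h1, h2⟩ := h
  -- `E_IM ∩ E_JM = E_∅M` is used twice: for `g` itself, which must be a zero vector, and for the
  -- section at its base point, which must vanish.
  have hsub : ∀ k : (K.chart M).E, k ∈ 𝓔.sub I.1 M → k ∈ 𝓔.sub J.1 M → k ∈ 𝓔.sub ∅ M := by
    intro k hk hk'
    rw [← hIJ, ← 𝓔.inter_sub I.1 J.1 M h1.le h2.le]
    exact ⟨hk, hk'⟩
  have hg := hsub g (𝓔.mem_of_morE h1) (𝓔.mem_of_morE h2)
  rw [𝓔.sub_empty] at hg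
  obtain ⟨z, rfl⟩ := hg
  have h1' := h1.pr
  have h2' := h2.pr
  rw [KChart.pr_zero] at h1' h2'
  have hz := 𝓔.sec_mem_empty_iff.1
    (hsub _ (𝓔.sec_mem_of_morB h1') (𝓔.sec_mem_of_morB h2'))
  have hx := h1'.mem_zeroSet_iff.2 hz
  have hy := h2'.mem_zeroSet_iff.2 hz
  exact ⟨_, hx, _, hy, h1'.zero.left_unique h1, h2'.zero.left_unique h2,
    (h1'.ψ_eq hx hz).symm.trans (h2'.ψ_eq hy hz)⟩

/-- Related elements of bundles with intersecting indices come from a common element. -/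
theorem RelE.exists_inter (hV : K.TameFamily 𝓔 V) {H : K.idx} (hH : H.1 = I.1 ∩ J.1)
    {e : (K.chart I).E} {f : (K.chart J).E} (he : (K.chart I).pr e ∈ V I)
    (hf : (K.chart J).pr f ∈ V J) (h : K.RelE V ⟨I, e⟩ ⟨J, f⟩) :
    ∃ g, (K.chart H).pr g ∈ V H ∧ K.MorE ⟨H, g⟩ ⟨I, e⟩ ∧ K.MorE ⟨H, g⟩ ⟨J, f⟩ := by
  obtain ⟨M, g, hg, h1, h2⟩ := h
  have hHI : H ≤ I := by change H.1 ⊆ I.1; rw [hH]; exact Finset.inter_subset_left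
  have hHJ : H ≤ J := by change H.1 ⊆ J.1; rw [hH]; exact Finset.inter_subset_right
  have hsub : ∀ k : (K.chart M).E, k ∈ 𝓔.sub I.1 M → k ∈ 𝓔.sub J.1 M → k ∈ 𝓔.sub H.1 M := by
    intro k hk hk'
    rw [hH, ← 𝓔.inter_sub I.1 J.1 M h1.le h2.le]
    exact ⟨hk, hk'⟩
  have hgH := hsub g (𝓔.mem_of_morE h1) (𝓔.mem_of_morE h2)
  have hsH := hsub _ (𝓔.sec_mem_of_morB h1.pr) (𝓔.sec_mem_of_morB h2.pr)
  -- Both the vector and the section at its base point lie in the `H` part of the filtration, so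
  -- `down` lifts the base point to `U_H` and the filtration lifts the vector. The lifts of `e` and
  -- `f` agree because both are mapped to `g`.
  have aux : ∀ {J : K.idx} {f : (K.chart J).E}, H ≤ J → (K.chart J).pr f ∈ V J →
      K.MorE ⟨J, f⟩ ⟨M, g⟩ → ∃ k, (K.chart H).pr k ∈ V H ∧ K.MorE ⟨H, k⟩ ⟨J, f⟩ ∧
        K.MorE ⟨H, k⟩ ⟨M, g⟩ := by
    intro J f hHJ hf h
    obtain ⟨x, hx, h3, h4⟩ := hV.down hHJ hf hg h.pr ((𝓔.mem_iff_of_morE hHJ h.pr.sec).2 hsH)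
    obtain ⟨k, rfl, hk⟩ := 𝓔.exists_morE ((𝓔.mem_iff_of_morE hHJ h).2 hgH) h3
    exact ⟨k, hx, hk, hk.weak_trans h h4⟩
  obtain ⟨k, hk, h3, h4⟩ := aux hHI he h1
  obtain ⟨k', -, h3', h4'⟩ := aux hHJ hf h2
  obtain rfl := h4.left_unique h4'
  exact ⟨k, hk, h3, h3'⟩

end RelE

namespace Shrinking

variable {𝓔 : K.Filtration} {S S' : K.Shrinking} {I J : K.idx}

/-- The common footprint point lies in the footprint of `I ∪ J`, and the zero of that chart over it
is the common image. -/
theorem relE_of_ψ_eq (S : K.Shrinking) {x : (K.chart I).U} {y : (K.chart J).U}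
    (hx : x ∈ K.zeroSet I) (hy : y ∈ K.zeroSet J) (hxS : x ∈ S.U I) (hyS : y ∈ S.U J)
    (h : (K.chart I).ψ ⟨x, hx⟩ = (K.chart J).ψ ⟨y, hy⟩) :
    K.RelE S.U ⟨I, (K.chart I).zero x⟩ ⟨J, (K.chart J).zero y⟩ := by
  have h1 := (S.mem_U_iff I ⟨x, hx⟩).1 hxS
  have h2 := (S.mem_U_iff J ⟨y, hy⟩).1 hyS
  rw [← h] at h2
  have h3 : (K.chart I).ψ ⟨x, hx⟩ ∈ ⋂ i ∈ I.1 ∪ J.1, S.F i := by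
    refine mem_iInter₂.2 fun i hi => ?_
    rcases Finset.mem_union.1 hi with hi | hi
    · exact mem_iInter₂.1 h1 i hi
    · exact mem_iInter₂.1 h2 i hi
  have h4 := S.inter_F_subset _ h3
  have hu : I.1 ∪ J.1 ∈ K.idx :=
    (K.mem_idx _).2 ⟨((K.mem_idx _).1 I.2).1.mono Finset.subset_union_left, _, h4⟩
  obtain ⟨z, hz, hψ⟩ := exists_zero_of_mem_foot (I := ⟨_, hu⟩) (by rw [foot_chart]; exact h4)
  refine ⟨⟨_, hu⟩, (K.chart _).zero z, ?_, (morB_of_ψ_eq Finset.subset_union_left hx hz hψ.symm).zero,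
    (morB_of_ψ_eq Finset.subset_union_right hy hz (h.symm.trans hψ.symm)).zero⟩
  rw [KChart.pr_zero]
  exact (S.mem_U_iff _ ⟨z, hz⟩).2 (hψ ▸ h3)

/-- Passing from `S'` to `S` loses no identifications. A common image over `S'` need not lie over
`S`, but the common origin over `I ∩ J` does, by tameness of `S`; from there one joins upwards
within `S`. If `I ∩ J = ∅`, footprints replace this argument. -/
theorem relE_of_relE (hS : K.TameFamily 𝓔 S.U) (hS' : K.TameFamily 𝓔 S'.U)
    (hSS' : ∀ I, S.U I ⊆ S'.U I) {e : (K.chart I).E} {f : (K.chart J).E}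
    (he : (K.chart I).pr e ∈ S.U I) (hf : (K.chart J).pr f ∈ S.U J)
    (h : K.RelE S'.U ⟨I, e⟩ ⟨J, f⟩) : K.RelE S.U ⟨I, e⟩ ⟨J, f⟩ := by
  by_cases hIJ : (I.1 ∩ J.1).Nonempty
  · obtain ⟨H, hH⟩ : ∃ H : K.idx, H.1 = I.1 ∩ J.1 :=
      ⟨⟨_, mem_idx_of_subset hIJ Finset.inter_subset_left⟩, rfl⟩
    obtain ⟨g, hg, h1, h2⟩ := h.exists_inter hS' hH (hSS' I he) (hSS' J hf)
    obtain ⟨x, hx, h3⟩ := hS.exists_of_sec_mem h1.le he (𝓔.sec_mem_of_morB h1.pr)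
    rw [← h1.pr.left_unique h3] at hx
    exact hS.joinE hx he hf h1 h2
  · rw [Finset.not_nonempty_iff_eq_empty] at hIJ
    obtain ⟨x, hx, y, hy, rfl, rfl, hψ⟩ := h.of_inter_eq_empty 𝓔 hIJ
    rw [KChart.pr_zero] at he hf
    exact relE_of_ψ_eq S hx hy he hf hψ

/-- Equality in the realization of the obstruction bundle of a tame shrinking. -/
theorem πE_eq_iff (hS : K.TameFamily 𝓔 S.U) (e : ↥((K.chart I).pr ⁻¹' S.U I))
    (f : ↥((K.chart J).pr ⁻¹' S.U J)) :
    S.atlas.πE I e = S.atlas.πE J f ↔ K.RelE S.U ⟨I, e.1⟩ ⟨J, f.1⟩ := by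
  constructor
  · intro h
    have key : ∀ p q : S.atlas.ObjE, Relation.EqvGen S.atlas.MorE p q →
        K.RelE S.U ⟨p.1, p.2.1⟩ ⟨q.1, q.2.1⟩ := by
      intro p q h
      induction h with
      | rel p q h => exact relE_of_morE q.2.2 ((S.morE_atlas_iff p.2 q.2).1 h)
      | refl p => exact relE_of_morE p.2.2 (MorE.refl _)
      | symm p q _ ih => exact ih.symm
      | trans p q r _ _ ih ih' => exact RelE.trans hS q.2.2 ih ih'
    exact key _ _ (Quot.eqvGen_exact h)
  · rintro ⟨M, g, hg, h1, h2⟩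
    have h1' := (S.morE_atlas_iff (I := I) (J := M) e ⟨g, hg⟩).2 h1
    have h2' := (S.morE_atlas_iff (I := J) (J := M) f ⟨g, hg⟩).2 h2
    exact (Quot.sound h1').trans (Quot.sound h2').symm

/-- The saturation of a closed set of vectors over compact sets is closed. -/
theorem isClosed_saturation [T2Space X] (hS : K.TameFamily 𝓔 S.U)
    {C : ∀ I : K.idx, Set (K.chart I).U} (hC : ∀ I, IsCompact (C I)) (hCS : ∀ I, C I ⊆ S.U I)
    {A : Set (K.chart I).E} (hA : IsClosed A) (hAC : A ⊆ (K.chart I).pr ⁻¹' C I) :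
    IsClosed {f | (K.chart J).pr f ∈ C J ∧ ∃ e ∈ A, K.RelE S.U ⟨I, e⟩ ⟨J, f⟩} := by
  by_cases hIJ : (I.1 ∩ J.1).Nonempty
  · obtain ⟨H, hH⟩ : ∃ H : K.idx, H.1 = I.1 ∩ J.1 :=
      ⟨⟨_, mem_idx_of_subset hIJ Finset.inter_subset_left⟩, rfl⟩
    have hHI : H ≤ I := by change H.1 ⊆ I.1; rw [hH]; exact Finset.inter_subset_left
    have hHJ : H ≤ J := by change H.1 ⊆ J.1; rw [hH]; exact Finset.inter_subset_right
    -- the preimage of the compact set `C I` in `U_H`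
    obtain ⟨D, hD, hDiff⟩ : ∃ D : Set (K.chart H).U, IsClosed D ∧
        ∀ x, x ∈ D ↔ ∃ y ∈ C I, K.MorB ⟨H, x⟩ ⟨I, y⟩ := by
      -- By tameness this compact set lies in the image of the embedding `φ_HI`, so its preimage is
      -- compact, hence closed in all of `U_H` and not merely in the domain.
      have hcpt : IsCompact (C I ∩ (K.chart I).sec ⁻¹' 𝓔.sub H.1 I) :=
        (hC I).inter_right ((𝓔.isClosed_sub H.1 I hHI).preimage (K.chart I).continuous_sec)
      have hsub : C I ∩ (K.chart I).sec ⁻¹' 𝓔.sub H.1 I ⊆ range (K.coord hHI).φ := by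
        rintro y ⟨hy, hs⟩
        obtain ⟨x, -, hm⟩ := hS.exists_of_sec_mem hHI (hCS I hy) hs
        obtain ⟨_, h2, h3⟩ := morB_iff.1 hm
        exact ⟨_, h3⟩
      refine ⟨_, ((((K.coord hHI).isEmbedding_φ.isInducing.isCompact_preimage_iff hsub).2
        hcpt).image continuous_subtype_val).isClosed, fun x => ⟨?_, ?_⟩⟩
      · rintro ⟨x, hx, rfl⟩
        exact ⟨_, hx.1, morB_φ hHI x.2⟩
      · rintro ⟨y, hy, hm⟩
        have hs := 𝓔.sec_mem_of_morB hm
        obtain ⟨_, h2, rfl⟩ := morB_iff.1 hm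
        exact ⟨⟨x, h2⟩, ⟨hy, hs⟩, rfl⟩
    have hDS : D ⊆ S.U H := by
      intro x hx
      obtain ⟨y, hy, hm⟩ := (hDiff x).1 hx
      obtain ⟨x', hx', hm'⟩ := hS.exists_of_sec_mem hHI (hCS I hy) (𝓔.sec_mem_of_morB hm)
      rwa [hm.left_unique hm']
    obtain ⟨T, hT, hTA⟩ := isClosed_induced_iff.1 (hA.preimage (K.coord hHI).isEmbedding_Φ.continuous)
    have hTiff : ∀ g, (K.chart H).pr g ∈ D → (g ∈ T ↔ ∃ e ∈ A, K.MorE ⟨H, g⟩ ⟨I, e⟩) := by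
      intro g hg
      obtain ⟨y, -, hm⟩ := (hDiff _).1 hg
      obtain ⟨h1, h2, _⟩ := morB_iff.1 hm
      refine (Set.ext_iff.1 hTA ⟨g, h2⟩).trans ⟨fun h => ⟨_, h, hHI, h2, rfl⟩, ?_⟩
      rintro ⟨e, he, hm'⟩
      obtain ⟨_, _, rfl⟩ := morE_iff.1 hm'
      exact he
    have hG : IsClosed (T ∩ (K.chart H).pr ⁻¹' D) :=
      hT.inter (hD.preimage (K.chart H).continuous_pr)
    -- The image under `Φ_HJ` is the trace of a closed set `T'` on the image of `Φ_HJ`. Over `C J`,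
    -- vectors in `E_HJ` whose base section is in `E_HJ` all lie in that image, so these closed
    -- conditions cut out the saturation.
    obtain ⟨T', hT', hTG⟩ := (K.coord hHJ).isEmbedding_Φ.isInducing.isClosed_iff.1
      (hG.preimage continuous_subtype_val)
    have hsat : IsClosed (T' ∩ ((K.chart J).pr ⁻¹' (C J ∩ (K.chart J).sec ⁻¹' 𝓔.sub H.1 J) ∩
        𝓔.sub H.1 J)) :=
      hT'.inter ((((hC J).isClosed.inter ((𝓔.isClosed_sub H.1 J hHJ).preimage
        (K.chart J).continuous_sec)).preimage (K.chart J).continuous_pr).inter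
        (𝓔.isClosed_sub H.1 J hHJ))
    convert hsat using 1
    ext f
    constructor
    · rintro ⟨hf, e, he, h⟩
      obtain ⟨g, hg, h1, h2⟩ := h.exists_inter hS hH (hCS I (hAC he)) (hCS J hf)
      have hgD := (hDiff _).2 ⟨_, hAC he, h1.pr⟩
      refine ⟨?_, ⟨hf, 𝓔.sec_mem_of_morB h2.pr⟩, 𝓔.mem_of_morE h2⟩
      obtain ⟨_, h3, rfl⟩ := morE_iff.1 h2
      exact (Set.ext_iff.1 hTG ⟨g, h3⟩).2 ⟨(hTiff g hgD).2 ⟨e, he, h1⟩, hgD⟩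
    · rintro ⟨hfT, ⟨hf, hs⟩, hfs⟩
      obtain ⟨x, hx, hm⟩ := hS.exists_of_sec_mem hHJ (hCS J hf) hs
      obtain ⟨g, rfl, h2⟩ := 𝓔.exists_morE hfs hm
      obtain ⟨_, h3, rfl⟩ := morE_iff.1 h2
      obtain ⟨hgT, hgD⟩ := (Set.ext_iff.1 hTG ⟨g, h3⟩).1 hfT
      obtain ⟨e, he, h1⟩ := (hTiff g hgD).1 hgT
      exact ⟨hf, e, he, hS.joinE (hDS hgD) (hCS I (hAC he)) (hCS J hf) h1 h2⟩
  -- With disjoint indices only zero vectors over zeros are identified, by their footprints. The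
  -- relevant footprints form a compact, hence closed, subset of `X`.
  · rw [Finset.not_nonempty_iff_eq_empty] at hIJ
    have hP : IsCompact ((Subtype.val : {x // (K.chart I).sec x = (K.chart I).zero x} → _) ⁻¹'
        (C I ∩ (K.chart I).zero ⁻¹' A)) :=
      ((isClosed_zeroSet I).isClosedEmbedding_subtypeVal).isCompact_preimage
        ((hC I).inter_right (hA.preimage (K.chart I).continuous_zero))
    have hQ := (isClosed_zeroSet J).isClosedMap_subtype_val _
      ((hP.image (K.chart I).isOpenEmbedding_ψ.continuous).isClosed.preimage
        (K.chart J).isOpenEmbedding_ψ.continuous)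
    have hsat := (isClosed_eq ((K.chart J).continuous_zero.comp (K.chart J).continuous_pr)
      continuous_id).inter (((hC J).isClosed.inter hQ).preimage (K.chart J).continuous_pr)
    convert hsat using 1
    ext f
    constructor
    · rintro ⟨hf, e, he, h⟩
      obtain ⟨x, hx, y, hy, rfl, rfl, hψ⟩ := h.of_inter_eq_empty 𝓔 hIJ
      have hxC := hAC he
      rw [mem_preimage, KChart.pr_zero] at hxC
      refine ⟨?_, hf, ?_⟩
      · simp [KChart.pr_zero]
      · rw [KChart.pr_zero]
        exact ⟨⟨y, hy⟩, ⟨⟨x, hx⟩, ⟨hxC, he⟩, hψ⟩, rfl⟩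
    · rintro ⟨hf0, hf, ⟨y, hy⟩, ⟨⟨x, hx⟩, ⟨hxC, hxA⟩, hψ⟩, hyf⟩
      refine ⟨hf, _, hxA, ?_⟩
      rw [← show (K.chart J).zero ((K.chart J).pr f) = f from hf0, ← hyf]
      rw [← hyf] at hf
      exact relE_of_ψ_eq S hx hy (hCS I hxC) (hCS J hf) hψ

end Shrinking

end WeakAtlas

end Kuranishi

/-! ### Hausdorff property and metrizability of the realizations. -/

namespace Kuranishi

theorem metrizableSpace_sigma {ι : Type*} {Y : ι → Type*} [∀ i, TopologicalSpace (Y i)]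
    [∀ i, MetrizableSpace (Y i)] : MetrizableSpace (Σ i, Y i) := by
  let _ := fun i => metrizableSpaceMetric (Y i)
  let _ : MetricSpace (Σ i, Y i) := Metric.Sigma.metricSpace
  infer_instance

namespace WeakAtlas

variable {X : Type u} [TopologicalSpace X] {K : WeakAtlas.{u, v} X}

theorem continuous_prReal (K : WeakAtlas.{u, v} X) : Continuous K.prReal := by
  refine continuous_quot_lift _ (continuous_quot_mk.comp ?_)
  exact continuous_sigma fun I => continuous_sigmaMk.comp (K.chart I).continuous_pr

/-- The map of realizations induced by the zero sections. -/
def zeroReal (K : WeakAtlas.{u, v} X) : K.RealB → K.RealE :=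
  Quot.map (fun p => ⟨p.1, (K.chart p.1).zero p.2⟩) (by
    rintro ⟨I, x⟩ ⟨J, y⟩ h
    exact MorB.zero h)

theorem continuous_zeroReal (K : WeakAtlas.{u, v} X) : Continuous K.zeroReal := by
  refine continuous_quot_lift _ (continuous_quot_mk.comp ?_)
  exact continuous_sigma fun I => continuous_sigmaMk.comp (K.chart I).continuous_zero

theorem zeroReal_injective (K : WeakAtlas.{u, v} X) : Function.Injective K.zeroReal := by
  refine Function.LeftInverse.injective (g := K.prReal) ?_
  rintro ⟨I, x⟩
  change K.πB I ((K.chart I).pr ((K.chart I).zero x)) = K.πB I x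
  rw [KChart.pr_zero]

theorem isEmbedding_zero (K : KChart.{u, v} X) : IsEmbedding K.zero :=
  Function.LeftInverse.isEmbedding (f := K.pr) K.pr_zero K.continuous_pr K.continuous_zero

/-- The Hausdorff and homeomorphism properties follow from those of the obstruction bundle. -/
theorem hausdorffHomeo_of_realE (hT : T2Space K.RealE) (hE : ∀ I, IsEmbedding (K.πE I)) :
    K.HausdorffHomeo := by
  refine ⟨T2Space.of_injective_continuous K.zeroReal_injective K.continuous_zeroReal, hT,
    fun I => ?_, hE, K.continuous_prReal, fun _ _ => rfl⟩
  -- Followed by the zero section, `πB` becomes `πE` composed with the embedding `0_I`.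
  refine IsEmbedding.of_comp (continuous_quot_mk.comp continuous_sigmaMk) K.continuous_zeroReal ?_
  exact (hE I).comp (isEmbedding_zero (K.chart I))

namespace Shrinking

variable {𝓔 : K.Filtration} {S S' : K.Shrinking} {I J : K.idx}

/-- The realization of the obstruction bundle of a preshrunk tame shrinking injects continuously
into a Hausdorff space, in which the charts are embedded and in which the zero section has compact
metrizable closure. -/
theorem exists_compactification [CompactSpace X] [MetrizableSpace X]
    (hS : K.TameFamily 𝓔 S.U) (hS' : K.TameFamily 𝓔 S'.U) (hSS' : ∀ I, closure (S.U I) ⊆ S'.U I) :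
    ∃ (Q : Type v) (_ : TopologicalSpace Q) (j : S.atlas.RealE → Q) (R : Set Q), T2Space Q ∧
      Continuous j ∧ Function.Injective j ∧ (∀ I, IsEmbedding (j ∘ S.atlas.πE I)) ∧
      CompactSpace R ∧ MetrizableSpace R ∧ ∀ p, j (S.atlas.zeroReal p) ∈ R := by
  have hsub : ∀ I, S.U I ⊆ S'.U I := fun I => subset_closure.trans (hSS' I)
  -- The closures of the `S.U I` lie in the tame domains of `S'`, not in those of `S`; hence the
  -- relation is taken over `S'`.
  let Y : Type v := Σ I : K.idx, ↥((K.chart I).pr ⁻¹' closure (S.U I))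
  let r : Setoid Y :=
    { r := fun p q => K.RelE S'.U ⟨p.1, p.2.1⟩ ⟨q.1, q.2.1⟩
      iseqv := ⟨fun p => relE_of_morE (hSS' _ p.2.2) (MorE.refl _), fun h => h.symm,
        fun {p q s} h h' => RelE.trans hS' (hSS' _ q.2.2) h h'⟩ }
  have hYc : ∀ I : K.idx, IsClosed ((K.chart I).pr ⁻¹' closure (S.U I)) := fun I =>
    isClosed_closure.preimage (K.chart I).continuous_pr
  let q : Y → Quotient r := Quotient.mk r
  have hq : Continuous q := continuous_quotient_mk'
  have hqs : Function.Surjective q := Quotient.mk_surjective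
  -- The preimage of `q '' A` in each chart is a finite union of saturations of closed sets.
  have hqcl : IsClosedMap q := by
    intro A hA
    refine (isQuotientMap_quotient_mk' (s := r)).isClosed_preimage.1 (isClosed_sigma_iff.2 fun J => ?_)
    have h1 : IsClosed (⋃ I : K.idx, {f | (K.chart J).pr f ∈ closure (S.U J) ∧
        ∃ e ∈ Subtype.val '' ((Sigma.mk I : _ → Y) ⁻¹' A), K.RelE S'.U ⟨I, e⟩ ⟨J, f⟩}) := by
      refine isClosed_iUnion_of_finite fun I => isClosed_saturation hS'
        (fun I => S.isCompact_closure_U I) hSS' ?_ ?_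
      · exact (hYc I).isClosedMap_subtype_val _ (hA.preimage continuous_sigmaMk)
      · rintro _ ⟨e, -, rfl⟩
        exact e.2
    convert h1.preimage (continuous_subtype_val (p := (· ∈ (K.chart J).pr ⁻¹' closure (S.U J))))
      using 1
    ext f
    constructor
    · rintro ⟨⟨I, e⟩, he, h⟩
      exact mem_iUnion.2 ⟨I, f.2, e.1, ⟨e, he, rfl⟩, Quotient.exact h⟩
    · intro h
      obtain ⟨I, -, _, ⟨e, he, rfl⟩, h⟩ := mem_iUnion.1 h
      exact ⟨⟨I, e⟩, he, Quotient.sound h⟩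
  have hYm : MetrizableSpace Y := metrizableSpace_sigma
  have hT2 : T2Space (Quotient r) := t2Space_of_isClosedMap hq hqcl hqs
  let i : S.atlas.ObjE → Y := fun p => ⟨p.1, p.2.1, subset_closure p.2.2⟩
  have hiI : ∀ I, Topology.IsEmbedding (fun e : ↥((K.chart I).pr ⁻¹' S.U I) =>
      (⟨e.1, subset_closure e.2⟩ : ↥((K.chart I).pr ⁻¹' closure (S.U I)))) := fun I =>
    IsEmbedding.inclusion (preimage_mono subset_closure)
  have hi : Continuous i := by
    refine continuous_sigma fun I => ?_
    exact (continuous_sigmaMk (σ := fun I : K.idx => ↥((K.chart I).pr ⁻¹' closure (S.U I)))).comp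
      (hiI I).continuous
  let j : S.atlas.RealE → Quotient r := Quot.lift (q ∘ i) (by
    rintro ⟨I, e⟩ ⟨J, f⟩ h
    exact Quotient.sound (relE_of_morE (hsub _ f.2) ((S.morE_atlas_iff (I := I) (J := J) e f).1 h)))
  have hj : Continuous j := continuous_quot_lift _ (hq.comp hi)
  have hjinj : Function.Injective j := by
    rintro ⟨I, e⟩ ⟨J, f⟩ h
    exact (πE_eq_iff (K := K) (I := I) (J := J) hS e f).2 (relE_of_relE hS hS' hsub e.2 f.2 (Quotient.exact h))
  have hqI : ∀ I, IsClosedEmbedding (fun e => q ⟨I, e⟩) := fun I => by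
    refine IsClosedEmbedding.of_continuous_injective_isClosedMap (hq.comp continuous_sigmaMk) ?_
      (hqcl.comp isClosedMap_sigmaMk)
    intro e f h
    exact Subtype.ext (RelE.eq (Quotient.exact h))
  -- the compact space of all zero vectors
  let Z : Type v := Σ I : K.idx, ↥(closure (S.U I))
  have : ∀ I : K.idx, CompactSpace ↥(closure (S.U I)) := fun I =>
    isCompact_iff_compactSpace.1 (S.isCompact_closure_U I)
  have hZm : MetrizableSpace Z := metrizableSpace_sigma
  let z : Z → Y := fun p => ⟨p.1, (K.chart p.1).zero p.2.1, (K.chart p.1).zero_mem p.2.2⟩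
  have hz : Continuous z := by
    refine continuous_sigma fun I => ?_
    exact (continuous_sigmaMk (σ := fun I : K.idx => ↥((K.chart I).pr ⁻¹' closure (S.U I)))).comp
      (Continuous.subtype_mk ((K.chart I).continuous_zero.comp continuous_subtype_val)
        fun x : ↥(closure (S.U I)) => (K.chart I).zero_mem x.2)
  have hqz := hq.comp hz
  refine ⟨Quotient r, inferInstance, j, range (q ∘ z), hT2, hj, hjinj, fun I => ?_,
    isCompact_iff_compactSpace.1 (isCompact_range hqz), ?_, ?_⟩
  · exact (hqI I).isEmbedding.comp (hiI I)
  · exact metrizableSpace_of_surjective (hqz.subtype_mk (fun x => mem_range_self x))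
      rangeFactorization_surjective
  · rintro ⟨I, x⟩
    exact ⟨⟨I, x.1, subset_closure x.2⟩, rfl⟩

/-- The realizations of a preshrunk tame shrinking are Hausdorff, contain the charts, and are
metrizable. -/
theorem IsPreshrunkTame.hausdorffHomeo_and_metric [CompactSpace X] [MetrizableSpace X]
    (h : S.IsPreshrunkTame 𝓔) :
    S.atlas.HausdorffHomeo ∧ ∃ d, S.atlas.IsAdmissibleMetric d := by
  obtain ⟨hS, S', hS', hSS'⟩ := h
  rw [isTame_iff] at hS hS'
  obtain ⟨Q, _, j, R, hQ, hj, hjinj, hjE, hRc, hRm, hR⟩ :=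
    exists_compactification hS hS' ((isShrinkingOf_iff S S').1 hSS').2
  refine ⟨hausdorffHomeo_of_realE (T2Space.of_injective_continuous hjinj hj) fun I =>
    IsEmbedding.of_comp (continuous_quot_mk.comp continuous_sigmaMk) hj (hjE I), ?_⟩
  let _ := metrizableSpaceMetric R
  -- The bundles themselves are not compact, but the zero vectors over the closures are, and `|S|`
  -- injects into their image `R`; the metric is pulled back from there and is bounded because `R`
  -- is compact.
  let k : S.atlas.RealB → R := fun p => ⟨j (S.atlas.zeroReal p), hR p⟩
  have hk : Function.Injective k := fun p p' hpp =>
    S.atlas.zeroReal_injective (hjinj (congrArg Subtype.val hpp))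
  have hkI : ∀ I, IsEmbedding (k ∘ S.atlas.πB I) := fun I => by
    have h1 := (hjE I).comp (isEmbedding_zero (S.atlas.chart I))
    exact IsEmbedding.of_comp (h1.continuous.subtype_mk fun x => hR (S.atlas.πB I x))
      continuous_subtype_val h1
  refine ⟨fun p p' => dist (k p) (k p'), fun p p' => ?_, fun p p' => dist_comm _ _,
    fun p p' p'' => dist_triangle _ _ _, ?_, fun I V => ?_⟩
  · rw [dist_eq_zero, hk.eq_iff]
  · obtain ⟨C, hC⟩ := Metric.isBounded_iff.1 (isCompact_univ (X := R)).isBounded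
    exact ⟨C, fun p p' => hC (mem_univ _) (mem_univ _)⟩
  · rw [isOpen_iff_mem_nhds]
    refine forall₂_congr fun x _ => ?_
    rw [(hkI I).isInducing.nhds_eq_comap, (Metric.nhds_basis_ball.comap _).mem_iff]
    refine exists_congr fun δ => and_congr_right fun _ => forall_congr' fun y => ?_
    rw [mem_preimage, Metric.mem_ball']
    rfl

end Shrinking

end WeakAtlas

end Kuranishi

/-! ### Products with the unit interval. -/

namespace Kuranishi

section Topology

variable {T A Z : Type*} [TopologicalSpace T] [TopologicalSpace A] [TopologicalSpace Z]
  {P' : T × A → Prop} {P : A → Prop}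

/-- A subspace of a product which is defined by a condition on the second factor is a product. -/
def subtypeProdHomeomorph (h : ∀ p, P' p ↔ P p.2) : {p : T × A // P' p} ≃ₜ T × {a : A // P a} where
  toFun p := (p.1.1, ⟨p.1.2, (h _).1 p.2⟩)
  invFun q := ⟨(q.1, q.2.1), (h _).2 q.2.2⟩
  left_inv _ := rfl
  right_inv _ := rfl
  continuous_toFun := by fun_prop
  continuous_invFun := by fun_prop

theorem isEmbedding_subtypeProd (h : ∀ p, P' p ↔ P p.2) {f : {a // P a} → Z} (hf : IsEmbedding f) :
    IsEmbedding (fun p : {p : T × A // P' p} => (p.1.1, f ⟨p.1.2, (h _).1 p.2⟩)) :=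
  (IsEmbedding.id.prodMap hf).comp (subtypeProdHomeomorph h).isEmbedding

theorem isOpenEmbedding_subtypeProd (h : ∀ p, P' p ↔ P p.2) {f : {a // P a} → Z}
    (hf : IsOpenEmbedding f) :
    IsOpenEmbedding (fun p : {p : T × A // P' p} => (p.1.1, f ⟨p.1.2, (h _).1 p.2⟩)) :=
  (IsOpenEmbedding.id.prodMap hf).comp (subtypeProdHomeomorph h).isOpenEmbedding

end Topology

variable {X : Type u} [TopologicalSpace X]

/-- The product of a chart with the unit interval. -/
abbrev KChart.prod (K : KChart.{u, v} X) : KChart.{u, v} (unitInterval × X) where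
  U := unitInterval × K.U
  E := unitInterval × K.E
  pr e := (e.1, K.pr e.2)
  zero x := (x.1, K.zero x.2)
  sec x := (x.1, K.sec x.2)
  continuous_pr := continuous_fst.prodMk (K.continuous_pr.comp continuous_snd)
  continuous_zero := continuous_fst.prodMk (K.continuous_zero.comp continuous_snd)
  continuous_sec := continuous_fst.prodMk (K.continuous_sec.comp continuous_snd)
  pr_zero x := Prod.ext rfl (K.pr_zero x.2)
  pr_sec x := Prod.ext rfl (K.pr_sec x.2)
  ψ x := (x.1.1, K.ψ ⟨x.1.2, congrArg Prod.snd x.2⟩)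
  isOpenEmbedding_ψ := isOpenEmbedding_subtypeProd
    (P' := fun x : unitInterval × K.U => (x.1, K.sec x.2) = (x.1, K.zero x.2))
    (P := fun x => K.sec x = K.zero x) (fun _ => ⟨congrArg Prod.snd, fun h => Prod.ext rfl h⟩)
    K.isOpenEmbedding_ψ

theorem KChart.foot_prod (K : KChart.{u, v} X) : K.prod.foot = Prod.snd ⁻¹' K.foot := by
  ext ⟨t, p⟩
  constructor
  · rintro ⟨x, hx⟩
    exact ⟨_, congrArg Prod.snd hx⟩
  · rintro ⟨x, rfl⟩
    exact ⟨⟨(t, x.1), Prod.ext rfl x.2⟩, rfl⟩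

/-- The product of a coordinate change with the identity of the unit interval. -/
def CoordChange.prod {K L : KChart.{u, v} X} (c : CoordChange K L) :
    CoordChange K.prod L.prod where
  dom := Prod.snd ⁻¹' c.dom
  isOpen_dom := c.isOpen_dom.preimage continuous_snd
  mem_dom_iff x := by
    rw [KChart.foot_prod, KChart.foot_prod]
    exact c.mem_dom_iff ⟨x.1.2, congrArg Prod.snd x.2⟩
  φ x := (x.1.1, c.φ ⟨x.1.2, x.2⟩)
  isEmbedding_φ := isEmbedding_subtypeProd
    (P' := fun x : unitInterval × K.U => x.2 ∈ c.dom) (P := fun x => x ∈ c.dom) (fun _ => Iff.rfl)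
    c.isEmbedding_φ
  Φ e := (e.1.1, c.Φ ⟨e.1.2, e.2⟩)
  isEmbedding_Φ := isEmbedding_subtypeProd
    (P' := fun e : unitInterval × K.E => e.2 ∈ K.pr ⁻¹' c.dom) (P := fun e => e ∈ K.pr ⁻¹' c.dom) (fun _ => Iff.rfl)
    c.isEmbedding_Φ
  pr_Φ e := Prod.ext rfl (c.pr_Φ ⟨e.1.2, e.2⟩)
  zero_φ x := Prod.ext rfl (c.zero_φ ⟨x.1.2, x.2⟩)
  sec_φ x := Prod.ext rfl (c.sec_φ ⟨x.1.2, x.2⟩)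
  ψ_φ x hx hy := Prod.ext rfl
    (c.ψ_φ ⟨x.1.2, x.2⟩ (congrArg Prod.snd hx) (congrArg Prod.snd hy))

namespace WeakAtlas

/-- The product of a weak atlas with the unit interval. -/
def prod (K : WeakAtlas.{u, v} X) : WeakAtlas.{u, v} (unitInterval × X) where
  N := K.N
  F i := Prod.snd ⁻¹' K.F i
  isOpen_F i := (K.isOpen_F i).preimage continuous_snd
  cover_F := by rw [← preimage_iUnion, K.cover_F, preimage_univ]
  idx := K.idx
  mem_idx I := by
    rw [K.mem_idx, ← preimage_iInter₂]
    exact and_congr_right fun _ =>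
      ⟨fun ⟨p, hp⟩ => ⟨(0, p), hp⟩, fun ⟨q, hq⟩ => ⟨q.2, hq⟩⟩
  chart I := (K.chart I).prod
  foot_chart I := by rw [KChart.foot_prod, K.foot_chart, preimage_iInter₂]
  coord h := (K.coord h).prod
  dom_refl I := by
    change Prod.snd ⁻¹' (K.coord (le_refl I)).dom = univ
    rw [K.dom_refl, preimage_univ]
  φ_refl I x := Prod.ext rfl (K.φ_refl I _)
  Φ_refl I e := Prod.ext rfl (K.Φ_refl I _)
  weak_cocycle hIJ hJL e h₁ h₂ h₃ := Prod.ext rfl (K.weak_cocycle hIJ hJL e.2 h₁ h₂ h₃)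

variable {K : WeakAtlas.{u, v} X}

theorem morB_prod_iff {I J : K.idx} (p : unitInterval × (K.chart I).U)
    (q : unitInterval × (K.chart J).U) :
    K.prod.MorB ⟨I, p⟩ ⟨J, q⟩ ↔ p.1 = q.1 ∧ K.MorB ⟨I, p.2⟩ ⟨J, q.2⟩ := by
  constructor
  · rintro ⟨h1, h2, h3⟩
    exact ⟨congrArg Prod.fst h3, h1, h2, congrArg Prod.snd h3⟩
  · rintro ⟨h, h1, h2, h3⟩
    exact ⟨h1, h2, Prod.ext h h3⟩

/-- The product of a filtration with the unit interval. -/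
def Filtration.prod (𝓔 : K.Filtration) : K.prod.Filtration where
  sub I J := Prod.snd ⁻¹' 𝓔.sub I J
  isClosed_sub I J h := (𝓔.isClosed_sub I J h).preimage continuous_snd
  sub_self J := by
    rw [show 𝓔.sub _ J = univ from 𝓔.sub_self J]
    rfl
  sub_empty J := by
    ext ⟨t, e⟩
    refine (Set.ext_iff.1 (𝓔.sub_empty J) e).trans ⟨?_, ?_⟩
    · rintro ⟨x, rfl⟩
      exact ⟨(t, x), rfl⟩
    · rintro ⟨x, hx⟩
      exact ⟨x.2, congrArg Prod.snd hx⟩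
  image_sub I J L hJL hI := by
    ext ⟨t, f⟩
    have key := Set.ext_iff.1 (𝓔.image_sub I J L hJL hI) f
    constructor
    · rintro ⟨e, he, h⟩
      obtain ⟨h1, x, hx⟩ := key.1 ⟨⟨e.1.2, e.2⟩, he, congrArg Prod.snd h⟩
      exact ⟨h1, ⟨(t, x.1), x.2⟩, Prod.ext rfl hx⟩
    · rintro ⟨hf, x, hx⟩
      obtain ⟨e, he, h⟩ := key.2 ⟨hf, ⟨x.1.2, x.2⟩, congrArg Prod.snd hx⟩
      exact ⟨⟨(t, e.1), e.2⟩, he, Prod.ext rfl h⟩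
  inter_sub I H J hI hH := congrArg (Prod.snd ⁻¹' ·) (𝓔.inter_sub I H J hI hH)
  isOpen_range I J hIJ := by
    obtain ⟨O, hO, hr⟩ := 𝓔.isOpen_range I J hIJ
    refine ⟨Prod.snd ⁻¹' O, hO.preimage continuous_snd, ?_⟩
    ext ⟨t, y⟩
    refine Iff.trans ⟨?_, ?_⟩ (Set.ext_iff.1 hr y)
    · rintro ⟨x, hx⟩
      exact ⟨⟨x.1.2, x.2⟩, congrArg Prod.snd hx⟩
    · rintro ⟨x, hx⟩
      exact ⟨⟨(t, x.1), x.2⟩, Prod.ext rfl hx⟩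

/-- Tameness of a family of subsets of the product with the unit interval is a fibrewise
condition. -/
theorem tameFamily_prod {𝓔 : K.Filtration} {W : ∀ I : K.idx, Set (unitInterval × (K.chart I).U)}
    (h : ∀ t, K.TameFamily 𝓔 (fun I => {x | (t, x) ∈ W I})) : K.prod.TameFamily 𝓔.prod W := by
  refine ⟨?_, ?_, ?_⟩
  · rintro I J L ⟨t, x⟩ ⟨t', z⟩ hIJ hJL hx hz hm
    obtain ⟨rfl, hm⟩ := (morB_prod_iff (t, x) (t', z)).1 hm
    obtain ⟨y, hy, h1, h2⟩ := (h t).up hIJ hJL hx hz hm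
    exact ⟨(t, y), hy, (morB_prod_iff _ _).2 ⟨rfl, h1⟩, (morB_prod_iff _ _).2 ⟨rfl, h2⟩⟩
  · rintro I J L ⟨t, y⟩ ⟨t', z⟩ hIJ hy hz hm hs
    obtain ⟨rfl, hm⟩ := (morB_prod_iff (t, y) (t', z)).1 hm
    obtain ⟨x, hx, h1, h2⟩ := (h t).down hIJ hy hz hm hs
    exact ⟨(t, x), hx, (morB_prod_iff _ _).2 ⟨rfl, h1⟩, (morB_prod_iff _ _).2 ⟨rfl, h2⟩⟩
  · rintro I J L ⟨t, x⟩ ⟨t', y⟩ ⟨t'', z⟩ hx hy hz hm hm'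
    obtain ⟨rfl, hm⟩ := (morB_prod_iff (t, x) (t', y)).1 hm
    obtain ⟨rfl, hm'⟩ := (morB_prod_iff (t, x) (t'', z)).1 hm'
    obtain ⟨hu, w, hw, h1⟩ := (h t).join hx hy hz hm hm'
    exact ⟨hu, (t, w), hw, (morB_prod_iff _ _).2 ⟨rfl, h1⟩⟩

end WeakAtlas

end Kuranishi

/-! ### Interpolation between shrinkings along the interval. -/

namespace Kuranishi

section Interpolation

/-- The condition which is `p α` on the collar of width `a` of `α`, is `q` at distance less
than `m` from `1/2`, and is `p α ∧ q` in between. -/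
def Interp (a m : ℝ) (p : Fin 2 → Prop) (q : Prop) (t : unitInterval) : Prop :=
  (∃ α, t ∈ collar α a ∧ p α) ∨ (|(t : ℝ) - 1 / 2| < m ∧ q) ∨ ∃ α, t ∈ collar α (1 / 2) ∧ p α ∧ q

variable {a m a' m' : ℝ} {t : unitInterval}

theorem endpt_cases (α : Fin 2) :
    α = 0 ∧ ((endpt α : unitInterval) : ℝ) = 0 ∨ α = 1 ∧ ((endpt α : unitInterval) : ℝ) = 1 := by
  fin_cases α <;> simp [endpt]

theorem mem_collar {α : Fin 2} : t ∈ collar α a ↔ |(t : ℝ) - endpt α| < a := Iff.rfl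

theorem endpt_mem_collar {α : Fin 2} (ha : 0 < a) : endpt α ∈ collar α a := by
  simpa [mem_collar] using ha

theorem isOpen_collar (α : Fin 2) (a : ℝ) : IsOpen (collar α a) :=
  isOpen_lt (by fun_prop) continuous_const

/-- Points of the two half intervals. -/
theorem abs_sub_endpt (α : Fin 2) (t : unitInterval) :
    |(t : ℝ) - endpt α| ≤ 1 / 2 ∧ |(t : ℝ) - 1 / 2| = 1 / 2 - |(t : ℝ) - endpt α| ∨
    1 / 2 ≤ |(t : ℝ) - endpt α| ∧ |(t : ℝ) - 1 / 2| = |(t : ℝ) - endpt α| - 1 / 2 := by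
  have h0 := t.2.1
  have h1 := t.2.2
  rcases endpt_cases α with ⟨-, h⟩ | ⟨-, h⟩ <;> rw [h]
  · rw [sub_zero, abs_of_nonneg h0]
    rcases le_total (t : ℝ) (1 / 2) with h | h
    · exact Or.inl ⟨h, by rw [abs_of_nonpos (by linarith)]; ring⟩
    · exact Or.inr ⟨h, by rw [abs_of_nonneg (by linarith)]⟩
  · rw [abs_of_nonpos (by linarith : (t : ℝ) - 1 ≤ 0)]
    rcases le_total (t : ℝ) (1 / 2) with h | h
    · exact Or.inr ⟨by linarith, by rw [abs_of_nonpos (by linarith)]; ring⟩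
    · exact Or.inl ⟨by linarith, by rw [abs_of_nonneg (by linarith)]; ring⟩

theorem abs_sub_endpt_add {α β : Fin 2} (h : α ≠ β) (t : unitInterval) :
    |(t : ℝ) - endpt α| + |(t : ℝ) - endpt β| = 1 := by
  have h0 := t.2.1
  have h1 := t.2.2
  rcases endpt_cases α with ⟨ha, h⟩ | ⟨ha, h⟩ <;> rcases endpt_cases β with ⟨hb, h'⟩ | ⟨hb, h'⟩
  · exact absurd (ha.trans hb.symm) ‹α ≠ β›
  · rw [h, h', sub_zero, abs_of_nonneg h0, abs_of_nonpos (by linarith)]; ring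
  · rw [h, h', sub_zero, abs_of_nonneg h0, abs_of_nonpos (by linarith)]; ring
  · exact absurd (ha.trans hb.symm) ‹α ≠ β›

theorem eq_of_mem_collar {α β : Fin 2} (h : t ∈ collar α (1 / 2)) (h' : t ∈ collar β (1 / 2)) :
    α = β := by
  by_contra hne
  have := abs_sub_endpt_add hne t
  rw [mem_collar] at h h'
  linarith

theorem collar_mono {α : Fin 2} (h : a ≤ a') : collar α a ⊆ collar α a' :=
  fun t (ht : |(t : ℝ) - endpt α| < a) => lt_of_lt_of_le ht h

theorem interp_iff_of_mem_collar (hm : 0 < m) (ham : a + m < 1 / 2) {α : Fin 2}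
    (ht : t ∈ collar α a) (p : Fin 2 → Prop) (q : Prop) : Interp a m p q t ↔ p α := by
  have ht' : t ∈ collar α (1 / 2) := collar_mono (by linarith) ht
  constructor
  · rintro (⟨β, hβ, h⟩ | ⟨h, -⟩ | ⟨β, hβ, h, -⟩)
    · rwa [eq_of_mem_collar ht' (collar_mono (by linarith) hβ)]
    · rw [mem_collar] at ht ht'
      rcases abs_sub_endpt α t with h' | h' <;> linarith
    · rwa [eq_of_mem_collar ht' hβ]
  · exact fun h => Or.inl ⟨α, ht, h⟩

/-- At a fixed parameter the same one of the three alternatives holds for all conditions `p`, `q`.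
Fibrewise statements thus reduce to the ends, to the middle, and to an intersection. -/
theorem interp_cases (hm : 0 < m) (ham : a + m < 1 / 2) (t : unitInterval) :
    (∃ α, ∀ p q, Interp a m p q t ↔ p α) ∨ (∀ p q, Interp a m p q t ↔ q) ∨
      ∃ α, ∀ p q, Interp a m p q t ↔ p α ∧ q := by
  by_cases h1 : ∃ α, t ∈ collar α a
  · obtain ⟨α, hα⟩ := h1
    exact Or.inl ⟨α, interp_iff_of_mem_collar hm ham hα⟩
  by_cases h2 : |(t : ℝ) - 1 / 2| < m
  · refine Or.inr (Or.inl fun p q => ⟨?_, fun h => Or.inr (Or.inl ⟨h2, h⟩)⟩)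
    rintro (⟨β, hβ, h⟩ | ⟨-, h⟩ | ⟨β, -, -, h⟩)
    · exact absurd ⟨β, hβ⟩ h1
    · exact h
    · exact h
  · have h3 : ∃ α, t ∈ collar α (1 / 2) := by
      by_contra h3
      push Not at h3
      have ha := h3 0
      have hb := h3 1
      rw [mem_collar, not_lt] at ha hb
      have := abs_sub_endpt_add zero_ne_one t
      rcases abs_sub_endpt 0 t with h' | h' <;> linarith
    obtain ⟨α, hα⟩ := h3
    refine Or.inr (Or.inr ⟨α, fun p q => ⟨?_, fun h => Or.inr (Or.inr ⟨α, hα, h⟩)⟩⟩)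
    rintro (⟨β, hβ, h⟩ | ⟨h, -⟩ | ⟨β, hβ, h⟩)
    · exact absurd ⟨β, hβ⟩ h1
    · exact absurd h h2
    · rwa [eq_of_mem_collar hα hβ]

/-- This makes the interpolation of the domains compatible with the footprints `F_I`, which are
intersections of interpolated basic footprints. -/
theorem interp_forall_iff (hm : 0 < m) (ham : a + m < 1 / 2) {ι : Type*} (s : Finset ι)
    (p : ι → Fin 2 → Prop) (q : ι → Prop) :
    (∀ i ∈ s, Interp a m (p i) (q i) t) ↔
      Interp a m (fun α => ∀ i ∈ s, p i α) (∀ i ∈ s, q i) t := by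
  rcases interp_cases hm ham t with ⟨α, h⟩ | h | ⟨α, h⟩ <;> simp only [h]
  exact ⟨fun h => ⟨fun i hi => (h i hi).1, fun i hi => (h i hi).2⟩,
    fun h i hi => ⟨h.1 i hi, h.2 i hi⟩⟩

variable {A : Type*} [TopologicalSpace A]

/-- The subset of `[0,1] × A` whose fibres are `P α` on the collar of width `a` of `α`, are `Q`
near `1/2`, and are `P α ∩ Q` in between. -/
def interpSet (a m : ℝ) (P : Fin 2 → Set A) (Q : Set A) : Set (unitInterval × A) :=
  {z | Interp a m (fun α => z.2 ∈ P α) (z.2 ∈ Q) z.1}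

variable {P P' : Fin 2 → Set A} {Q Q' : Set A}

theorem isOpen_interpSet (hP : ∀ α, IsOpen (P α)) (hQ : IsOpen Q) :
    IsOpen (interpSet a m P Q) := by
  have : interpSet a m P Q = (⋃ α, collar α a ×ˢ P α) ∪ ({t : unitInterval | |(t : ℝ) - 1 / 2| < m} ×ˢ Q ∪
      ⋃ α, collar α (1 / 2) ×ˢ (P α ∩ Q)) := by
    ext z
    simp [interpSet, Interp, mem_prod]
  rw [this]
  have hm : IsOpen {t : unitInterval | |(t : ℝ) - 1 / 2| < m} :=
    isOpen_lt (by fun_prop) continuous_const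
  exact (isOpen_iUnion fun α => (isOpen_collar α a).prod (hP α)).union ((hm.prod hQ).union
    (isOpen_iUnion fun α => (isOpen_collar α _).prod ((hP α).inter hQ)))

theorem closure_interpSet_subset (ha : a < a') (hm : m < m') (hm' : 0 < m')
    (hP : ∀ α, closure (P α) ⊆ P' α) (hQ : closure Q ⊆ Q') :
    closure (interpSet a m P Q) ⊆ interpSet a' m' P' Q' := by
  have hcl : ∀ c : ℝ, ∀ b, IsClosed {t : unitInterval | |(t : ℝ) - c| ≤ b} := fun c b =>
    isClosed_le (by fun_prop) continuous_const
  have h1 : closure (interpSet a m P Q) ⊆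
      (⋃ α, {t : unitInterval | |(t : ℝ) - endpt α| ≤ a} ×ˢ closure (P α)) ∪
      ({t : unitInterval | |(t : ℝ) - 1 / 2| ≤ m} ×ˢ closure Q ∪
      ⋃ α, {t : unitInterval | |(t : ℝ) - endpt α| ≤ 1 / 2} ×ˢ (closure (P α) ∩ closure Q)) := by
    refine closure_minimal ?_ ((isClosed_iUnion_of_finite fun α =>
      (hcl _ _).prod isClosed_closure).union (((hcl _ _).prod isClosed_closure).union
      (isClosed_iUnion_of_finite fun α =>
        (hcl _ _).prod (isClosed_closure.inter isClosed_closure))))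
    rintro ⟨t, x⟩ (⟨α, h, hx⟩ | ⟨h, hx⟩ | ⟨α, h, hx, hx'⟩)
    · exact Or.inl (mem_iUnion.2 ⟨α, (mem_collar.1 h).le, subset_closure hx⟩)
    · exact Or.inr (Or.inl ⟨le_of_lt h, subset_closure hx⟩)
    · exact Or.inr (Or.inr (mem_iUnion.2 ⟨α, (mem_collar.1 h).le, subset_closure hx, subset_closure hx'⟩))
  refine h1.trans ?_
  rintro ⟨t, x⟩ (h | ⟨h, hx⟩ | h)
  · obtain ⟨α, h, hx⟩ := mem_iUnion.1 h
    exact Or.inl ⟨α, lt_of_le_of_lt h ha, hP α hx⟩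
  · exact Or.inr (Or.inl ⟨lt_of_le_of_lt h hm, hQ hx⟩)
  · obtain ⟨α, h, hx, hx'⟩ := mem_iUnion.1 h
    rcases (show |(t : ℝ) - endpt α| ≤ 1 / 2 from h).lt_or_eq with h' | h'
    · exact Or.inr (Or.inr ⟨α, h', hP α hx, hQ hx'⟩)
    -- A limit with `|t - α| = 1/2` has `t = 1/2`, which leaves the open half interval but lies in
    -- the middle region because `m' > 0`.
    · refine Or.inr (Or.inl ⟨?_, hQ hx'⟩)
      rcases abs_sub_endpt α t with h'' | h'' <;> linarith

theorem closure_interpSet_subset_prod : closure (interpSet a m P Q) ⊆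
    univ ×ˢ ((⋃ α, closure (P α)) ∪ closure Q) := by
  refine closure_minimal ?_ (isClosed_univ.prod
    ((isClosed_iUnion_of_finite fun α => isClosed_closure).union isClosed_closure))
  rintro ⟨t, x⟩ (⟨α, h, hx⟩ | ⟨h, hx⟩ | ⟨α, h, hx, hx'⟩)
  · exact ⟨trivial, Or.inl (mem_iUnion.2 ⟨α, subset_closure hx⟩)⟩
  · exact ⟨trivial, Or.inr (subset_closure hx)⟩
  · exact ⟨trivial, Or.inr (subset_closure hx')⟩

end Interpolation

variable {X : Type u} [TopologicalSpace X]

namespace WeakAtlas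

variable {K : WeakAtlas.{u, v} X}

namespace Shrinking

/-- The shrinking of the product of an atlas with the unit interval that interpolates between
given shrinkings. -/
def interp [CompactSpace X] (S : Fin 2 → K.Shrinking) (B : K.Shrinking) (a m : ℝ)
    (ha : 0 < a) (hm : 0 < m) (ham : a + m < 1 / 2)
    (hSB : ∀ α, ⋃ i, (S α).F i ∩ B.F i = univ) : K.prod.Shrinking where
  F i := interpSet a m (fun α => (S α).F i) (B.F i)
  isOpen_F i := isOpen_interpSet (fun α => (S α).isOpen_F i) (B.isOpen_F i)
  closure_F i := ⟨isClosed_closure.isCompact, fun z hz => by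
    rcases (closure_interpSet_subset_prod hz).2 with h | h
    · obtain ⟨α, h⟩ := mem_iUnion.1 h
      exact ((S α).closure_F i).2 h
    · exact (B.closure_F i).2 h⟩
  cover_F := by
    refine eq_univ_of_forall fun z => mem_iUnion.2 ?_
    change ∃ i, Interp a m (fun α => z.2 ∈ (S α).F i) (z.2 ∈ B.F i) z.1
    -- The transition region is where `hSB` is needed: there only `S α ∩ B` is available to cover.
    rcases interp_cases hm ham z.1 with ⟨α, h⟩ | h | ⟨α, h⟩ <;> simp only [h]
    · exact mem_iUnion.1 ((S α).cover_F.symm.subset (mem_univ z.2))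
    · exact mem_iUnion.1 (B.cover_F.symm.subset (mem_univ z.2))
    · exact mem_iUnion.1 ((hSB α).symm.subset (mem_univ z.2))
  nonempty_F I hI := by
    obtain ⟨z, hz⟩ := hI
    obtain ⟨p, hp⟩ := (S 0).nonempty_F I
      ⟨z.2, mem_iInter₂.2 fun i hi => mem_iInter₂.1 hz i hi⟩
    exact ⟨(endpt 0, p), mem_iInter₂.2 fun i hi => Or.inl
      ⟨0, endpt_mem_collar ha, mem_iInter₂.1 hp i hi⟩⟩
  U I := interpSet a m (fun α => (S α).U I) (B.U I)
  isOpen_U I := isOpen_interpSet (fun α => (S α).isOpen_U I) (B.isOpen_U I)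
  isCompact_closure_U I := (isCompact_univ.prod ((isCompact_iUnion fun α =>
    (S α).isCompact_closure_U I).union (B.isCompact_closure_U I))).of_isClosed_subset
      isClosed_closure closure_interpSet_subset_prod
  mem_U_iff I x := by
    have h1 := fun α => (S α).mem_U_iff I ⟨x.1.2, congrArg Prod.snd x.2⟩
    have h2 := B.mem_U_iff I ⟨x.1.2, congrArg Prod.snd x.2⟩
    simp only [mem_iInter₂] at h1 h2 ⊢
    refine Iff.trans ?_ (interp_forall_iff (t := x.1.1) hm ham I.1 _ _).symm
    change Interp a m (fun α => x.1.2 ∈ (S α).U I) (x.1.2 ∈ B.U I) x.1.1 ↔ _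
    simp only [h1, h2]
    rfl

theorem isTame_interp [CompactSpace X] {𝓔 : K.Filtration} {S : Fin 2 → K.Shrinking}
    {B : K.Shrinking} {a m : ℝ} (ha : 0 < a) (hm : 0 < m) (ham : a + m < 1 / 2)
    (hSB : ∀ α, ⋃ i, (S α).F i ∩ B.F i = univ) (hS : ∀ α, (S α).IsTame 𝓔) (hB : B.IsTame 𝓔) :
    (interp S B a m ha hm ham hSB).IsTame 𝓔.prod := by
  simp only [isTame_iff] at hS hB ⊢
  refine tameFamily_prod fun t => ?_
  change K.TameFamily 𝓔 (fun I => {x | Interp a m (fun α => x ∈ (S α).U I) (x ∈ B.U I) t})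
  rcases interp_cases hm ham t with ⟨α, h⟩ | h | ⟨α, h⟩ <;> simp only [h]
  · exact hS α
  · exact hB
  · exact (hS α).inter hB

/-- Interpolate the intermediate shrinkings as well, with slightly larger `a` and `m`, so that the
closures of the smaller regions are contained in the larger ones. -/
theorem isPreshrunkTame_interp [CompactSpace X] {𝓔 : K.Filtration} {S : Fin 2 → K.Shrinking}
    {B : K.Shrinking} {a m : ℝ} (ha : 0 < a) (hm : 0 < m) (ham : a + m < 1 / 2)
    (hSB : ∀ α, ⋃ i, (S α).F i ∩ B.F i = univ) (hS : ∀ α, (S α).IsPreshrunkTame 𝓔)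
    (hB : B.IsPreshrunkTame 𝓔) :
    (interp S B a m ha hm ham hSB).IsPreshrunkTame 𝓔.prod := by
  choose S' hS' hSS' using fun α => (hS α).2
  obtain ⟨B', hB', hBB'⟩ := hB.2
  simp only [isShrinkingOf_iff] at hSS' hBB'
  have hSB' : ∀ α, ⋃ i, (S' α).F i ∩ B'.F i = univ := fun α => by
    rw [← univ_subset_iff, ← hSB α]
    exact iUnion_mono fun i => inter_subset_inter
      (subset_closure.trans ((hSS' α).1 i)) (subset_closure.trans (hBB'.1 i))
  -- A quarter of the slack in `a + m < 1/2` is added to each of `a` and `m`.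
  obtain ⟨r, hr, hr'⟩ : ∃ r > 0, a + r + (m + r) < 1 / 2 :=
    ⟨(1 / 2 - (a + m)) / 4, by linarith, by linarith⟩
  refine ⟨isTame_interp ha hm ham hSB (fun α => (hS α).1) hB.1,
    interp S' B' (a + r) (m + r) (by linarith) (by linarith) hr' hSB',
    isTame_interp _ _ _ hSB' hS' hB', (isShrinkingOf_iff _ _).2 ⟨fun i => ?_, fun I => ?_⟩⟩
  · exact closure_interpSet_subset (by linarith) (by linarith) (by linarith)
      (fun α => (hSS' α).1 i) (hBB'.1 i)
  · exact closure_interpSet_subset (by linarith) (by linarith) (by linarith)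
      (fun α => (hSS' α).2 I) (hBB'.2 I)

end Shrinking

end WeakAtlas

end Kuranishi

/-! ### The interpolation as a concordance. -/

namespace Kuranishi

variable {X : Type u} [TopologicalSpace X]

namespace WeakAtlas

variable {K : WeakAtlas.{u, v} X}

theorem mem_range_φ_iff {I J : K.idx} (h : I ≤ J) (y : (K.chart J).U) :
    y ∈ range (K.coord h).φ ↔ ∃ x, K.MorB ⟨I, x⟩ ⟨J, y⟩ := by
  constructor
  · rintro ⟨x, rfl⟩
    exact ⟨x, morB_φ h x.2⟩
  · rintro ⟨x, hm⟩
    obtain ⟨_, h2, rfl⟩ := morB_iff.1 hm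
    exact ⟨⟨x, h2⟩, rfl⟩

theorem mem_dom_iff_exists_morB {I J : K.idx} (h : I ≤ J) (x : (K.chart I).U) :
    x ∈ (K.coord h).dom ↔ ∃ y, K.MorB ⟨I, x⟩ ⟨J, y⟩ :=
  ⟨fun hx => ⟨_, morB_φ h hx⟩, fun ⟨_, hm⟩ => hm.2.1⟩

namespace Shrinking

theorem mem_foot_iff (S : K.Shrinking) (I : K.idx) (p : X) :
    p ∈ (S.atlas.chart I).foot ↔ ∀ i ∈ I.1, p ∈ S.F i :=
  (Set.ext_iff.1 (S.atlas.foot_chart I) p).trans mem_iInter₂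

section

variable [CompactSpace X] {S : Fin 2 → K.Shrinking} {B : K.Shrinking} {a m : ℝ}
  (ha : 0 < a) (hm : 0 < m) (ham : a + m < 1 / 2) (hSB : ∀ α, ⋃ i, (S α).F i ∩ B.F i = univ)

theorem mem_interp_U_iff {α : Fin 2} {t : unitInterval} (ht : t ∈ collar α a) (I : K.idx)
    (x : (K.chart I).U) :
    (t, x) ∈ (interp S B a m ha hm ham hSB).U I ↔ x ∈ (S α).U I :=
  interp_iff_of_mem_collar hm ham ht _ _

theorem mem_interp_F_iff {α : Fin 2} {t : unitInterval} (ht : t ∈ collar α a) (i : Fin K.N)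
    (p : X) : (t, p) ∈ (interp S B a m ha hm ham hSB).F i ↔ p ∈ (S α).F i :=
  interp_iff_of_mem_collar hm ham ht _ _

theorem mem_interp_foot_iff {α : Fin 2} {t : unitInterval} (ht : t ∈ collar α a) (I : K.idx)
    (p : X) : (t, p) ∈ ((interp S B a m ha hm ham hSB).atlas.chart I).foot ↔
      p ∈ ((S α).atlas.chart I).foot :=
  (mem_foot_iff (interp S B a m ha hm ham hSB) I (t, p)).trans (Iff.trans
    (forall₂_congr fun i _ => mem_interp_F_iff ha hm ham hSB ht i p) (mem_foot_iff (S α) I p).symm)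

/-- The collar embedding of the domains of an interpolating shrinking. -/
def collarU (α : Fin 2) (I : K.idx) (q : ↥(collar α a) × (S α).U I) :
    (interp S B a m ha hm ham hSB).U I :=
  ⟨(q.1.1, q.2.1), (mem_interp_U_iff ha hm ham hSB q.1.2 I q.2.1).2 q.2.2⟩

/-- The collar embedding of the obstruction bundles of an interpolating shrinking. -/
def collarE (α : Fin 2) (I : K.idx) (q : ↥(collar α a) × ↥((K.chart I).pr ⁻¹' (S α).U I)) :
    ↥((K.prod.chart I).pr ⁻¹' (interp S B a m ha hm ham hSB).U I) :=
  ⟨(q.1.1, q.2.1), (mem_interp_U_iff ha hm ham hSB q.1.2 I _).2 q.2.2⟩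

theorem isOpenEmbedding_collarU (α : Fin 2) (I : K.idx) :
    IsOpenEmbedding (collarU ha hm ham hSB α I) := by
  refine IsOpenEmbedding.of_comp _
    ((interp S B a m ha hm ham hSB).isOpen_U I).isOpenEmbedding_subtypeVal ?_
  exact (isOpen_collar α a).isOpenEmbedding_subtypeVal.prodMap
    ((S α).isOpen_U I).isOpenEmbedding_subtypeVal

theorem isOpenEmbedding_collarE (α : Fin 2) (I : K.idx) :
    IsOpenEmbedding (collarE ha hm ham hSB α I) := by
  refine IsOpenEmbedding.of_comp _ (((interp S B a m ha hm ham hSB).isOpen_U I).preimage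
    (K.prod.chart I).continuous_pr).isOpenEmbedding_subtypeVal ?_
  exact (isOpen_collar α a).isOpenEmbedding_subtypeVal.prodMap
    (((S α).isOpen_U I).preimage (K.chart I).continuous_pr).isOpenEmbedding_subtypeVal

/-- Morphisms of the product preserve the parameter, and over the collar the domains are those of `S
α`; so the atlas is a product there. -/
theorem morB_collarU_iff {α : Fin 2} {I J : K.idx} {t s : ↥(collar α a)} {x : (S α).U I}
    {y : (S α).U J} : (interp S B a m ha hm ham hSB).atlas.MorB
      ⟨I, collarU ha hm ham hSB α I (t, x)⟩ ⟨J, collarU ha hm ham hSB α J (s, y)⟩ ↔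
      t = s ∧ (S α).atlas.MorB ⟨I, x⟩ ⟨J, y⟩ := by
  rw [morB_atlas_iff (S α)]
  refine (morB_atlas_iff (interp S B a m ha hm ham hSB) (I := I) (J := J) _ _).trans ?_
  exact (morB_prod_iff _ _).trans (and_congr_left' Subtype.ext_iff.symm)

theorem exists_collarU_eq {α : Fin 2} {I : K.idx} (x : (interp S B a m ha hm ham hSB).U I)
    (hx : x.1.1 ∈ collar α a) :
    ∃ (s : collar α a) (x' : (S α).U I), s.1 = x.1.1 ∧ collarU ha hm ham hSB α I (s, x') = x :=
  ⟨⟨_, hx⟩, ⟨x.1.2, (mem_interp_U_iff ha hm ham hSB hx I x.1.2).1 x.2⟩, rfl, rfl⟩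

theorem exists_collarE_eq {α : Fin 2} {I : K.idx}
    (e : ↥((K.prod.chart I).pr ⁻¹' (interp S B a m ha hm ham hSB).U I))
    (he : e.1.1 ∈ collar α a) :
    ∃ (s : collar α a) (e' : ↥((K.chart I).pr ⁻¹' (S α).U I)), s.1 = e.1.1 ∧
      collarE ha hm ham hSB α I (s, e') = e :=
  ⟨⟨_, he⟩, ⟨e.1.2, (mem_interp_U_iff ha hm ham hSB he I _).1 e.2⟩, rfl, rfl⟩

/-- A morphism of the interpolating shrinking preserves the parameter. -/
theorem fst_eq_of_morB {I J : K.idx} {x : (interp S B a m ha hm ham hSB).U I}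
    {y : (interp S B a m ha hm ham hSB).U J}
    (h : (interp S B a m ha hm ham hSB).atlas.MorB ⟨I, x⟩ ⟨J, y⟩) : x.1.1 = y.1.1 :=
  ((morB_prod_iff x.1 y.1).1
    ((morB_atlas_iff (interp S B a m ha hm ham hSB) (I := I) (J := J) x y).1 h)).1

theorem notMem_collar_one_of_mem_collar_zero {t : unitInterval} (ham : a ≤ 1 / 2)
    (h0 : t ∈ collar 0 a) (h1 : t ∈ collar 1 a) : False :=
  zero_ne_one (eq_of_mem_collar (collar_mono ham h0) (collar_mono ham h1))

/-- The interpolating shrinking is a concordance. -/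
def concordance : Concordance (fun α => (S α).atlas) where
  atlas := (interp S B a m ha hm ham hSB).atlas
  ε := a
  ε_pos := ha
  ε_lt := by linarith
  foot_collar I α t ht p := (mem_interp_foot_iff ha hm ham hSB ht I p).trans
    (mem_interp_foot_iff ha hm ham hSB (endpt_mem_collar ha) I p).symm
  emb α := Function.Embedding.refl (Fin K.N)
  bd α I := I
  bd_val α I := (Finset.map_refl).symm
  mem_range_bd α I := by
    -- Shrinkings keep the index set, so every chart meets both ends and `bd` is the identity. The
    -- condition on charts missing an end is therefore vacuous.
    refine iff_of_true ⟨I, rfl⟩ ?_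
    obtain ⟨p, hp⟩ := (((S α).atlas.mem_idx I.1).1 I.2).2
    refine ⟨p, (mem_interp_foot_iff ha hm ham hSB (endpt_mem_collar ha) I p).2 ?_⟩
    exact (Set.ext_iff.1 ((S α).atlas.foot_chart I) p).2 hp
  foot_bd α I p := mem_interp_foot_iff ha hm ham hSB (endpt_mem_collar ha) I p
  ιU α I := collarU ha hm ham hSB α I
  ιE α I := collarE ha hm ham hSB α I
  isOpenEmbedding_ιU := isOpenEmbedding_collarU ha hm ham hSB
  isOpenEmbedding_ιE := isOpenEmbedding_collarE ha hm ham hSB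
  isClosed_bdU α I := by
    have h1 : IsClosed {x : (interp S B a m ha hm ham hSB).U I | x.1.1 = endpt α} :=
      isClosed_eq (continuous_fst.comp continuous_subtype_val) continuous_const
    change IsClosed (collarU ha hm ham hSB α I '' {q | (q.1 : unitInterval) = endpt α})
    convert h1 using 1
    ext x
    constructor
    · rintro ⟨q, hq, rfl⟩
      exact hq
    · intro hx
      have hx' : x.1.1 ∈ collar α a := by
        rw [show x.1.1 = endpt α from hx]; exact endpt_mem_collar ha
      obtain ⟨s, x', hs, h⟩ := exists_collarU_eq ha hm ham hSB x hx'
      exact ⟨_, hs.trans hx, h⟩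
  isClosed_bdE α I := by
    have h1 : IsClosed {e : ↥((K.prod.chart I).pr ⁻¹' (interp S B a m ha hm ham hSB).U I) |
        e.1.1 = endpt α} :=
      isClosed_eq (continuous_fst.comp continuous_subtype_val) continuous_const
    change IsClosed (collarE ha hm ham hSB α I '' {q | (q.1 : unitInterval) = endpt α})
    convert h1 using 1
    ext x
    constructor
    · rintro ⟨q, hq, rfl⟩
      exact hq
    · intro hx
      have hx' : x.1.1 ∈ collar α a := by
        rw [show x.1.1 = endpt α from hx]; exact endpt_mem_collar ha
      obtain ⟨s, x', hs, h⟩ := exists_collarE_eq ha hm ham hSB x hx'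
      exact ⟨_, hs.trans hx, h⟩
  disjoint_ιU I J q r h := by
    have h1 : q.1.1 = r.1.1 := congrArg
      (fun p : (interp S B a m ha hm ham hSB).atlas.ObjB => p.2.1.1) h
    exact notMem_collar_one_of_mem_collar_zero (by linarith) q.1.2 (h1 ▸ r.1.2)
  disjoint_ιE I J q r h := by
    have h1 : q.1.1 = r.1.1 := congrArg
      (fun p : (interp S B a m ha hm ham hSB).atlas.ObjE => p.2.1.1) h
    exact notMem_collar_one_of_mem_collar_zero (by linarith) q.1.2 (h1 ▸ r.1.2)
  pr_ιE α I t e := rfl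
  zero_ιU α I t x := rfl
  sec_ιU α I t x := rfl
  ψ_ιU α I t x hx hy := rfl
  mem_dom_ιU α I J h h' t x := by
    refine (mem_dom_iff_exists_morB (K := (interp S B a m ha hm ham hSB).atlas) h' _).trans
      (Iff.trans ?_ (mem_dom_iff_exists_morB (K := (S α).atlas) h x).symm)
    constructor
    · rintro ⟨y, hy⟩
      have h1 := fst_eq_of_morB ha hm ham hSB hy
      have h2 : y.1.1 ∈ collar α a := h1 ▸ t.2
      obtain ⟨s, y', -, rfl⟩ := exists_collarU_eq ha hm ham hSB y h2
      exact ⟨y', ((morB_collarU_iff ha hm ham hSB).1 hy).2⟩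
    · rintro ⟨y, hy⟩
      exact ⟨_, (morB_collarU_iff ha hm ham hSB (s := t)).2 ⟨rfl, hy⟩⟩
  φ_ιU α I J h h' t x hx := rfl
  Φ_ιE α I J h h' t e he := rfl
  range_φ_ιU α I J h h' t y := by
    refine (mem_range_φ_iff (K := (interp S B a m ha hm ham hSB).atlas) h' _).trans
      (Iff.trans ?_ (mem_range_φ_iff (K := (S α).atlas) h y).symm)
    constructor
    · rintro ⟨x, hx⟩
      have h1 := fst_eq_of_morB ha hm ham hSB hx
      have h2 : x.1.1 ∈ collar α a := h1 ▸ t.2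
      obtain ⟨s, x', -, rfl⟩ := exists_collarU_eq ha hm ham hSB x h2
      exact ⟨x', ((morB_collarU_iff ha hm ham hSB).1 hx).2⟩
    · rintro ⟨x, hx⟩
      exact ⟨_, (morB_collarU_iff ha hm ham hSB (t := t)).2 ⟨rfl, hx⟩⟩
  notMem_dom_ιU α I J h' hJ := absurd ⟨J, rfl⟩ hJ

/-- Both filtrations are restrictions of `E_IJ` or of its product with the interval, so the product
structure is visible on the whole collar and `δ = a` works. -/
theorem concordance_isFilteredBy (𝓔 : K.Filtration) :
    (concordance ha hm ham hSB).IsFilteredBy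
      ((interp S B a m ha hm ham hSB).filtration 𝓔.prod) (fun α => (S α).filtration 𝓔) := by
  refine ⟨a, ha, le_rfl, fun α I J hIJ => ?_⟩
  have hI : I.map (Function.Embedding.refl (Fin K.N)) = I := Finset.map_refl
  change (∀ (t : collar α a) (e : ↥((K.chart J).pr ⁻¹' (S α).U J)), (t : unitInterval) = endpt α →
      (e.1 ∈ 𝓔.sub (I.map (Function.Embedding.refl (Fin K.N))) J ↔ e.1 ∈ 𝓔.sub I J)) ∧
    collarE ha hm ham hSB α J '' {q | (q.1 : unitInterval) ∈ collar α a ∧ q.2.1 ∈ 𝓔.sub I J} =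
      {e | e.1.2 ∈ 𝓔.sub (I.map (Function.Embedding.refl (Fin K.N))) J} ∩
        {e | ((interp S B a m ha hm ham hSB).atlas.chart J).pr e ∈
        collarU ha hm ham hSB α J '' {q | (q.1 : unitInterval) ∈ collar α a}}
  rw [hI]
  refine ⟨fun t e _ => Iff.rfl, ?_⟩
  ext e
  constructor
  · rintro ⟨⟨t, e⟩, ⟨ht, he⟩, rfl⟩
    exact ⟨he, ⟨(t, ⟨(K.chart J).pr e.1, e.2⟩), ht, rfl⟩⟩
  · rintro ⟨he, ⟨⟨t, x⟩, ht, hx⟩⟩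
    have h1 : t.1 = e.1.1 := congrArg (fun z : (interp S B a m ha hm ham hSB).U J => z.1.1) hx
    have h2 : e.1.1 ∈ collar α a := h1 ▸ ht
    obtain ⟨s, e', -, rfl⟩ := exists_collarE_eq ha hm ham hSB e h2
    exact ⟨_, ⟨s.2, he⟩, rfl⟩

end

end Shrinking

end WeakAtlas

end Kuranishi

/-! ### Cone metrics and gluing of metrics. -/

namespace Kuranishi

section Cone

variable {P : Type*}

/-- The distance function of a cone, at height `w`. -/
def coneDist (w : P → ℝ) (d : P → P → ℝ) (c : ℝ) (p q : P) : ℝ :=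
  min (w p) (w q) * d p q + c * |w p - w q|

variable {w : P → ℝ} {d : P → P → ℝ} {c : ℝ}

theorem coneDist_nonneg (hw : ∀ p, 0 ≤ w p) (hd : ∀ p q, 0 ≤ d p q) (hc : 0 ≤ c) (p q : P) :
    0 ≤ coneDist w d c p q :=
  add_nonneg (mul_nonneg (le_min (hw p) (hw q)) (hd p q)) (mul_nonneg hc (abs_nonneg _))

theorem coneDist_comm (hd : ∀ p q, d p q = d q p) (p q : P) :
    coneDist w d c p q = coneDist w d c q p := by
  rw [coneDist, coneDist, hd, min_comm, abs_sub_comm]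

/-- If `q` is at least as high as the lower of `p` and `r`, the triangle inequality of `d` suffices.
Otherwise the loss of weight costs at most `c` times the height defect, and the height terms supply
twice that amount. The inequality for `d` is needed only at positive heights. -/
theorem coneDist_triangle (hw : ∀ p, 0 ≤ w p) (hd : ∀ p q, 0 ≤ d p q) (hdc : ∀ p q, d p q ≤ c)
    (htri : ∀ p q r, 0 < w p → 0 < w q → 0 < w r → d p r ≤ d p q + d q r) (p q r : P) :
    coneDist w d c p r ≤ coneDist w d c p q + coneDist w d c q r := by
  have hc : 0 ≤ c := (hd p p).trans (hdc p p)
  simp only [coneDist]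
  rcases le_or_gt (min (w p) (w r)) (w q) with h | h
  · have h1 : |w p - w r| ≤ |w p - w q| + |w q - w r| := abs_sub_le _ _ _
    have h2 : min (w p) (w r) * d p r ≤ min (w p) (w q) * d p q + min (w q) (w r) * d q r := by
      rcases (le_min (hw p) (hw r)).eq_or_lt with h0 | h0
      · rw [← h0, zero_mul]
        exact add_nonneg (mul_nonneg (le_min (hw p) (hw q)) (hd p q))
          (mul_nonneg (le_min (hw q) (hw r)) (hd q r))
      · have h3 := htri p q r (lt_min_iff.1 h0).1 (h0.trans_le h) (lt_min_iff.1 h0).2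
        calc min (w p) (w r) * d p r ≤ min (w p) (w r) * (d p q + d q r) := by gcongr
          _ = min (w p) (w r) * d p q + min (w p) (w r) * d q r := mul_add _ _ _
          _ ≤ _ := add_le_add
            (mul_le_mul_of_nonneg_right (le_min (min_le_left _ _) h) (hd p q))
            (mul_le_mul_of_nonneg_right (le_min h (min_le_right _ _)) (hd q r))
    nlinarith
  · obtain ⟨hp, hr⟩ := lt_min_iff.1 h
    rw [min_eq_right hp.le, min_eq_left hr.le, abs_of_pos (sub_pos.2 hp),
      abs_sub_comm (w q), abs_of_pos (sub_pos.2 hr)]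
    -- With this identity, `|w p - w q| + |w q - w r|` exceeds `|w p - w r|` by `2 * (min (w p) (w
    -- r) - w q)`.
    have h1 : |w p - w r| = w p + w r - 2 * min (w p) (w r) := by
      rcases le_total (w p) (w r) with h' | h'
      · rw [abs_of_nonpos (by linarith), min_eq_left h']; ring
      · rw [abs_of_nonneg (by linarith), min_eq_right h']; ring
    have h2 : w q * d p r ≤ w q * d p q + w q * d q r := by
      rcases (hw q).eq_or_lt with h0 | h0
      · simp [← h0]
      · rw [← mul_add]
        exact mul_le_mul_of_nonneg_left (htri p q r (h0.trans hp) h0 (h0.trans hr)) h0.le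
    have h3 : (min (w p) (w r) - w q) * d p r ≤ (min (w p) (w r) - w q) * c :=
      mul_le_mul_of_nonneg_left (hdc p r) (by linarith)
    have h4 : 0 ≤ (min (w p) (w r) - w q) * c := mul_nonneg (by linarith) hc
    rw [h1]
    nlinarith

theorem coneDist_self (hd : ∀ p, d p p = 0) (p : P) : coneDist w d c p p = 0 := by
  simp [coneDist, hd]

theorem coneDist_le (hw : ∀ p, 0 ≤ w p) (hw1 : ∀ p, w p ≤ 1) (hd : ∀ p q, 0 ≤ d p q)
    (hdc : ∀ p q, d p q ≤ c) (p q : P) : coneDist w d c p q ≤ c + c := by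
  have hc : 0 ≤ c := (hd p p).trans (hdc p p)
  have h1 : min (w p) (w q) * d p q ≤ 1 * c :=
    mul_le_mul ((min_le_left _ _).trans (hw1 p)) (hdc p q) (hd p q) zero_le_one
  have h2 : |w p - w q| ≤ 1 := abs_sub_le_iff.2
    ⟨by linarith [hw q, hw1 p], by linarith [hw p, hw1 q]⟩
  have h3 := mul_le_mul_of_nonneg_left h2 hc
  simp only [coneDist]
  linarith

end Cone

variable {X : Type u} [TopologicalSpace X]

namespace WeakAtlas

variable {A : WeakAtlas.{u, v} X}

namespace IsAdmissibleMetric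

variable {d : A.RealB → A.RealB → ℝ}

theorem self (h : A.IsAdmissibleMetric d) (p : A.RealB) : d p p = 0 := (h.eq_zero_iff p p).2 rfl

theorem nonneg (h : A.IsAdmissibleMetric d) (p q : A.RealB) : 0 ≤ d p q := by
  have h1 := h.triangle p q p
  rw [h.self, h.symm q p] at h1
  linarith

/-- By the triangle inequality `d`-balls pull back to sets satisfying the openness criterion, so
they are open in `U_I`. -/
theorem tendsto (h : A.IsAdmissibleMetric d) {I : A.idx} (x : (A.chart I).U) :
    Filter.Tendsto (fun y => d (A.πB I x) (A.πB I y)) (𝓝 x) (𝓝 0) := by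
  have hn : ∀ y, 0 ≤ d (A.πB I x) (A.πB I y) := fun y => h.nonneg _ _
  refine (nhds_basis_abs_sub_lt (0 : ℝ)).tendsto_right_iff.2 fun ε hε => ?_
  have ho : IsOpen {y | d (A.πB I x) (A.πB I y) < ε} := by
    refine (h.isOpen_iff I _).2 fun y hy => ⟨ε - d (A.πB I x) (A.πB I y), sub_pos.2 hy, ?_⟩
    intro z hz
    have := h.triangle (A.πB I x) (A.πB I y) (A.πB I z)
    change d (A.πB I x) (A.πB I z) < ε
    linarith
  filter_upwards [ho.mem_nhds (show d (A.πB I x) (A.πB I x) < ε by rwa [h.self])] with y hy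
  change |d (A.πB I x) (A.πB I y) - 0| < ε
  rwa [sub_zero, abs_of_nonneg (hn y)]

theorem exists_of_mem_nhds (h : A.IsAdmissibleMetric d) {I : A.idx} {x : (A.chart I).U}
    {V : Set (A.chart I).U} (hV : V ∈ 𝓝 x) :
    ∃ δ > 0, ∀ y, d (A.πB I x) (A.πB I y) < δ → y ∈ V := by
  obtain ⟨W, hWV, hW, hx⟩ := mem_nhds_iff.1 hV
  obtain ⟨δ, hδ, h'⟩ := (h.isOpen_iff I W).1 hW x hx
  exact ⟨δ, hδ, fun y hy => hWV (h' y hy)⟩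

end IsAdmissibleMetric

/-- An admissible metric that is glued from finitely many metrics, defined where the functions
`W i` of a parameter `τ` are positive. -/
theorem isAdmissibleMetric_glue {ι : Type*} [Fintype ι] {τ : A.RealB → unitInterval}
    {W : ι → unitInterval → ℝ} {d : ι → A.RealB → A.RealB → ℝ} {c : ℝ} (hc : 0 < c)
    (hW0 : ∀ i t, 0 ≤ W i t) (hW1 : ∀ i t, W i t ≤ 1) (hWc : ∀ i, Continuous (W i))
    (hτ : ∀ I, Continuous (τ ∘ A.πB I))
    (hd0 : ∀ i p q, 0 ≤ d i p q) (hdc : ∀ i p q, d i p q ≤ c) (hdself : ∀ i p, d i p p = 0)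
    (hdsymm : ∀ i p q, d i p q = d i q p)
    (hdtri : ∀ i p q r, 0 < W i (τ p) → 0 < W i (τ q) → 0 < W i (τ r) →
      d i p r ≤ d i p q + d i q r)
    (hsep : ∀ p q, τ p = τ q → (∀ i, 0 < W i (τ p) → d i p q = 0) → p = q)
    (hcont : ∀ i I (x : (A.chart I).U), 0 < W i (τ (A.πB I x)) →
      Filter.Tendsto (fun y => d i (A.πB I x) (A.πB I y)) (𝓝 x) (𝓝 0))
    (hsmall : ∀ I (x : (A.chart I).U), ∃ i, 0 < W i (τ (A.πB I x)) ∧ ∀ V ∈ 𝓝 x, ∃ δ > 0, ∀ y,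
      |(τ (A.πB I x) : ℝ) - τ (A.πB I y)| < δ → 0 < W i (τ (A.πB I y)) →
      d i (A.πB I x) (A.πB I y) < δ → y ∈ V) :
    A.IsAdmissibleMetric
      (fun p q => |(τ p : ℝ) - τ q| + ∑ i, coneDist (fun p => W i (τ p)) (d i) c p q) := by
  have hcone0 : ∀ i p q, 0 ≤ coneDist (fun p => W i (τ p)) (d i) c p q := fun i =>
    coneDist_nonneg (fun p => hW0 i _) (hd0 i) hc.le
  have hsum0 : ∀ p q, 0 ≤ ∑ i, coneDist (fun p => W i (τ p)) (d i) c p q := fun p q =>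
    Finset.sum_nonneg fun i _ => hcone0 i p q
  refine ⟨fun p q => ⟨fun h => ?_, ?_⟩, fun p q => ?_, fun p q r => ?_, ?_, fun I V => ⟨?_, ?_⟩⟩
  · have h1 : |(τ p : ℝ) - τ q| = 0 := by linarith [abs_nonneg ((τ p : ℝ) - τ q), hsum0 p q]
    have h2 : ∑ i, coneDist (fun p => W i (τ p)) (d i) c p q = 0 := by linarith
    have h3 : τ p = τ q := Subtype.ext (sub_eq_zero.1 (abs_eq_zero.1 h1))
    refine hsep p q h3 fun i hi => ?_
    -- At equal parameters the height terms vanish, so each cone distance is the weight times `d i`.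
    have h4 := (Finset.sum_eq_zero_iff_of_nonneg fun i _ => hcone0 i p q).1 h2 i (Finset.mem_univ i)
    simp only [coneDist, ← h3, min_self, sub_self, abs_zero, mul_zero, add_zero] at h4
    exact (mul_eq_zero.1 h4).resolve_left hi.ne'
  · rintro rfl
    simp [coneDist_self (hdself _)]
  · simp only [coneDist_comm (hdsymm _) p q, abs_sub_comm (τ p : ℝ)]
  · have h1 := abs_sub_le (τ p : ℝ) (τ q) (τ r)
    have h2 := Finset.sum_le_sum fun i (_ : i ∈ Finset.univ) => coneDist_triangle (w := fun p => W i (τ p))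
      (fun p => hW0 i _) (hd0 i) (hdc i) (hdtri i) p q r
    rw [Finset.sum_add_distrib] at h2
    linarith
  · refine ⟨1 + ∑ _i : ι, (c + c), fun p q => add_le_add ?_ (Finset.sum_le_sum fun i _ =>
      coneDist_le (fun p => hW0 i _) (fun p => hW1 i _) (hd0 i) (hdc i) p q)⟩
    exact abs_sub_le_iff.2 ⟨by linarith [(τ p).2.2, (τ q).2.1], by linarith [(τ p).2.1, (τ q).2.2]⟩
  · intro hV x hx
    obtain ⟨i, hi, h⟩ := hsmall I x
    obtain ⟨δ, hδ, h⟩ := h V (hV.mem_nhds hx)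
    set ω := W i (τ (A.πB I x)) with hω
    -- The bound `c * ω / 2` keeps the weight at `y` above `ω / 2`; then `ω * δ / 2` bounds `d i` by
    -- `δ`, and `δ` itself bounds the parameter distance.
    refine ⟨min δ (min (ω * δ / 2) (c * ω / 2)), by positivity, fun y hy => ?_⟩
    have h1 := lt_min_iff.1 hy
    have h2 := lt_min_iff.1 h1.2
    have h3 : coneDist (fun p => W i (τ p)) (d i) c (A.πB I x) (A.πB I y) ≤
        ∑ i, coneDist (fun p => W i (τ p)) (d i) c (A.πB I x) (A.πB I y) :=
      Finset.single_le_sum (fun i _ => hcone0 i _ _) (Finset.mem_univ i)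
    have h4 := abs_nonneg ((τ (A.πB I x) : ℝ) - τ (A.πB I y))
    have h5 : 0 ≤ min ω (W i (τ (A.πB I y))) * d i (A.πB I x) (A.πB I y) :=
      mul_nonneg (le_min hi.le (hW0 i _)) (hd0 i _ _)
    have h6 : 0 ≤ c * |ω - W i (τ (A.πB I y))| := mul_nonneg hc.le (abs_nonneg _)
    have h7 : coneDist (fun p => W i (τ p)) (d i) c (A.πB I x) (A.πB I y) =
      min ω (W i (τ (A.πB I y))) * d i (A.πB I x) (A.πB I y) +
        c * |ω - W i (τ (A.πB I y))| := rfl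
    have h8 : |ω - W i (τ (A.πB I y))| < ω / 2 := by
      refine lt_of_mul_lt_mul_left ?_ hc.le
      linarith
    have h9 : ω / 2 < W i (τ (A.πB I y)) := by linarith [(abs_lt.1 h8).2]
    refine h y (by linarith [hsum0 (A.πB I x) (A.πB I y)]) (by linarith) ?_
    have h10 : ω / 2 * d i (A.πB I x) (A.πB I y) ≤
        min ω (W i (τ (A.πB I y))) * d i (A.πB I x) (A.πB I y) :=
      mul_le_mul_of_nonneg_right (le_min (by linarith) h9.le) (hd0 i _ _)
    refine lt_of_mul_lt_mul_left (a := ω / 2) ?_ (by linarith)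
    linarith
  · intro h
    refine isOpen_iff_mem_nhds.2 fun x hx => ?_
    obtain ⟨δ, hδ, h⟩ := h x hx
    have ht : Filter.Tendsto (fun y => |(τ (A.πB I x) : ℝ) - τ (A.πB I y)|) (𝓝 x) (𝓝 0) := by
      have : Continuous fun y => |(τ (A.πB I x) : ℝ) - τ (A.πB I y)| :=
        (continuous_const.sub (continuous_subtype_val.comp (hτ I))).abs
      simpa using this.tendsto x
    have hcone : ∀ i, Filter.Tendsto
        (fun y => coneDist (fun p => W i (τ p)) (d i) c (A.πB I x) (A.πB I y)) (𝓝 x) (𝓝 0) := by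
      intro i
      have hw : Continuous fun y => W i (τ (A.πB I y)) := (hWc i).comp (hτ I)
      have h2 : Filter.Tendsto (fun y => c * |W i (τ (A.πB I x)) - W i (τ (A.πB I y))|)
          (𝓝 x) (𝓝 0) := by
        have : Continuous fun y => c * |W i (τ (A.πB I x)) - W i (τ (A.πB I y))| :=
          continuous_const.mul (continuous_const.sub hw).abs
        simpa using this.tendsto x
      have h1 : Filter.Tendsto (fun y => min (W i (τ (A.πB I x))) (W i (τ (A.πB I y))) *
          d i (A.πB I x) (A.πB I y)) (𝓝 x) (𝓝 0) := by
        -- If the weight vanishes at `x`, the `d i` term is identically zero, so nothing about `d i`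
        -- is needed there.
        rcases (hW0 i (τ (A.πB I x))).eq_or_lt with h0 | h0
        · simp only [← h0, min_eq_left (hW0 i _), zero_mul]
          exact tendsto_const_nhds
        · have hmin : Continuous fun y => min (W i (τ (A.πB I x))) (W i (τ (A.πB I y))) :=
            continuous_const.min hw
          have := (hmin.tendsto x).mul (hcont i I x h0)
          simpa using this
      simpa [coneDist] using h1.add h2
    have hsum := ht.add (tendsto_finsetSum Finset.univ fun i _ => hcone i)
    simp only [Finset.sum_const_zero, add_zero] at hsum
    filter_upwards [hsum.eventually_lt_const hδ] with y hy using h y hy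

end WeakAtlas

end Kuranishi

/-! ### Collared metrics on the concordance. -/

namespace Kuranishi

/-- The function which is `1` on the closed collar of width `a / 2` of `α` and is positive on the
collar of width `a`. -/
noncomputable def endWeight (a : ℝ) (α : Fin 2) (t : unitInterval) : ℝ :=
  max 0 (min 1 (2 - 2 * |(t : ℝ) - endpt α| / a))

/-- The function which vanishes on the collars of width `a / 2` and is positive elsewhere. -/
noncomputable def midWeight (a : ℝ) (t : unitInterval) : ℝ :=
  max 0 (min |(t : ℝ) - endpt 0| |(t : ℝ) - endpt 1| - a / 2)

section Weights

variable {a : ℝ} {α : Fin 2} {t : unitInterval}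

theorem continuous_endWeight (a : ℝ) (α : Fin 2) : Continuous (endWeight a α) := by
  unfold endWeight
  fun_prop

theorem continuous_midWeight (a : ℝ) : Continuous (midWeight a) := by
  unfold midWeight
  fun_prop

theorem endWeight_eq_one (ha : 0 < a) (h : |(t : ℝ) - endpt α| ≤ a / 2) :
    endWeight a α t = 1 := by
  have h1 : 2 * |(t : ℝ) - endpt α| / a ≤ 1 := (div_le_one ha).2 (by linarith)
  rw [endWeight, min_eq_left (by linarith), max_eq_right zero_le_one]

theorem endWeight_pos_iff (ha : 0 < a) : 0 < endWeight a α t ↔ t ∈ collar α a := by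
  rw [endWeight, lt_max_iff, lt_min_iff, mem_collar, sub_pos, div_lt_iff₀ ha]
  constructor
  · rintro (h | ⟨-, h⟩)
    · exact absurd h (lt_irrefl _)
    · linarith
  · exact fun h => Or.inr ⟨one_pos, by linarith⟩

theorem midWeight_pos_iff : 0 < midWeight a t ↔ ∀ α, a / 2 < |(t : ℝ) - endpt α| := by
  rw [midWeight, lt_max_iff, sub_pos, lt_min_iff, Fin.forall_fin_two]
  simp

theorem midWeight_eq_zero (h : |(t : ℝ) - endpt α| ≤ a / 2) : midWeight a t = 0 := by
  refine le_antisymm ?_ (le_max_left _ _)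
  by_contra hpos
  exact absurd h (not_le.2 (midWeight_pos_iff.1 (not_le.1 hpos) α))

theorem midWeight_le_one (ha : 0 < a) : midWeight a t ≤ 1 := by
  have h := abs_sub_endpt_add (zero_ne_one (α := Fin 2)) t
  refine max_le zero_le_one ?_
  have := min_le_left |(t : ℝ) - endpt 0| |(t : ℝ) - endpt 1|
  linarith [abs_nonneg ((t : ℝ) - endpt 1)]

theorem endWeight_eq_zero (ha : 0 < a) (h : t ∉ collar α a) : endWeight a α t = 0 :=
  le_antisymm (not_lt.1 fun h' => h ((endWeight_pos_iff ha).1 h')) (le_max_left _ _)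

end Weights

variable {X : Type u} [TopologicalSpace X]

namespace WeakAtlas

variable {K : WeakAtlas.{u, v} X}

namespace Shrinking

variable [CompactSpace X] {S : Fin 2 → K.Shrinking} {B : K.Shrinking} {a m : ℝ}
  (ha : 0 < a) (hm : 0 < m) (ham : a + m < 1 / 2) (hSB : ∀ α, ⋃ i, (S α).F i ∩ B.F i = univ)

/-- The parameter of a point in the realization of an interpolating shrinking. -/
def interpTime : (interp S B a m ha hm ham hSB).atlas.RealB → unitInterval :=
  Quot.lift (fun p => p.2.1.1) fun _ _ h => fst_eq_of_morB ha hm ham hSB h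

/-- The slice over a parameter in a collar of the realization of an interpolating shrinking. -/
def interpSlice (α : Fin 2) (t : collar α a) (p : (S α).atlas.RealB) :
    (interp S B a m ha hm ham hSB).atlas.RealB :=
  Quot.lift (fun p : (S α).atlas.ObjB => (interp S B a m ha hm ham hSB).atlas.πB (show K.idx from p.1)
      (collarU ha hm ham hSB α p.1 (t, p.2)))
    (fun _ _ h => Quot.sound ((morB_collarU_iff ha hm ham hSB).2 ⟨rfl, h⟩)) p

open Classical in
/-- The projection of a collar of the realization of an interpolating shrinking to the realization
of the corresponding end. -/
noncomputable def interpEnd (α : Fin 2) (p : (interp S B a m ha hm ham hSB).atlas.RealB) :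
    Option (S α).atlas.RealB :=
  Quot.lift (fun p => if h : p.2.1.1 ∈ collar α a then some ((S α).atlas.πB p.1
      ⟨p.2.1.2, (mem_interp_U_iff ha hm ham hSB h p.1 p.2.1.2).1 p.2.2⟩) else none)
    (by
      rintro ⟨I, x⟩ ⟨J, y⟩ h
      have h1 := fst_eq_of_morB ha hm ham hSB h
      by_cases hx : x.1.1 ∈ collar α a
      · have hy : y.1.1 ∈ collar α a := h1 ▸ hx
        obtain ⟨s, x', -, rfl⟩ := exists_collarU_eq ha hm ham hSB x hx
        obtain ⟨s', y', -, rfl⟩ := exists_collarU_eq ha hm ham hSB y hy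
        simp only [dif_pos hx, dif_pos hy]
        exact congrArg some (Quot.sound ((morB_collarU_iff ha hm ham hSB).1 h).2)
      · have hy : y.1.1 ∉ collar α a := h1 ▸ hx
        simp only [dif_neg hx, dif_neg hy]) p

theorem interpEnd_πB (α : Fin 2) (I : K.idx) (t : collar α a) (x : (S α).U I) :
    interpEnd ha hm ham hSB α ((interp S B a m ha hm ham hSB).atlas.πB I
      (collarU ha hm ham hSB α I (t, x))) = some ((S α).atlas.πB I x) :=
  dif_pos t.2

theorem exists_eq_interpSlice {α : Fin 2} (p : (interp S B a m ha hm ham hSB).atlas.RealB)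
    (hp : interpTime ha hm ham hSB p ∈ collar α a) :
    ∃ x, interpEnd ha hm ham hSB α p = some x ∧ interpSlice ha hm ham hSB α ⟨_, hp⟩ x = p := by
  obtain ⟨⟨I, x⟩, rfl⟩ := Quot.exists_rep p
  exact ⟨_, dif_pos hp, rfl⟩

/-- The pullback to the collar of a distance function at an end of an interpolating shrinking. -/
noncomputable def endDist (d : ∀ α, (S α).atlas.RealB → (S α).atlas.RealB → ℝ) (α : Fin 2)
    (p q : (interp S B a m ha hm ham hSB).atlas.RealB) : ℝ :=
  (interpEnd ha hm ham hSB α p).elim 0 fun x => (interpEnd ha hm ham hSB α q).elim 0 fun y =>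
    d α x y

variable {d : ∀ α, (S α).atlas.RealB → (S α).atlas.RealB → ℝ}

/-- The triangle inequality is absent because it can fail: the value is `0` as soon as one point is
outside the collar. There the weight of the end vanishes. -/
theorem endDist_facts (hd : ∀ α, (S α).atlas.IsAdmissibleMetric (d α)) (α : Fin 2) :
    (∀ p q, 0 ≤ endDist ha hm ham hSB d α p q) ∧ (∀ p, endDist ha hm ham hSB d α p p = 0) ∧
    (∀ p q, endDist ha hm ham hSB d α p q = endDist ha hm ham hSB d α q p) := by
  refine ⟨fun p q => ?_, fun p => ?_, fun p q => ?_⟩ <;> unfold endDist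
  · rcases interpEnd ha hm ham hSB α p with _ | x <;>
      rcases interpEnd ha hm ham hSB α q with _ | y <;> simp [(hd α).nonneg]
  · rcases interpEnd ha hm ham hSB α p with _ | x <;> simp [(hd α).self]
  · rcases interpEnd ha hm ham hSB α p with _ | x <;>
      rcases interpEnd ha hm ham hSB α q with _ | y <;> simp [(hd α).symm]

theorem endDist_collarU {α : Fin 2} {I J : K.idx} (t s : collar α a) (x : (S α).U I)
    (y : (S α).U J) : endDist ha hm ham hSB d α
      ((interp S B a m ha hm ham hSB).atlas.πB I (collarU ha hm ham hSB α I (t, x)))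
      ((interp S B a m ha hm ham hSB).atlas.πB J (collarU ha hm ham hSB α J (s, y))) =
      d α ((S α).atlas.πB I x) ((S α).atlas.πB J y) := by
  simp only [endDist, interpEnd_πB, Option.elim_some]

/-- The weights for the construction of a collared metric. -/
noncomputable def collarWeight (a : ℝ) (o : Option (Fin 2)) : unitInterval → ℝ :=
  o.elim (midWeight a) (endWeight a)

/-- The distance functions from which a collared metric is constructed. -/
noncomputable def collarDist (d : ∀ α, (S α).atlas.RealB → (S α).atlas.RealB → ℝ)
    (D : (interp S B a m ha hm ham hSB).atlas.RealB →
      (interp S B a m ha hm ham hSB).atlas.RealB → ℝ) (o : Option (Fin 2)) :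
    (interp S B a m ha hm ham hSB).atlas.RealB →
      (interp S B a m ha hm ham hSB).atlas.RealB → ℝ :=
  o.elim D (endDist ha hm ham hSB d)

variable {D : (interp S B a m ha hm ham hSB).atlas.RealB →
  (interp S B a m ha hm ham hSB).atlas.RealB → ℝ}

theorem tendsto_endDist (hd : ∀ α, (S α).atlas.IsAdmissibleMetric (d α)) {α : Fin 2} {I : K.idx}
    (t : collar α a) (x : (S α).U I) :
    Filter.Tendsto (fun y : (interp S B a m ha hm ham hSB).U I => endDist ha hm ham hSB d α
      ((interp S B a m ha hm ham hSB).atlas.πB I (collarU ha hm ham hSB α I (t, x)))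
      ((interp S B a m ha hm ham hSB).atlas.πB I y))
      (𝓝 (collarU ha hm ham hSB α I (t, x))) (𝓝 0) := by
  rw [← (isOpenEmbedding_collarU ha hm ham hSB α I).map_nhds_eq, Filter.tendsto_map'_iff]
  exact (((hd α).tendsto (I := I) x).comp (continuous_snd.tendsto (t, x))).congr fun q =>
    (endDist_collarU ha hm ham hSB t q.1 x q.2).symm

/-- On the collar, neighbourhoods contain products, so smallness in the parameter and in `d α`
together force `y` into `V`. -/
theorem exists_endDist_of_mem_nhds (hd : ∀ α, (S α).atlas.IsAdmissibleMetric (d α)) {α : Fin 2}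
    {I : K.idx} (t : collar α a) (x : (S α).U I) {V : Set ((interp S B a m ha hm ham hSB).U I)}
    (hV : V ∈ 𝓝 (collarU ha hm ham hSB α I (t, x))) :
    ∃ δ > 0, ∀ y : (interp S B a m ha hm ham hSB).U I, |(t.1 : ℝ) - y.1.1| < δ →
      y.1.1 ∈ collar α a → endDist ha hm ham hSB d α
      ((interp S B a m ha hm ham hSB).atlas.πB I (collarU ha hm ham hSB α I (t, x)))
      ((interp S B a m ha hm ham hSB).atlas.πB I y) < δ → y ∈ V := by
  have h := (isOpenEmbedding_collarU ha hm ham hSB α I).continuous.continuousAt.preimage_mem_nhds hV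
  obtain ⟨V₁, h₁, V₂, h₂, h₁₂⟩ := mem_nhds_prod_iff.1 h
  obtain ⟨δ₁, hδ₁, h₁⟩ := Metric.mem_nhds_iff.1 h₁
  obtain ⟨δ₂, hδ₂, h₂⟩ := (hd α).exists_of_mem_nhds (I := I) h₂
  refine ⟨min δ₁ δ₂, lt_min hδ₁ hδ₂, fun y hy1 hy hy2 => ?_⟩
  obtain ⟨s, y', -, rfl⟩ := exists_collarU_eq ha hm ham hSB y hy
  rw [endDist_collarU] at hy2
  refine h₁₂ ⟨h₁ ?_, h₂ _ (hy2.trans_le (min_le_right _ _))⟩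
  rw [Metric.mem_ball, dist_comm]
  exact hy1.trans_le (min_le_left _ _)

/-- The index `none` carries the metric `D` with weight zero on the collars of width `a / 2`, and
`some α` carries the pullback of `d α` with weight positive exactly on the collar of width `a`. Some
weight is positive at every parameter, so the glued function separates points and controls
neighbourhoods. -/
theorem isAdmissibleMetric_collar (hd : ∀ α, (S α).atlas.IsAdmissibleMetric (d α))
    (hD : (interp S B a m ha hm ham hSB).atlas.IsAdmissibleMetric D) {c : ℝ} (hc : 0 < c)
    (hdc : ∀ α p q, d α p q ≤ c) (hDc : ∀ p q, D p q ≤ c) :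
    (interp S B a m ha hm ham hSB).atlas.IsAdmissibleMetric (fun p q =>
      |(interpTime ha hm ham hSB p : ℝ) - interpTime ha hm ham hSB q| +
        ∑ o, coneDist (fun p => collarWeight a o (interpTime ha hm ham hSB p))
          (collarDist ha hm ham hSB d D o) c p q) := by
  have hf := endDist_facts ha hm ham hSB hd
  refine isAdmissibleMetric_glue hc ?_ ?_ ?_ (fun I => show Continuous fun x : (interp S B a m ha hm ham hSB).U I => x.1.1 from
    continuous_fst.comp continuous_subtype_val) ?_ ?_ ?_ ?_ ?_ ?_ ?_ ?_
  · rintro (_ | α) t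
    · exact le_max_left _ _
    · exact le_max_left _ _
  · rintro (_ | α) t
    · exact midWeight_le_one ha
    · exact max_le zero_le_one (min_le_left _ _)
  · rintro (_ | α)
    · exact continuous_midWeight a
    · exact continuous_endWeight a α
  · rintro (_ | α)
    · exact hD.nonneg
    · exact (hf α).1
  · rintro (_ | α) p q
    · exact hDc p q
    · change endDist ha hm ham hSB d α p q ≤ c
      unfold endDist
      rcases interpEnd ha hm ham hSB α p with _ | x <;>
        rcases interpEnd ha hm ham hSB α q with _ | y <;> simp [hdc, hc.le]
  · rintro (_ | α)
    · exact hD.self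
    · exact (hf α).2.1
  · rintro (_ | α)
    · exact hD.symm
    · exact (hf α).2.2
  · rintro (_ | α) p q r hp hq hr
    · exact hD.triangle p q r
    · obtain ⟨x, hx, -⟩ := exists_eq_interpSlice ha hm ham hSB p ((endWeight_pos_iff ha).1 hp)
      obtain ⟨y, hy, -⟩ := exists_eq_interpSlice ha hm ham hSB q ((endWeight_pos_iff ha).1 hq)
      obtain ⟨z, hz, -⟩ := exists_eq_interpSlice ha hm ham hSB r ((endWeight_pos_iff ha).1 hr)
      simp only [collarDist, endDist, hx, hy, hz, Option.elim_some]
      exact (hd α).triangle x y z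
  · intro p q hpq h
    -- Within `a / 2` of an end, `d α` separates points of a slice; elsewhere the weight of `D` is
    -- positive.
    by_cases hα : ∃ α, |(interpTime ha hm ham hSB p : ℝ) - endpt α| ≤ a / 2
    · obtain ⟨α, hα⟩ := hα
      have hp : interpTime ha hm ham hSB p ∈ collar α a := by rw [mem_collar]; linarith
      have hq : interpTime ha hm ham hSB q ∈ collar α a := hpq ▸ hp
      obtain ⟨x, hx, hxp⟩ := exists_eq_interpSlice ha hm ham hSB p hp
      obtain ⟨y, hy, hyq⟩ := exists_eq_interpSlice ha hm ham hSB q hq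
      have h1 := h (some α) ((endWeight_pos_iff ha).2 hp)
      simp only [collarDist, endDist, hx, hy, Option.elim_some] at h1
      rw [← hxp, ← hyq, ((hd α).eq_zero_iff x y).1 h1]
      congr 2
    · push Not at hα
      exact (hD.eq_zero_iff p q).1 (h none (midWeight_pos_iff.2 hα))
  · rintro (_ | α) I x hx
    · exact hD.tendsto x
    · obtain ⟨t, x, -, rfl⟩ := exists_collarU_eq ha hm ham hSB x ((endWeight_pos_iff ha).1 hx)
      exact tendsto_endDist ha hm ham hSB hd t x
  · intro I x
    by_cases hα : ∃ α, |((show (interp S B a m ha hm ham hSB).U I from x).1.1 : ℝ) - endpt α| ≤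
        a / 2
    · obtain ⟨α, hα⟩ := hα
      obtain ⟨t, x, -, rfl⟩ := exists_collarU_eq ha hm ham hSB x
        (show _ < a by linarith)
      refine ⟨some α, (endWeight_pos_iff ha).2 t.2, fun V hV => ?_⟩
      obtain ⟨δ, hδ, h⟩ := exists_endDist_of_mem_nhds ha hm ham hSB hd t x hV
      exact ⟨δ, hδ, fun y h1 h2 h3 => h y h1 ((endWeight_pos_iff ha).1 h2) h3⟩
    · push Not at hα
      refine ⟨none, midWeight_pos_iff.2 hα, fun V hV => ?_⟩
      obtain ⟨δ, hδ, h⟩ := hD.exists_of_mem_nhds hV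
      exact ⟨δ, hδ, fun y _ _ h3 => h y h3⟩

/-- The concordance given by an interpolating shrinking has an admissible metric that is collared
with given restrictions, provided it has some admissible metric. -/
theorem exists_isCollaredMetric (hd : ∀ α, (S α).atlas.IsAdmissibleMetric (d α))
    (hD : (interp S B a m ha hm ham hSB).atlas.IsAdmissibleMetric D) :
    ∃ D' : (interp S B a m ha hm ham hSB).atlas.RealB →
        (interp S B a m ha hm ham hSB).atlas.RealB → ℝ,
      (interp S B a m ha hm ham hSB).atlas.IsAdmissibleMetric D' ∧
      (concordance ha hm ham hSB).IsCollaredMetric D' d := by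
  obtain ⟨c₀, h₀⟩ := (hd 0).bounded
  obtain ⟨c₁, h₁⟩ := (hd 1).bounded
  obtain ⟨c₂, h₂⟩ := hD.bounded
  -- One slope must dominate all three metrics; the maximum with `1` makes it positive.
  obtain ⟨c, hc, hdc, hDc⟩ : ∃ c : ℝ, 0 < c ∧ (∀ α p q, d α p q ≤ c) ∧ ∀ p q, D p q ≤ c := by
    refine ⟨max 1 (max c₀ (max c₁ c₂)), by positivity, ?_, fun p q => (h₂ p q).trans (by simp)⟩
    exact Fin.forall_fin_two.2 ⟨fun p q => (h₀ p q).trans (by simp),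
      fun p q => (h₁ p q).trans (by simp)⟩
  have hadm := isAdmissibleMetric_collar ha hm ham hSB hd hD hc hdc hDc
  -- On the collar of width `a / 2` the weight of `α` is `1` and the other two vanish, so the sum
  -- reduces to `d α`. The lower bound for points outside comes from the parameter term alone.
  refine ⟨_, hadm, a / 2, by positivity, by change a / 2 ≤ a; linarith, fun α => ⟨?_, ?_⟩⟩
  · intro I J t t' x y ht ht'
    change |(t.1 : ℝ) - t'.1| + ∑ o, coneDist _ _ c _ _ = _
    have ht1 := (mem_collar.1 ht).le
    have ht2 := (mem_collar.1 ht').le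
    rw [abs_sub_comm (t.1 : ℝ), Fintype.sum_eq_single (some α)]
    · simp only [coneDist]
      change _ + (min (endWeight a α t.1) (endWeight a α t'.1) * endDist ha hm ham hSB d α
          ((interp S B a m ha hm ham hSB).atlas.πB I (collarU ha hm ham hSB α I (t, x)))
          ((interp S B a m ha hm ham hSB).atlas.πB J (collarU ha hm ham hSB α J (t', y))) +
        c * |endWeight a α t.1 - endWeight a α t'.1|) = _
      rw [endWeight_eq_one ha ht1, endWeight_eq_one ha ht2]
      simp only [min_self, one_mul, sub_self, abs_zero, mul_zero, add_zero]
      exact congrArg (|(t'.1 : ℝ) - t.1| + ·)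
        (endDist_collarU ha hm ham hSB (I := I) (J := J) t t' x y)
    · rintro (_ | β) hβ
      · simp only [coneDist]
        change min (midWeight a t.1) (midWeight a t'.1) * _ +
          c * |midWeight a t.1 - midWeight a t'.1| = 0
        rw [midWeight_eq_zero ht1, midWeight_eq_zero ht2]
        simp
      · have hne : α ≠ β := fun h => hβ (h ▸ rfl)
        have key : ∀ s : unitInterval, |(s : ℝ) - endpt α| ≤ a / 2 → endWeight a β s = 0 :=
          fun s hs => endWeight_eq_zero ha fun h => by
            have := abs_sub_endpt_add hne s
            rw [mem_collar] at h
            linarith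
        simp only [coneDist]
        change min (endWeight a β t.1) (endWeight a β t'.1) * _ +
          c * |endWeight a β t.1 - endWeight a β t'.1| = 0
        rw [key _ ht1, key _ ht2]
        simp
  · intro p hp I t x ht
    have hp' : a / 2 ≤ |(interpTime ha hm ham hSB p : ℝ) - endpt α| := by
      by_contra hlt
      obtain ⟨⟨J, y⟩, rfl⟩ := Quot.exists_rep p
      obtain ⟨s, y, -, rfl⟩ := exists_collarU_eq ha hm ham hSB y
        (collar_mono (by linarith) (mem_collar.2 (not_le.1 hlt)))
      exact hp J s y (mem_collar.2 (not_le.1 hlt)) rfl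
    have hf := endDist_facts ha hm ham hSB hd
    have h1 : 0 ≤ ∑ o, coneDist (fun p => collarWeight a o (interpTime ha hm ham hSB p))
        (collarDist ha hm ham hSB d D o) c p ((interp S B a m ha hm ham hSB).atlas.πB I
          (collarU ha hm ham hSB α I (t, x))) := by
      refine Finset.sum_nonneg fun o _ => ?_
      rcases o with _ | β
      · exact coneDist_nonneg (fun p => le_max_left _ _) hD.nonneg hc.le _ _
      · exact coneDist_nonneg (fun p => le_max_left _ _) (hf β).1 hc.le _ _
    have h2 := abs_sub_le (interpTime ha hm ham hSB p : ℝ) t.1 (endpt α)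
    exact le_trans (by change a / 2 - |(t.1 : ℝ) - endpt α| ≤ _; linarith)
      (add_le_add (le_refl |(interpTime ha hm ham hSB p : ℝ) - t.1|) h1)

end Shrinking

end WeakAtlas

end Kuranishi

/-! ### The main theorem. -/

theorem mainTheorem1 {X : Type u} [TopologicalSpace X] [CompactSpace X] [MetrizableSpace X]
    (K : Kuranishi.WeakAtlas.{u, v} X) (𝓔 : K.Filtration) :
    (∃ S : K.Shrinking, S.IsPreshrunkTame 𝓔) ∧
    (∀ S : K.Shrinking, S.IsPreshrunkTame 𝓔 →
      S.atlas.IsAtlas ∧ S.atlas.IsTame (S.filtration 𝓔) ∧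
      (∃ d, S.atlas.IsAdmissibleMetric d) ∧ S.atlas.HausdorffHomeo) ∧
    (∀ (S : Fin 2 → K.Shrinking) (d : ∀ α, (S α).atlas.RealB → (S α).atlas.RealB → ℝ),
      (∀ α, (S α).IsPreshrunkTame 𝓔) → (∀ α, (S α).atlas.IsAdmissibleMetric (d α)) →
      ∃ (C : Kuranishi.Concordance (fun α => (S α).atlas)) (𝓔C : C.atlas.Filtration)
        (D : C.atlas.RealB → C.atlas.RealB → ℝ),
        C.atlas.IsAtlas ∧ C.IsFilteredBy 𝓔C (fun α => (S α).filtration 𝓔) ∧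
        C.atlas.IsTame 𝓔C ∧ C.atlas.IsAdmissibleMetric D ∧ C.IsCollaredMetric D d ∧
        C.atlas.HausdorffHomeo) := by
  have h2 : ∀ S : K.Shrinking, S.IsPreshrunkTame 𝓔 →
      S.atlas.HausdorffHomeo ∧ ∃ d, S.atlas.IsAdmissibleMetric d :=
    fun S hS => hS.hausdorffHomeo_and_metric
  refine ⟨?_, fun S hS => ⟨hS.1.1, hS.1.2, (h2 S hS).2, (h2 S hS).1⟩, fun S d hS hd => ?_⟩
  · obtain ⟨S, hS, -⟩ := Kuranishi.WeakAtlas.exists_isPreshrunkTame K 𝓔 (fun _ => ∅)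
      (fun _ => isClosed_empty) (fun _ => empty_subset _)
    exact ⟨S, hS⟩
  -- The footprints of `B` contain those of both ends, so `S α ∩ B` has the footprints of `S α` and
  -- still covers `X`.
  · obtain ⟨B, hB, hBF⟩ := Kuranishi.WeakAtlas.exists_isPreshrunkTame K 𝓔
      (fun i => closure ((S 0).F i) ∪ closure ((S 1).F i))
      (fun i => isClosed_closure.union isClosed_closure)
      (fun i => union_subset ((S 0).closure_F i).2 ((S 1).closure_F i).2)
    have hSF : ∀ α i, (S α).F i ⊆ B.F i := Fin.forall_fin_two.2
      ⟨fun i => subset_closure.trans (subset_union_left.trans (hBF i)),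
        fun i => subset_closure.trans (subset_union_right.trans (hBF i))⟩
    have hSB : ∀ α, ⋃ i, (S α).F i ∩ B.F i = univ := fun α => by
      simp only [inter_eq_self_of_subset_left (hSF α _)]
      exact (S α).cover_F
    -- Any positive `a`, `m` with `a + m < 1/2` would serve.
    have ha : (0 : ℝ) < 1 / 5 := by norm_num
    have hm : (0 : ℝ) < 1 / 10 := by norm_num
    have ham : (1 / 5 : ℝ) + 1 / 10 < 1 / 2 := by norm_num
    have hI := Kuranishi.WeakAtlas.Shrinking.isPreshrunkTame_interp ha hm ham hSB hS hB
    obtain ⟨hH, D, hD⟩ := hI.hausdorffHomeo_and_metric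
    obtain ⟨D', hD', hcol⟩ :=
      Kuranishi.WeakAtlas.Shrinking.exists_isCollaredMetric ha hm ham hSB hd hD
    exact ⟨Kuranishi.WeakAtlas.Shrinking.concordance ha hm ham hSB, _, D', hI.1.1,
      Kuranishi.WeakAtlas.Shrinking.concordance_isFilteredBy ha hm ham hSB 𝓔, hI.1.2, hD', hcol,
      hH⟩
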